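/- **Setting.** Let $\Omega\subset\mathbb R^N$ ($N\ge1$) be a bounded domain (non-empty, open, connected). Let $A=(A_{ij})$ be a real symmetric matrix-valued function on $\mathbb R^N$ with entries in $L^\infty(\mathbb R^N)$ and $\theta^{-1}|\xi|^2\le\sum_{i,j}A_{ij}(x)\xi_i\xi_j\le\theta|\xi|^2$ for all $x,\xi\in\mathbb R^N$ and some $\theta\ge1$. Let $\phi,\tilde\phi$ be homeomorphisms of $\Omega$ onto open sets $\phi(\Omega),\tilde\phi(\Omega)\subset\mathbb R^N$, Lipschitz continuous together with their inverses. Fix either Dirichlet or Neumann boundary conditions, and accordingly let $\mathcal W=W^{1,2}_0(\phi(\Omega))$ or $\mathcal W=W^{1,2}(\phi(\Omega))$, and likewise $\tilde{\mathcal W}$ for $\tilde\phi(\Omega)$. Put $$g=|\det\nabla\phi|,\qquad a=(\nabla\phi)^{-1}A(\phi)(\nabla\phi)^{-t},\qquad w=g^{1/2}\tilde g^{-1/2},\qquad S=w^{-2}a^{-1/2}\tilde a\,a^{-1/2},$$ with $\tilde g,\tilde a$ defined from $\tilde\phi$. All spaces are complex. * $H$ is the non-negative self-adjoint operator in $L^2(\Omega,g\,dx)$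 associated with the form $\int_\Omega (a\nabla u\cdot\nabla\bar u)\,g\,dx$ on $\{v\circ\phi:v\in\mathcal W\}$; $\tilde H$ in $L^2(\Omega,\tilde g\,dx)$ is defined in the same way from $\tilde\phi$. * $T^*ST$ is the non-negative self-adjoint operator in $L^2(\Omega,g\,dx)$ associated with the form $\int_\Omega(\tilde a\nabla u\cdot\nabla\bar u)\,\tilde g\,dx$ on $\{v\circ\phi:v\in\mathcal W\}$ (that is, with $\|S^{1/2}Tu\|^2_{L^2(\Omega,g\,dx)}$, $Tu=a^{1/2}\nabla u$). * $w^{-1}\tilde Hw$ is the operator in $L^2(\Omega,g\,dx)$ obtained from $\tilde H$ by the unitary map $u\mapsto wu$ of $L^2(\Omega,g\,dx)$ onto $L^2(\Omega,\tilde g\,dx)$. For a non-negative self-adjoint operator $E$ with compact resolvent let $\lambda_1[E]\le\lambda_2[E]\le\dots$ be its eigenvalues, repeated according to multiplicity, and $\psi_n[E]$ a corresponding complete orthonormal sequence of eigenfunctions. Let $\alpha,C_1,\gamma,C_2\in(0,\infty)$ and $q_0\in(2,\infty]$. Assume that $H$, $\tilde H$ and $T^*ST$ have compact resolvent and that the eigenvalues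 of each of them satisfy $\lambda_n\ge C_1n^{1/\alpha}$ for all $n$ with $\lambda_n\neq0$. An operator $E$ in $L^2(\Omega,g\,dx)$ has property * (P1) if, for some choice of the $\psi_n[E]$, $\|\psi_n[E]\|_{L^{q_0}(\Omega,g\,dx)}\le C_2\lambda_n[E]^{\gamma}$ for all $n$ with $\lambda_n[E]\ne0$; * (P2) if, for some choice of the $\psi_n[E]$, $\|\nabla\psi_n[E]\|_{L^{q_0}(\Omega,g\,dx)}\le C_2\lambda_n[E]^{\frac12+\gamma}$ for all $n$. For $0<q<\infty$ let $$\delta_q(\phi,\tilde\phi)=\|w-1\|+\|w^{-1}-1\|+\|(S^{1/2}-S^{-1/2})a^{1/2}\|+\|(S-I)a^{1/2}\|,$$ all norms being those of $L^q(\Omega,g\,dx)$, with the Euclidean operator norm for matrices. **Theorem (stability of resolvents).** Assume that $H$ and $T^*ST$ satisfy (P1) and (P2) and that $w^{-1}\tilde Hw$ satisfies (P1), all with the same parameters $q_0,\gamma,C_2$. Then for all $k\in\mathbb N$ that are large enough, depending only on $\alpha$ and $\gamma$, and for every real $s>q_0(\alpha+2\gamma)/(q_0-2)$ there is $c>0$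 such that $$\big\|(w^{-1}\tilde Hw+1)^{-k}-(H+1)^{-k}\big\|_{\mathcal C^2}\le c\,\big[1+\delta_s(\phi,\tilde\phi)\big]\,\delta_{\frac{2q_0}{q_0-2}}(\phi,\tilde\phi),$$ where $\|\cdot\|_{\mathcal C^2}$ is the Hilbert–Schmidt norm on $L^2(\Omega,g\,dx)$, and $q_0/(q_0-2)=1$ if $q_0=\infty$. The constant $c$ depends only on $\alpha,k,\gamma,s,C_1,C_2$, on the kind of boundary condition and, for Neumann conditions, also on an upper bound for $\|g\|_{L^{q_0}(\Omega)}$ and a positive lower bound for the measure $|\phi(\Omega)|$. In particular, no uniform bound on $\nabla\phi$ enters. -/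

import Mathlib

open MeasureTheory Set
open scoped ENNReal NNReal ContDiff

namespace ResolventStability

noncomputable section

/-! ## Sobolev spaces -/

/-- `ℝ^N` with the Euclidean norm. -/
abbrev Rn (N : ℕ) : Type := EuclideanSpace ℝ (Fin N)

/-- Complex-valued `C^∞` functions on `ℝ^N` with compact support contained in `U`. -/
def IsTestFunction {N : ℕ} (U : Set (Rn N)) (η : Rn N → ℂ) : Prop :=
  ContDiff ℝ ∞ η ∧ HasCompactSupport η ∧ tsupport η ⊆ U

/-- The classical gradient `(∂η/∂x_1, …, ∂η/∂x_N)` of a complex-valued function. -/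
def classicalGrad {N : ℕ} (η : Rn N → ℂ) (x : Rn N) : EuclideanSpace ℂ (Fin N) :=
  WithLp.toLp 2 fun i => fderiv ℝ η x (EuclideanSpace.single i 1)

/-- `V` is the weak gradient of `v` on `U` (both being locally integrable on `U`). -/
def HasWeakGrad {N : ℕ} (U : Set (Rn N)) (v : Rn N → ℂ) (V : Rn N → EuclideanSpace ℂ (Fin N)) :
    Prop :=
  LocallyIntegrableOn v U volume ∧ LocallyIntegrableOn V U volume ∧
    ∀ η : Rn N → ℂ, IsTestFunction U η → ∀ i : Fin N,
      ∫ x in U, v x * classicalGrad η x i = - ∫ x in U, V x i * η x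

/-- The two boundary conditions. -/
inductive BoundaryCondition : Type
  | dirichlet
  | neumann

/-- Membership in the space `𝒲` attached to the boundary condition: `W^{1,2}(U)` for Neumann
conditions, and `W^{1,2}_0(U)`, the closure of the test functions in `W^{1,2}(U)`, for Dirichlet
conditions. -/
def MemSobolev {N : ℕ} (bc : BoundaryCondition) (U : Set (Rn N)) (v : Rn N → ℂ) : Prop :=
  ∃ V : Rn N → EuclideanSpace ℂ (Fin N), HasWeakGrad U v V ∧
    MemLp v 2 (volume.restrict U) ∧ MemLp V 2 (volume.restrict U) ∧
    (bc = BoundaryCondition.dirichlet → ∀ ε : ℝ, 0 < ε → ∃ η : Rn N → ℂ, IsTestFunction U η ∧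
      eLpNorm (fun x => v x - η x) 2 (volume.restrict U) +
        eLpNorm (fun x => V x - classicalGrad η x) 2 (volume.restrict U) < ENNReal.ofReal ε)

/-! ## Coefficients and domain transformations -/

/-- A real symmetric matrix-valued function on `ℝ^N` with entries in `L^∞(ℝ^N)` that satisfies
`θ⁻¹ |ξ|² ≤ ∑ A_ij(x) ξ_i ξ_j ≤ θ |ξ|²` for some `θ ≥ 1`. -/
def IsEllipticCoefficient {N : ℕ} (A : Rn N → Matrix (Fin N) (Fin N) ℝ) : Prop :=
  (∀ i j, MemLp (fun x => A x i j) ∞ volume) ∧ (∀ x, (A x).IsSymm) ∧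
    ∃ θ : ℝ, 1 ≤ θ ∧ ∀ x ξ : Rn N,
      θ⁻¹ * ‖ξ‖ ^ 2 ≤ ∑ i, ∑ j, A x i j * ξ i * ξ j ∧
      ∑ i, ∑ j, A x i j * ξ i * ξ j ≤ θ * ‖ξ‖ ^ 2

/-- `φ` maps `Ω` homeomorphically onto the open set `φ(Ω)`, and both `φ` and its inverse are
Lipschitz continuous. (Only the values of `φ` on `Ω` matter. For open `Ω` the openness of the
image follows from the other two conditions by invariance of domain.) -/
structure IsTransformation {N : ℕ} (Ω : Set (Rn N)) (φ : Rn N → Rn N) : Prop where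
  lipschitz : ∃ K : ℝ≥0, LipschitzOnWith K φ Ω
  inverse_lipschitz : ∃ K : ℝ≥0, ∀ x ∈ Ω, ∀ y ∈ Ω, dist x y ≤ K * dist (φ x) (φ y)
  isOpen_image : IsOpen (φ '' Ω)

/-- The Jacobian matrix `(∇φ)_ij = ∂φ_i/∂x_j`, which for a map that is Lipschitz on the open set
`Ω` exists at almost every point of `Ω` and is there the weak gradient. -/
def jacobian {N : ℕ} (φ : Rn N → Rn N) (x : Rn N) : Matrix (Fin N) (Fin N) ℝ :=
  Matrix.of fun i j => fderiv ℝ φ x (EuclideanSpace.single j 1) i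

/-- `g = |det ∇φ|`. -/
def density {N : ℕ} (φ : Rn N → Rn N) (x : Rn N) : ℝ := |(jacobian φ x).det|

/-- The measure `g dx` on `Ω`. -/
def weightedMeasure {N : ℕ} (Ω : Set (Rn N)) (φ : Rn N → Rn N) : Measure (Rn N) :=
  (volume.restrict Ω).withDensity fun x => ENNReal.ofReal (density φ x)

/-- The complex Hilbert space `L²(Ω, g dx)`. -/
abbrev L2 {N : ℕ} (Ω : Set (Rn N)) (φ : Rn N → Rn N) : Type := Lp ℂ 2 (weightedMeasure Ω φ)

/-- `a = (∇φ)⁻¹ A(φ) (∇φ)⁻ᵗ`. -/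
def pulledCoefficient {N : ℕ} (A : Rn N → Matrix (Fin N) (Fin N) ℝ) (φ : Rn N → Rn N)
    (x : Rn N) : Matrix (Fin N) (Fin N) ℝ :=
  (jacobian φ x)⁻¹ * A (φ x) * ((jacobian φ x)⁻¹).transpose

/-! ## Unbounded operators, represented by their graphs -/

/-- The graph of an operator `E` in `X`: `(u, f)` belongs to it iff `u ∈ dom E` and `E u = f`. -/
abbrev OpGraph (X : Type*) : Type _ := Set (X × X)

/-- The domain `C_φ[𝒲]` of the quadratic forms: all `u = v ∘ φ` with `v ∈ 𝒲`, where `𝒲` is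
`W^{1,2}_0(φ(Ω))` or `W^{1,2}(φ(Ω))`. -/
def MemFormDomain {N : ℕ} (bc : BoundaryCondition) (Ω : Set (Rn N)) (φ : Rn N → Rn N)
    (u : Rn N → ℂ) : Prop :=
  ∃ v : Rn N → ℂ, MemSobolev bc (φ '' Ω) v ∧ u =ᵐ[volume.restrict Ω] v ∘ φ

/-- The operator in `L²(Ω, |det ∇φ| dx)` associated with the (closed) quadratic form
`u ↦ ∫_Ω ∑ b_ij ∂_i u ∂_j ū |det ∇χ| dx`, `b = (∇χ)⁻¹ A(χ) (∇χ)⁻ᵗ`, with domain `C_φ[𝒲]`: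
`E u = f` iff `u` is in the form domain and `Q(u, v) = ⟨f, v⟩` for all `v` in the form domain.
(Mathlib's inner product is conjugate-linear in its first argument.) -/
def formOperator {N : ℕ} (bc : BoundaryCondition) (A : Rn N → Matrix (Fin N) (Fin N) ℝ)
    (Ω : Set (Rn N)) (φ χ : Rn N → Rn N) : OpGraph (L2 Ω φ) :=
  {p | MemFormDomain bc Ω φ p.1 ∧ ∃ U, HasWeakGrad Ω p.1 U ∧
    ∀ (v : L2 Ω φ) (V : Rn N → EuclideanSpace ℂ (Fin N)),
      MemFormDomain bc Ω φ v → HasWeakGrad Ω v V →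
      ∫ x, ∑ i, ∑ j, (pulledCoefficient A χ x i j : ℂ) * U x i * star (V x j)
        ∂(weightedMeasure Ω χ) = inner ℂ v p.2}

/-- The pull-back `H` of `L` to `L²(Ω, g dx)`. -/
def opH {N : ℕ} (bc : BoundaryCondition) (A : Rn N → Matrix (Fin N) (Fin N) ℝ)
    (Ω : Set (Rn N)) (φ : Rn N → Rn N) : OpGraph (L2 Ω φ) :=
  formOperator bc A Ω φ φ

/-- `T*ST`: the operator in `L²(Ω, g dx)` given by the form `∫_Ω (ã ∇u · ∇ū) g̃ dx` on `C_φ[𝒲]`,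
that is, by `‖S^{1/2} T u‖²` in `L²(Ω, g dx)^N`, where `T u = a^{1/2} ∇u` on `C_φ[𝒲]`. -/
def opTST {N : ℕ} (bc : BoundaryCondition) (A : Rn N → Matrix (Fin N) (Fin N) ℝ)
    (Ω : Set (Rn N)) (φ φ' : Rn N → Rn N) : OpGraph (L2 Ω φ) :=
  formOperator bc A Ω φ φ'

/-- `w = g^{1/2} g̃^{-1/2}`. -/
def weight {N : ℕ} (φ φ' : Rn N → Rn N) (x : Rn N) : ℝ :=
  √(density φ x) / √(density φ' x)

/-- `w⁻¹ H̃ w` in `L²(Ω, g dx)`: it sends `u` to `f` iff `H̃ (w u) = w f`. -/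
def opConj {N : ℕ} (bc : BoundaryCondition) (A : Rn N → Matrix (Fin N) (Fin N) ℝ)
    (Ω : Set (Rn N)) (φ φ' : Rn N → Rn N) : OpGraph (L2 Ω φ) :=
  {p | ∃ q ∈ opH bc A Ω φ',
    (q.1 =ᵐ[volume.restrict Ω] fun x => (weight φ φ' x : ℂ) * p.1 x) ∧
    (q.2 =ᵐ[volume.restrict Ω] fun x => (weight φ φ' x : ℂ) * p.2 x)}

section Spectral

variable {X : Type*} [NormedAddCommGroup X] [InnerProductSpace ℂ X]

/-- `R = (E + 1)⁻¹`: the bounded operator `R` is a two-sided inverse of `E + 1`. -/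
def IsResolvent (E : OpGraph X) (R : X →L[ℂ] X) : Prop :=
  (∀ f : X, (R f, f - R f) ∈ E) ∧ ∀ p ∈ E, R (p.2 + p.1) = p.1

def HasCompactResolvent (E : OpGraph X) : Prop :=
  ∃ R : X →L[ℂ] X, IsResolvent E R ∧ IsCompactOperator R

/-- The eigenvalues of `E` in non-decreasing order, repeated according to multiplicity, with a
corresponding complete orthonormal sequence of eigenfunctions; `lam n` is `λ_{n+1}[E]` and `ψ n`
is `ψ_{n+1}[E]`. -/
structure IsEigenSystem (E : OpGraph X) (lam : ℕ → ℝ) (ψ : ℕ → X) : Prop where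
  mono : Monotone lam
  orthonormal : Orthonormal ℂ ψ
  complete : (Submodule.span ℂ (Set.range ψ)).topologicalClosure = ⊤
  eigen : ∀ n, (ψ n, (lam n : ℂ) • ψ n) ∈ E

/-- `λ_n[E] ≥ C₁ n^{1/α}` for all `n = 1, 2, …` with `λ_n[E] ≠ 0`. -/
def EigenvalueGrowth (E : OpGraph X) (α C₁ : ℝ) : Prop :=
  ∀ (lam : ℕ → ℝ) (ψ : ℕ → X), IsEigenSystem E lam ψ →
    ∀ n : ℕ, lam n ≠ 0 → C₁ * ((n : ℝ) + 1) ^ (1 / α) ≤ lam n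

/-- The Hilbert–Schmidt norm `(∑ ‖B e_i‖²)^{1/2}`, `(e_i)` an orthonormal basis, written as the
supremum of the sums over finite orthonormal sets; it is `∞` if `B` is not Hilbert–Schmidt. -/
def hsNorm (B : X →L[ℂ] X) : ℝ≥0∞ :=
  (⨆ (e : Finset X) (_ : Orthonormal ℂ ((↑) : e → X)), ∑ x ∈ e, ‖B x‖ₑ ^ 2) ^ (1 / 2 : ℝ)

end Spectral

/-- Property (P1), for an operator in `L²(Ω, g dx)`. -/
def PropP1 {N : ℕ} {Ω : Set (Rn N)} {φ : Rn N → Rn N} (E : OpGraph (L2 Ω φ))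
    (q₀ : ℝ≥0∞) (γ C₂ : ℝ) : Prop :=
  ∃ (lam : ℕ → ℝ) (ψ : ℕ → L2 Ω φ), IsEigenSystem E lam ψ ∧
    ∀ n, lam n ≠ 0 →
      eLpNorm (ψ n) q₀ (weightedMeasure Ω φ) ≤ ENNReal.ofReal (C₂ * lam n ^ γ)

/-- Property (P2), for an operator in `L²(Ω, g dx)`. -/
def PropP2 {N : ℕ} {Ω : Set (Rn N)} {φ : Rn N → Rn N} (E : OpGraph (L2 Ω φ))
    (q₀ : ℝ≥0∞) (γ C₂ : ℝ) : Prop :=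
  ∃ (lam : ℕ → ℝ) (ψ : ℕ → L2 Ω φ), IsEigenSystem E lam ψ ∧
    ∀ n, ∃ Ψ : Rn N → EuclideanSpace ℂ (Fin N), HasWeakGrad Ω (ψ n) Ψ ∧
      eLpNorm Ψ q₀ (weightedMeasure Ω φ) ≤ ENNReal.ofReal (C₂ * lam n ^ (1 / 2 + γ))

/-! ## The measure of vicinity -/

/-- The square root of a symmetric positive semidefinite matrix. -/
def matSqrt {N : ℕ} (M : Matrix (Fin N) (Fin N) ℝ) : Matrix (Fin N) (Fin N) ℝ :=
  cfc Real.sqrt M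

/-- The operator norm of a matrix with respect to the Euclidean norm. -/
def matNorm {N : ℕ} (M : Matrix (Fin N) (Fin N) ℝ) : ℝ :=
  ‖Matrix.toEuclideanCLM (n := Fin N) (𝕜 := ℝ) M‖

/-- `S = w⁻² a^{-1/2} ã a^{-1/2}`. -/
def matS {N : ℕ} (A : Rn N → Matrix (Fin N) (Fin N) ℝ) (φ φ' : Rn N → Rn N) (x : Rn N) :
    Matrix (Fin N) (Fin N) ℝ :=
  ((weight φ φ' x) ^ 2)⁻¹ • ((matSqrt (pulledCoefficient A φ x))⁻¹ * pulledCoefficient A φ' x *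
    (matSqrt (pulledCoefficient A φ x))⁻¹)

/-- `δ_q^{(1)} = ‖w - 1‖ + ‖w⁻¹ - 1‖`, norms of `L^q(Ω, g dx)`. -/
def delta1 {N : ℕ} (Ω : Set (Rn N)) (φ φ' : Rn N → Rn N) (q : ℝ≥0∞) : ℝ≥0∞ :=
  eLpNorm (fun x => weight φ φ' x - 1) q (weightedMeasure Ω φ) +
    eLpNorm (fun x => (weight φ φ' x)⁻¹ - 1) q (weightedMeasure Ω φ)

/-- `δ_q^{(2)} = ‖(S^{1/2} - S^{-1/2}) a^{1/2}‖ + ‖(S - I) a^{1/2}‖`, norms of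
`L^q(Ω, g dx)`. -/
def delta2 {N : ℕ} (A : Rn N → Matrix (Fin N) (Fin N) ℝ) (Ω : Set (Rn N)) (φ φ' : Rn N → Rn N)
    (q : ℝ≥0∞) : ℝ≥0∞ :=
  eLpNorm (fun x => matNorm ((matSqrt (matS A φ φ' x) - (matSqrt (matS A φ φ' x))⁻¹) *
      matSqrt (pulledCoefficient A φ x))) q (weightedMeasure Ω φ) +
    eLpNorm (fun x => matNorm ((matS A φ φ' x - 1) * matSqrt (pulledCoefficient A φ x))) q
      (weightedMeasure Ω φ)

/-- `δ_q(φ, φ̃) = δ_q^{(1)}(φ, φ̃) + δ_q^{(2)}(φ, φ̃)`. -/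
def delta {N : ℕ} (A : Rn N → Matrix (Fin N) (Fin N) ℝ) (Ω : Set (Rn N)) (φ φ' : Rn N → Rn N)
    (q : ℝ≥0∞) : ℝ≥0∞ :=
  delta1 Ω φ φ' q + delta2 A Ω φ φ' q

/-- The number `q₀ / (q₀ - 2)`, equal to `1` for `q₀ = ∞`. -/
def exponentFactor (q₀ : ℝ≥0∞) : ℝ := (1 - (2 / q₀).toReal)⁻¹

end

end ResolventStability

open ResolventStability

/-! Let `R = (H + 1)⁻¹`, `Q = (T*ST + 1)⁻¹` and `R' = (w⁻¹H̃w + 1)⁻¹`. All three are self-adjoint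
contractions, and `R'` is compared with `R` through `Q`: `R'^k - R^k = (R'^k - Q^k) + (Q^k - R^k)`.

For two self-adjoint contractions `B`, `C` with eigenbases, `B^k - C^k = ∑ C^(k-1-i) (B - C) B^i`.
If `k ≥ 2L + 1`, every term carries at least `L` powers of `B` on the right or of `C` on the left.
In the first case its Hilbert–Schmidt norm is computed in the eigenbasis of `B`, in the second,
after taking the adjoint, in that of `C`. It therefore suffices to bound `‖(B - C)ψ‖` by `δ` times
`(1 + λ)^γ` on the eigenfunctions of both operators: the factor `(1 + λ)^(-L)` with `L ≥ γ + α` and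
the growth `λ_n ≥ C₁ n^(1/α)` leave the convergent series `∑ n⁻²` (`tsum_enorm_pow_sub_pow_sq_le`,
`tsum_weighted_sq_le`).

For `Q - R` the two operators have the same form domain and differ only in the form. If `Hψ = λψ`
and `d = (Q - R)ψ`, then `(1 + λ)‖d‖²` is the difference of the two forms at `(ψ, Qd)`. Factoring `a
- w⁻²ã` as `-((S^(1/2) - S^(-1/2)) a^(1/2))ᵗ (S^(1/2) a^(1/2))` and applying Hölder bounds it by `δ
‖∇ψ‖_{q₀}` times the energy norm of `Qd`, which is at most `‖d‖`; (P2) finishes. For eigenfunctions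
of `T*ST` the factorization with `(S - I) a^(1/2)` is used (`enorm_resolvent_sub_eigenvector_le`).

For `R' - Q` the forms agree and the densities differ. The function `w R'f` solves the equation of
`T*ST` with right-hand side `w⁻¹(f - R'f)`, hence `R' - Q = -(w-1)R' + Q(w⁻¹-1) + Q(w - w⁻¹)R'`
(`WeightMaps.conj_sub`). On eigenfunctions, Hölder and (P1) give the bound, the adjoint identity
serving those of `T*ST`.

Zero eigenvalues, about which (P1) says nothing, occur only for Neumann conditions and are simple,
because `Ω` is connected. The zero mode of `T*ST` is constant, and its `L^{q₀}` norm is controlled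
by the lower bound on `|φ(Ω)|`. The zero mode of `w⁻¹H̃w` is a multiple of `w⁻¹`. There the
difference of the powers is estimated directly, through the distance of `w⁻¹` from the constants,
which needs no `L^{q₀}` bound for `w⁻¹` (`enorm_pow_sub_pow_zero_mode_le`). The resulting bound is
linear in `δ`, with `p = 2q₀/(q₀-2)`; the factor `1 + δ_s ≥ 1` is inserted at the end.

A large part of the file is the analysis behind this: bi-Lipschitz invariance of both Sobolev
spaces, so that all forms live on one domain, and the description of functions with zero gradient.
-/

namespace ResolventStability

/-! ### Hilbert–Schmidt sums and differences of powers of contractions -/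

section HilbertSchmidt

/-- The order of the factors matters: powers of `x` stand on the right, where they meet eigenvectors
of `x`, and powers of `y` on the left, where they meet eigenvectors of `y` after taking adjoints. -/
lemma pow_sub_pow_eq_sum {A : Type*} [Ring A] (x y : A) (k : ℕ) :
    x ^ k - y ^ k = ∑ i ∈ Finset.range k, y ^ (k - 1 - i) * (x - y) * x ^ i := by
  have h := Finset.sum_range_sub (fun i => y ^ (k - i) * x ^ i) k
  simp only [Nat.sub_self, pow_zero, one_mul, Nat.sub_zero, mul_one] at h
  rw [← h]
  refine Finset.sum_congr rfl fun i hi => ?_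
  have hi := Finset.mem_range.1 hi
  rw [show k - i = (k - 1 - i) + 1 by omega, show k - (i + 1) = k - 1 - i by omega, pow_succ y,
    pow_succ' x]
  noncomm_ring

lemma enorm_sum_sq_le {X ι : Type*} [NormedAddCommGroup X] (s : Finset ι) (v : ι → X) :
    ‖∑ i ∈ s, v i‖ₑ ^ 2 ≤ s.card * ∑ i ∈ s, ‖v i‖ₑ ^ 2 := by
  have h1 : ‖∑ i ∈ s, v i‖ ^ 2 ≤ s.card * ∑ i ∈ s, ‖v i‖ ^ 2 :=
    (pow_le_pow_left₀ (norm_nonneg _) (norm_sum_le _ _) 2).trans sq_sum_le_card_mul_sum_sq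
  have h2 := ENNReal.ofReal_le_ofReal h1
  rw [ENNReal.ofReal_mul (by positivity), ENNReal.ofReal_sum_of_nonneg (fun _ _ => sq_nonneg _)] at h2
  simpa [ENNReal.ofReal_pow] using h2

variable {X : Type*} [NormedAddCommGroup X] [InnerProductSpace ℂ X]

/-- A complete orthonormal sequence. -/
def IsCompleteOrthonormal (ψ : ℕ → X) : Prop :=
  Orthonormal ℂ ψ ∧ (Submodule.span ℂ (Set.range ψ)).topologicalClosure = ⊤

lemma pow_apply_eigenvector {B : X →L[ℂ] X} {x : X} {μ : ℂ} (h : B x = μ • x) (n : ℕ) :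
    (B ^ n) x = μ ^ n • x := by
  induction n with
  | zero => simp
  | succ n ih => rw [pow_succ, mul_apply_eq_comp, h, map_smul, ih, smul_smul, pow_succ']

lemma enorm_pow_apply_le {B : X →L[ℂ] X} (hB : ‖B‖ ≤ 1) (n : ℕ) (x : X) : ‖(B ^ n) x‖ₑ ≤ ‖x‖ₑ := by
  have h : ‖(B ^ n) x‖ ≤ ‖x‖ := by
    refine ((B ^ n).le_opNorm x).trans (mul_le_of_le_one_left (norm_nonneg _) ?_)
    rcases Nat.eq_zero_or_pos n with rfl | hn
    · rw [pow_zero]; exact ContinuousLinearMap.norm_id_le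
    · exact (norm_pow_le' B hn).trans (pow_le_one₀ (norm_nonneg _) hB)
  rw [← ofReal_norm, ← ofReal_norm]
  exact ENNReal.ofReal_le_ofReal h

lemma norm_eigenvalue_le_one {B : X →L[ℂ] X} (hB : ‖B‖ ≤ 1) {x : X} (hx : ‖x‖ = 1) {μ : ℂ}
    (h : B x = μ • x) : ‖μ‖ ≤ 1 := by
  have := B.le_opNorm x
  rw [h, norm_smul, hx] at this
  linarith

/-- Powers of `B` beyond the `L`-th multiply the eigenvector by numbers of modulus at most one, and
`C ^ j` is a contraction. So all terms of the telescoping sum with `i ≥ L` are dominated by one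
quantity. -/
lemma enorm_mul_pow_apply_le {B C : X →L[ℂ] X} (hB : ‖B‖ ≤ 1) (hC : ‖C‖ ≤ 1) {x : X}
    (hx : ‖x‖ = 1) {μ : ℂ} (h : B x = μ • x) {L i : ℕ} (hi : L ≤ i) (j : ℕ) (D : X →L[ℂ] X) :
    ‖(C ^ j * D * B ^ i) x‖ₑ ≤ ‖D ((B ^ L) x)‖ₑ := by
  rw [mul_assoc, mul_apply_eq_comp]
  refine (enorm_pow_apply_le hC j _).trans ?_
  rw [mul_apply_eq_comp, pow_apply_eigenvector h, pow_apply_eigenvector h, map_smul,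
    map_smul, enorm_smul, enorm_smul]
  gcongr
  rw [← ofReal_norm, ← ofReal_norm, norm_pow, norm_pow]
  exact ENNReal.ofReal_le_ofReal
    (pow_le_pow_of_le_one (norm_nonneg _) (norm_eigenvalue_le_one hB hx h) hi)

variable [CompleteSpace X]

lemma IsCompleteOrthonormal.tsum_enorm_inner_sq {ψ : ℕ → X} (h : IsCompleteOrthonormal ψ) (x : X) :
    ∑' n, ‖inner ℂ (ψ n) x‖ₑ ^ 2 = ‖x‖ₑ ^ 2 := by
  set b := HilbertBasis.mk h.1 h.2.ge
  have hb : ⇑b = ψ := HilbertBasis.coe_mk _ _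
  have h1 := b.hasSum_inner_mul_inner x x
  rw [hb] at h1
  have h2 : HasSum (fun n => ‖inner ℂ (ψ n) x‖ ^ 2) (‖x‖ ^ 2) := by
    have h3 := Complex.hasSum_re h1
    rw [inner_self_eq_norm_sq_to_K] at h3
    convert h3 using 1
    · ext n
      rw [← inner_conj_symm x (ψ n), ← Complex.normSq_eq_conj_mul_self, Complex.ofReal_re,
        Complex.normSq_eq_norm_sq]
    · norm_cast
  have h4 := ENNReal.ofReal_tsum_of_nonneg (fun n => sq_nonneg ‖inner ℂ (ψ n) x‖) h2.summable
  rw [h2.tsum_eq] at h4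
  simpa [ENNReal.ofReal_pow] using h4.symm

/-- Both sides are the double sum of `|⟨χ_m, B ψ_n⟩|²`. Besides allowing the passage to the adjoint,
this permits a change of orthonormal basis, hence evaluation in the eigenbasis of whichever operator
is convenient. -/
lemma tsum_enorm_apply_sq_eq_adjoint {ψ χ : ℕ → X} (hψ : IsCompleteOrthonormal ψ)
    (hχ : IsCompleteOrthonormal χ) (B : X →L[ℂ] X) :
    ∑' n, ‖B (ψ n)‖ₑ ^ 2 = ∑' n, ‖ContinuousLinearMap.adjoint B (χ n)‖ₑ ^ 2 := by
  calc ∑' n, ‖B (ψ n)‖ₑ ^ 2 = ∑' n, ∑' m, ‖inner ℂ (χ m) (B (ψ n))‖ₑ ^ 2 := by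
        simp_rw [hχ.tsum_enorm_inner_sq]
    _ = ∑' m, ∑' n, ‖inner ℂ (χ m) (B (ψ n))‖ₑ ^ 2 := ENNReal.tsum_comm
    _ = ∑' m, ∑' n, ‖inner ℂ (ψ n) (ContinuousLinearMap.adjoint B (χ m))‖ₑ ^ 2 := by
        refine tsum_congr fun m => tsum_congr fun n => ?_
        rw [ContinuousLinearMap.adjoint_inner_right, ← inner_conj_symm]
        rw [← ofReal_norm, ← ofReal_norm, RCLike.norm_conj]
    _ = _ := by simp_rw [hψ.tsum_enorm_inner_sq]

/-- Expand `B x` in the basis `ψ`, exchange the sums, and use Bessel's inequality for each `B* ψ_m`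
against the finite orthonormal set `e`. -/
lemma hsNorm_le_of_isCompleteOrthonormal {ψ : ℕ → X} (hψ : IsCompleteOrthonormal ψ)
    (B : X →L[ℂ] X) : hsNorm B ≤ (∑' n, ‖B (ψ n)‖ₑ ^ 2) ^ (1 / 2 : ℝ) := by
  refine ENNReal.rpow_le_rpow (iSup₂_le fun e he => ?_) (by norm_num)
  rw [tsum_enorm_apply_sq_eq_adjoint hψ hψ]
  calc ∑ x ∈ e, ‖B x‖ₑ ^ 2 = ∑ x ∈ e, ∑' m, ‖inner ℂ (ψ m) (B x)‖ₑ ^ 2 := by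
        simp_rw [hψ.tsum_enorm_inner_sq]
    _ = ∑' m, ∑ x ∈ e, ‖inner ℂ (ψ m) (B x)‖ₑ ^ 2 :=
        (Summable.tsum_finsetSum fun i _ => ENNReal.summable).symm
    _ ≤ _ := by
        refine ENNReal.tsum_le_tsum fun m => ?_
        have h := he.sum_inner_products_le (s := Finset.univ)
          (x := ContinuousLinearMap.adjoint B (ψ m))
        rw [Finset.sum_coe_sort e
          (fun i => ‖inner ℂ i (ContinuousLinearMap.adjoint B (ψ m))‖ ^ 2)] at h
        have h' := ENNReal.ofReal_le_ofReal h
        rw [ENNReal.ofReal_sum_of_nonneg (fun _ _ => sq_nonneg _)] at h'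
        simp_rw [ENNReal.ofReal_pow (norm_nonneg _), ofReal_norm] at h'
        refine le_trans (le_of_eq (Finset.sum_congr rfl fun x _ => ?_)) h'
        rw [ContinuousLinearMap.adjoint_inner_right, ← inner_conj_symm]
        rw [← ofReal_norm, ← ofReal_norm, RCLike.norm_conj]

/-- Telescoping bound for the Hilbert--Schmidt norm of a difference of powers of two self-adjoint
contractions in terms of the action of the difference on eigenvectors. -/
lemma tsum_enorm_pow_sub_pow_sq_le {B C : X →L[ℂ] X} (hBs : IsSelfAdjoint B) (hCs : IsSelfAdjoint C)
    (hB : ‖B‖ ≤ 1) (hC : ‖C‖ ≤ 1) {ψ χ : ℕ → X} (hψ : IsCompleteOrthonormal ψ)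
    (hχ : IsCompleteOrthonormal χ) {μ ν : ℕ → ℂ} (hμ : ∀ n, B (ψ n) = μ n • ψ n)
    (hν : ∀ n, C (χ n) = ν n • χ n) (Z : Set ℕ) [DecidablePred (· ∈ Z)] {L k : ℕ}
    (hk : 2 * L + 1 ≤ k) {D : ℝ≥0∞}
    (h1 : ∑' n, ‖(B - C) ((C ^ L) (χ n))‖ₑ ^ 2 ≤ D)
    (h2 : ∑' n, (if n ∈ Z then 0 else ‖(B - C) ((B ^ L) (ψ n))‖ₑ ^ 2) ≤ D)
    (h3 : ∑' n, (if n ∈ Z then ‖(B ^ k - C ^ k) (ψ n)‖ₑ ^ 2 else 0) ≤ D) :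
    ∑' n, ‖(B ^ k - C ^ k) (ψ n)‖ₑ ^ 2 ≤ (k * k + 1) * D := by
  have key : ∀ i ∈ Finset.range k, ∑' n, (if n ∈ Z then 0 else
      ‖(C ^ (k - 1 - i) * (B - C) * B ^ i) (ψ n)‖ₑ ^ 2) ≤ D := by
    intro i hi
    have hi := Finset.mem_range.1 hi
    -- For `i ≥ L` the powers of `B` suffice and the eigenbasis of `B` is used off `Z`. For `i < L`
    -- the hypothesis `2 * L + 1 ≤ k` gives `k - 1 - i ≥ L`; then the sum is enlarged to all indices
    -- and, after taking adjoints, evaluated in the eigenbasis of `C`.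
    by_cases hL : L ≤ i
    · refine le_trans (ENNReal.tsum_le_tsum fun n => ?_) h2
      split_ifs
      · exact le_rfl
      · gcongr
        exact enorm_mul_pow_apply_le hB hC (hψ.1.1 n) (hμ n) hL _ _
    · refine le_trans (ENNReal.tsum_le_tsum fun n => ?_) (b := ∑' n,
        ‖(C ^ (k - 1 - i) * (B - C) * B ^ i) (ψ n)‖ₑ ^ 2) ?_
      · split_ifs <;> simp
      · rw [tsum_enorm_apply_sq_eq_adjoint hψ hχ, ← ContinuousLinearMap.star_eq_adjoint]
        refine le_trans (ENNReal.tsum_le_tsum fun n => ?_) h1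
        have : star (C ^ (k - 1 - i) * (B - C) * B ^ i) = B ^ i * (B - C) * C ^ (k - 1 - i) := by
          simp [star_mul, hBs.star_eq, hCs.star_eq, mul_assoc]
        rw [this]
        gcongr
        exact enorm_mul_pow_apply_le hC hB (hχ.1.1 n) (hν n) (by omega) _ _
  -- Off `Z` the `k` telescoping terms are separated by Cauchy–Schwarz. On `Z`, which holds the
  -- eigenvectors without a usable bound for `B - C`, the difference of powers is left intact for
  -- `h3`.
  have hsplit : ∀ n, ‖(B ^ k - C ^ k) (ψ n)‖ₑ ^ 2 ≤
      (if n ∈ Z then ‖(B ^ k - C ^ k) (ψ n)‖ₑ ^ 2 else 0) +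
      k * ∑ i ∈ Finset.range k, (if n ∈ Z then 0 else
        ‖(C ^ (k - 1 - i) * (B - C) * B ^ i) (ψ n)‖ₑ ^ 2) := by
    intro n
    by_cases hn : n ∈ Z
    · simp [hn]
    · simp only [hn, if_false, zero_add]
      rw [pow_sub_pow_eq_sum, _root_.sum_apply]
      simpa using enorm_sum_sq_le (Finset.range k)
        (fun i => (C ^ (k - 1 - i) * (B - C) * B ^ i) (ψ n))
  calc ∑' n, ‖(B ^ k - C ^ k) (ψ n)‖ₑ ^ 2 ≤ _ := ENNReal.tsum_le_tsum hsplit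
    _ ≤ D + k * (k * D) := by
      rw [ENNReal.tsum_add, ENNReal.tsum_mul_left,
        Summable.tsum_finsetSum fun i _ => ENNReal.summable]
      gcongr
      refine (Finset.sum_le_sum key).trans ?_
      simp
    _ = _ := by ring

end HilbertSchmidt

/-! ### Measure-theoretic and differential properties of bi-Lipschitz maps -/

section Geometry

variable {N : ℕ}

/-- Lebesgue measure is a constant multiple of the `N`-dimensional Hausdorff measure, for which the
scaling under Lipschitz maps is known; the constant appears on both sides. -/
lemma volume_image_le_of_lipschitzOnWith {K : ℝ≥0} {f : Rn N → Rn N} {s : Set (Rn N)}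
    (hf : LipschitzOnWith K f s) : volume (f '' s) ≤ (K : ℝ≥0∞) ^ N * volume s := by
  have h := hf.hausdorffMeasure_image_le (d := (Module.finrank ℝ (Rn N) : ℝ)) (by positivity)
  have e := Measure.isAddLeftInvariant_eq_smul (volume : Measure (Rn N))
    (μH[(Module.finrank ℝ (Rn N) : ℝ)] : Measure (Rn N))
  rw [e, Measure.smul_apply, Measure.smul_apply]
  have hN : (Module.finrank ℝ (Rn N) : ℝ) = (N : ℝ) := by simp
  simp only [ENNReal.smul_def, smul_eq_mul]
  refine (mul_le_mul_right h _).trans_eq ?_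
  rw [mul_left_comm]
  congr 1
  rw [hN, ENNReal.rpow_natCast]

variable {Ω : Set (Rn N)} {φ : Rn N → Rn N}

namespace IsTransformation

lemma injOn (h : IsTransformation Ω φ) : InjOn φ Ω := by
  obtain ⟨K, hK⟩ := h.inverse_lipschitz
  intro x hx y hy hxy
  have := hK x hx y hy
  rw [hxy, dist_self, mul_zero] at this
  exact dist_le_zero.1 this

lemma continuousOn (h : IsTransformation Ω φ) : ContinuousOn φ Ω := by
  obtain ⟨K, hK⟩ := h.lipschitz
  exact hK.continuousOn

/-- The transition map between two transformations of the same set. -/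
lemma transition (h : IsTransformation Ω φ) {φ' : Rn N → Rn N} (h' : IsTransformation Ω φ') :
    ∃ Ψ : Rn N → Rn N, IsTransformation (φ' '' Ω) Ψ ∧ Ψ '' (φ' '' Ω) = φ '' Ω ∧
      ∀ x ∈ Ω, Ψ (φ' x) = φ x := by
  obtain ⟨K, hK⟩ := h.lipschitz
  obtain ⟨K', hK'⟩ := h'.lipschitz
  obtain ⟨J, hJ⟩ := h.inverse_lipschitz
  obtain ⟨J', hJ'⟩ := h'.inverse_lipschitz
  rcases Ω.eq_empty_or_nonempty with rfl | hne
  · exact ⟨id, ⟨⟨1, by simp⟩, ⟨1, by simp⟩, by simp⟩, by simp, by simp⟩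
  have : Nonempty (Rn N) := ⟨0⟩
  have e : ∀ x ∈ Ω, (φ ∘ Function.invFunOn φ' Ω) (φ' x) = φ x := fun x hx => by
    rw [Function.comp_apply, h'.injOn.leftInvOn_invFunOn hx]
  have him : (φ ∘ Function.invFunOn φ' Ω) '' (φ' '' Ω) = φ '' Ω := by
    rw [← image_comp]
    exact image_congr e
  refine ⟨φ ∘ Function.invFunOn φ' Ω, ⟨⟨K * J', ?_⟩, ⟨K' * J, ?_⟩, ?_⟩, him, e⟩
  · refine LipschitzOnWith.of_dist_le_mul ?_
    rintro _ ⟨x, hx, rfl⟩ _ ⟨y, hy, rfl⟩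
    rw [e x hx, e y hy]
    calc dist (φ x) (φ y) ≤ K * dist x y := hK.dist_le_mul x hx y hy
      _ ≤ K * (J' * dist (φ' x) (φ' y)) := by gcongr; exact hJ' x hx y hy
      _ = _ := by push_cast; ring
  · rintro _ ⟨x, hx, rfl⟩ _ ⟨y, hy, rfl⟩
    rw [e x hx, e y hy]
    calc dist (φ' x) (φ' y) ≤ K' * dist x y := hK'.dist_le_mul x hx y hy
      _ ≤ K' * (J * dist (φ x) (φ y)) := by gcongr; exact hJ x hx y hy
      _ = _ := by push_cast; ring
  · rw [him]; exact h.isOpen_image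

lemma refl (hΩ : IsOpen Ω) : IsTransformation Ω id :=
  ⟨⟨1, LipschitzWith.id.lipschitzOnWith⟩, ⟨1, by simp⟩, by simpa⟩

/-- The inverse of `φ` is Lipschitz on `φ '' Ω`. This makes composition with `φ` well defined on
almost-everywhere classes and bounded between `L^p` spaces. -/
lemma volume_inter_preimage_le (h : IsTransformation Ω φ) :
    ∃ C : ℝ≥0, ∀ s, volume (Ω ∩ φ ⁻¹' s) ≤ C * volume (s ∩ φ '' Ω) := by
  obtain ⟨K, hK⟩ := h.inverse_lipschitz
  rcases Ω.eq_empty_or_nonempty with rfl | hne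
  · exact ⟨0, by simp⟩
  have : Nonempty (Rn N) := ⟨0⟩
  have hl : LipschitzOnWith K (Function.invFunOn φ Ω) (φ '' Ω) := by
    refine LipschitzOnWith.of_dist_le_mul ?_
    rintro _ ⟨x, hx, rfl⟩ _ ⟨y, hy, rfl⟩
    rw [h.injOn.leftInvOn_invFunOn hx, h.injOn.leftInvOn_invFunOn hy]
    exact hK x hx y hy
  refine ⟨K ^ N, fun s => ?_⟩
  calc volume (Ω ∩ φ ⁻¹' s) ≤ volume (Function.invFunOn φ Ω '' (s ∩ φ '' Ω)) := by
        refine measure_mono fun x hx => ⟨φ x, ⟨hx.2, mem_image_of_mem _ hx.1⟩, ?_⟩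
        exact h.injOn.leftInvOn_invFunOn hx.1
    _ ≤ _ := by
        simpa using volume_image_le_of_lipschitzOnWith (hl.mono (inter_subset_right (s := s)))

lemma aemeasurable (h : IsTransformation Ω φ) (hΩ : IsOpen Ω) :
    AEMeasurable φ (volume.restrict Ω) :=
  h.continuousOn.aemeasurable hΩ.measurableSet

lemma map_le (h : IsTransformation Ω φ) (hΩ : IsOpen Ω) :
    ∃ C : ℝ≥0, Measure.map φ (volume.restrict Ω) ≤ C • volume.restrict (φ '' Ω) := by
  obtain ⟨C, hC⟩ := h.volume_inter_preimage_le
  refine ⟨C, Measure.le_iff.2 fun s hs => ?_⟩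
  rw [Measure.map_apply_of_aemeasurable (h.aemeasurable hΩ) hs, Measure.smul_apply,
    Measure.restrict_apply hs, Measure.restrict_apply' hΩ.measurableSet, inter_comm]
  exact hC s

lemma quasiMeasurePreserving_ae (h : IsTransformation Ω φ) (hΩ : IsOpen Ω) {p : Rn N → Prop}
    (hp : ∀ᵐ y ∂volume.restrict (φ '' Ω), p y) : ∀ᵐ x ∂volume.restrict Ω, p (φ x) := by
  obtain ⟨C, hC⟩ := h.map_le hΩ
  have h2 : ∀ᵐ y ∂Measure.map φ (volume.restrict Ω), p y := by
    refine (Measure.absolutelyContinuous_of_le hC).ae_le ?_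
    exact Measure.smul_absolutelyContinuous.ae_le hp
  exact ae_of_ae_map (h.aemeasurable hΩ) h2

lemma ae_differentiableAt (h : IsTransformation Ω φ) (hΩ : IsOpen Ω) :
    ∀ᵐ x ∂volume.restrict Ω, DifferentiableAt ℝ φ x := by
  obtain ⟨K, hK⟩ := h.lipschitz
  filter_upwards [hK.ae_differentiableWithinAt hΩ.measurableSet (μ := volume),
    ae_restrict_mem hΩ.measurableSet] with x hx hxΩ
  exact hx.differentiableAt (hΩ.mem_nhds hxΩ)

lemma exists_norm_fderiv_le (h : IsTransformation Ω φ) (hΩ : IsOpen Ω) :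
    ∃ K : ℝ≥0, ∀ x ∈ Ω, ‖fderiv ℝ φ x‖ ≤ K := by
  obtain ⟨K, hK⟩ := h.lipschitz
  exact ⟨K, fun x hx => norm_fderiv_le_of_lipschitzOn ℝ (hΩ.mem_nhds hx) hK⟩

/-- The Lipschitz bound for the inverse, applied to `x + t ξ` and `x`, is divided by `t` and passes
to the limit `t ↓ 0`. -/
lemma exists_le_norm_fderiv_apply (h : IsTransformation Ω φ) (hΩ : IsOpen Ω) :
    ∃ K : ℝ≥0, ∀ x ∈ Ω, DifferentiableAt ℝ φ x → ∀ ξ, ‖ξ‖ ≤ K * ‖fderiv ℝ φ x ξ‖ := by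
  obtain ⟨K, hK⟩ := h.inverse_lipschitz
  refine ⟨K, fun x hx hd ξ => ?_⟩
  have h1 := (hd.hasFDerivAt.hasLineDerivAt ξ).tendsto_slope_zero_right
  have h2 := (h1.norm.const_mul (K : ℝ))
  refine ge_of_tendsto h2 ?_
  have h3 : ∀ᶠ t : ℝ in nhdsWithin 0 (Ioi 0), x + t • ξ ∈ Ω := by
    have : Filter.Tendsto (fun t : ℝ => x + t • ξ) (nhds 0) (nhds x) := by
      have : Continuous fun t : ℝ => x + t • ξ := by fun_prop
      simpa using this.tendsto 0
    exact (this.eventually (hΩ.mem_nhds hx)).filter_mono nhdsWithin_le_nhds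
  filter_upwards [h3, self_mem_nhdsWithin] with t ht ht0
  have ht0 : 0 < t := ht0
  have := hK _ ht _ hx
  rw [dist_eq_norm, dist_eq_norm, add_sub_cancel_left, norm_smul, Real.norm_of_nonneg ht0.le] at this
  rw [norm_smul, norm_inv, Real.norm_of_nonneg ht0.le]
  calc ‖ξ‖ = t⁻¹ * (t * ‖ξ‖) := by field_simp
    _ ≤ t⁻¹ * (K * ‖φ (x + t • ξ) - φ x‖) := by gcongr
    _ = _ := by ring

end IsTransformation

lemma jacobian_eq_toMatrix (φ : Rn N → Rn N) (x : Rn N) :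
    jacobian φ x = LinearMap.toMatrix (EuclideanSpace.basisFun (Fin N) ℝ).toBasis
      (EuclideanSpace.basisFun (Fin N) ℝ).toBasis (fderiv ℝ φ x).toLinearMap := by
  ext i j
  simp [jacobian, LinearMap.toMatrix_apply]

lemma jacobian_mulVec (φ : Rn N → Rn N) (x ξ : Rn N) :
    WithLp.toLp 2 ((jacobian φ x).mulVec ξ) = fderiv ℝ φ x ξ := by
  ext i
  rw [jacobian_eq_toMatrix]
  have := LinearMap.toMatrix_mulVec_repr (EuclideanSpace.basisFun (Fin N) ℝ).toBasis
      (EuclideanSpace.basisFun (Fin N) ℝ).toBasis (fderiv ℝ φ x).toLinearMap ξ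
  exact congrFun this i

lemma det_jacobian (φ : Rn N → Rn N) (x : Rn N) : (jacobian φ x).det = (fderiv ℝ φ x).det := by
  rw [jacobian_eq_toMatrix, LinearMap.det_toMatrix]

lemma measurable_jacobian_apply (φ : Rn N → Rn N) (i j : Fin N) :
    Measurable fun x => jacobian φ x i j := by
  have h := measurable_fderiv_apply_const ℝ φ (EuclideanSpace.single j (1 : ℝ))
  have h2 : Measurable fun y : Rn N => y i := by fun_prop
  exact h2.comp h

lemma measurable_density (φ : Rn N → Rn N) : Measurable (density φ) := by
  refine Measurable.norm (f := fun x => (jacobian φ x).det) ?_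
  simp_rw [Matrix.det_apply']
  exact Finset.measurable_fun_sum _ fun σ _ => Measurable.const_mul
    (Finset.measurable_fun_prod _ fun i _ => measurable_jacobian_apply φ _ _) _

lemma density_nonneg (φ : Rn N → Rn N) (x : Rn N) : 0 ≤ density φ x := abs_nonneg _

lemma abs_det_le {M : Matrix (Fin N) (Fin N) ℝ} {c : ℝ} (h : ∀ i j, |M i j| ≤ c) :
    |M.det| ≤ N.factorial * c ^ N := by
  have := Matrix.det_le (abv := AbsoluteValue.abs) (A := M) (x := c) h
  simpa using this

/-- Qualitative bounds for the Jacobian matrix of a transformation and for its inverse. -/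
lemma IsTransformation.ae_jacobian_bounds (h : IsTransformation Ω φ) (hΩ : IsOpen Ω) :
    ∃ C : ℝ, 0 < C ∧ ∀ᵐ x ∂volume.restrict Ω, IsUnit (jacobian φ x).det ∧ 0 < density φ x ∧
      density φ x ≤ C ∧ (density φ x)⁻¹ ≤ C ∧ (∀ i j, |jacobian φ x i j| ≤ C) ∧
      ∀ i j, |(jacobian φ x)⁻¹ i j| ≤ C := by
  obtain ⟨K, hK⟩ := h.exists_norm_fderiv_le hΩ
  obtain ⟨J, hJ⟩ := h.exists_le_norm_fderiv_apply hΩ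
  refine ⟨1 + K + J + N.factorial * K ^ N + N.factorial * J ^ N, by positivity, ?_⟩
  have p1 : (0 : ℝ) ≤ N.factorial * K ^ N := by positivity
  have p2 : (0 : ℝ) ≤ N.factorial * J ^ N := by positivity
  have p3 : (0 : ℝ) ≤ K := K.2
  have p4 : (0 : ℝ) ≤ J := J.2
  filter_upwards [h.ae_differentiableAt hΩ, ae_restrict_mem hΩ.measurableSet] with x hd hx
  have hu : IsUnit (jacobian φ x).det := by
    rw [← Matrix.isUnit_iff_isUnit_det, ← Matrix.mulVec_injective_iff_isUnit]
    refine (injective_iff_map_eq_zero (Matrix.mulVecLin (jacobian φ x))).2 fun ξ hξ => ?_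
    have h1 := hJ x hx hd (WithLp.toLp 2 ξ)
    rw [← jacobian_mulVec] at h1
    have h2 : (jacobian φ x).mulVec ξ = 0 := hξ
    rw [show (jacobian φ x).mulVec (WithLp.toLp 2 ξ : Rn N) = (jacobian φ x).mulVec ξ from rfl, h2]
      at h1
    simp only [WithLp.toLp_zero, norm_zero, mul_zero, norm_le_zero_iff] at h1
    simpa using congrArg WithLp.ofLp h1
  have hb1 : ∀ i j, |jacobian φ x i j| ≤ K := by
    intro i j
    calc |jacobian φ x i j| = ‖(fderiv ℝ φ x (EuclideanSpace.single j 1)) i‖ := rfl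
      _ ≤ ‖fderiv ℝ φ x (EuclideanSpace.single j 1)‖ := PiLp.norm_apply_le _ i
      _ ≤ ‖fderiv ℝ φ x‖ * ‖EuclideanSpace.single j (1 : ℝ)‖ := ContinuousLinearMap.le_opNorm _ _
      _ ≤ K := by simpa using hK x hx
  have hb2 : ∀ i j, |(jacobian φ x)⁻¹ i j| ≤ J := by
    intro i j
    -- The `j`-th column `ξ` of the inverse Jacobian is mapped by the Jacobian to a unit vector, so
    -- the lower bound `hJ` for the derivative bounds its length.
    set ξ : Rn N := WithLp.toLp 2 ((jacobian φ x)⁻¹.mulVec (Pi.single j 1)) with hξ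
    have h1 := hJ x hx hd ξ
    rw [← jacobian_mulVec] at h1
    have h2 : (jacobian φ x).mulVec ξ = Pi.single j 1 := by
      change (jacobian φ x).mulVec ((jacobian φ x)⁻¹.mulVec (Pi.single j 1)) = _
      rw [Matrix.mulVec_mulVec, Matrix.mul_nonsing_inv _ hu, Matrix.one_mulVec]
    rw [h2] at h1
    have h3 : ‖(WithLp.toLp 2 (Pi.single j 1) : Rn N)‖ = 1 := by
      simp
    rw [h3, mul_one] at h1
    refine le_trans ?_ h1
    have h4 : (jacobian φ x)⁻¹ i j = ξ i := by simp [hξ]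
    rw [h4]
    exact PiLp.norm_apply_le ξ i
  have hd1 : density φ x ≤ N.factorial * K ^ N := abs_det_le hb1
  have hd2 : (density φ x)⁻¹ ≤ N.factorial * J ^ N := by
    have := abs_det_le hb2
    rwa [Matrix.det_nonsing_inv, Ring.inverse_eq_inv, abs_inv] at this
  refine ⟨hu, abs_pos.2 hu.ne_zero, by linarith, by linarith, fun i j => ?_, fun i j => ?_⟩
  · linarith [hb1 i j]
  · linarith [hb2 i j]

/-- This is the area formula on the points of differentiability; the remaining points form a null
set by Rademacher's theorem, and a Lipschitz map sends it to a null set. It turns the lower bound on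
`|φ(Ω)|` into one for the total mass of `g dx`. -/
lemma IsTransformation.volume_image_le_weightedMeasure (h : IsTransformation Ω φ) (hΩ : IsOpen Ω) :
    volume (φ '' Ω) ≤ weightedMeasure Ω φ univ := by
  obtain ⟨K, hK⟩ := h.lipschitz
  have hm : MeasurableSet {x | DifferentiableAt ℝ φ x} := measurableSet_of_differentiableAt ℝ φ
  have hs : MeasurableSet (Ω ∩ {x | DifferentiableAt ℝ φ x}) := hΩ.measurableSet.inter hm
  have h0 : volume (Ω \ {x | DifferentiableAt ℝ φ x}) = 0 := by
    have := h.ae_differentiableAt hΩ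
    rw [ae_restrict_iff' hΩ.measurableSet, ae_iff] at this
    convert this using 2
    ext x; simp
  have h1 : volume (φ '' (Ω \ {x | DifferentiableAt ℝ φ x})) = 0 := by
    have := volume_image_le_of_lipschitzOnWith (hK.mono (sdiff_subset (t := {x | DifferentiableAt ℝ φ x})))
    rwa [h0, mul_zero, nonpos_iff_eq_zero] at this
  have h2 := lintegral_abs_det_fderiv_eq_addHaar_image volume hs (f := φ) (f' := fderiv ℝ φ)
    (fun x hx => hx.2.hasFDerivAt.hasFDerivWithinAt) (h.injOn.mono inter_subset_left)
  calc volume (φ '' Ω) ≤ volume (φ '' (Ω ∩ {x | DifferentiableAt ℝ φ x})) +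
        volume (φ '' (Ω \ {x | DifferentiableAt ℝ φ x})) := by
        rw [← inter_union_sdiff Ω {x | DifferentiableAt ℝ φ x}, image_union]
        simpa using measure_union_le _ _
    _ = ∫⁻ x in Ω ∩ {x | DifferentiableAt ℝ φ x}, ENNReal.ofReal |(fderiv ℝ φ x).det| := by
        rw [h1, add_zero, h2]
    _ ≤ ∫⁻ x in Ω, ENNReal.ofReal (density φ x) := by
        simp_rw [density, det_jacobian]
        exact lintegral_mono_set inter_subset_left
    _ = _ := by rw [weightedMeasure, withDensity_apply _ MeasurableSet.univ, setLIntegral_univ]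

end Geometry

/-! ### Mollification and its convergence -/

section Mollification

open Filter Topology

variable {N : ℕ} {F : Type*} [NormedAddCommGroup F] [NormedSpace ℝ F]

/-- A smooth bump function supported in the ball of radius `1 / (n + 1)` about the origin. -/
noncomputable def bump (N n : ℕ) : ContDiffBump (0 : Rn N) where
  -- The fixed ratio `rOut = 2 * rIn` is what almost-everywhere convergence of the mollifications
  -- requires.
  rIn := 1 / (2 * (n + 1))
  rOut := 1 / (n + 1)
  rIn_pos := by positivity
  rIn_lt_rOut := by
    rw [div_lt_div_iff_of_pos_left one_pos (by positivity) (by positivity)]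
    linarith [(by positivity : (0 : ℝ) < n + 1)]

/-- The corresponding kernel with integral one. -/
noncomputable def kernel (N n : ℕ) : Rn N → ℝ := (bump N n).normed volume

/-- Mollification at scale `1 / (n + 1)`. -/
noncomputable def mollify (n : ℕ) (f : Rn N → F) : Rn N → F :=
  convolution f (kernel N n) (ContinuousLinearMap.lsmul ℝ ℝ).flip volume

lemma mollify_apply (n : ℕ) (f : Rn N → F) (x : Rn N) :
    mollify n f x = ∫ y, kernel N n (x - y) • f y := rfl

/-- The definition puts the kernel on the right, where the smoothness statements for convolutions
want the smooth factor; this form puts it on the left, as the convergence statements for bump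
functions want it. -/
lemma mollify_eq_convolution (n : ℕ) (f : Rn N → F) :
    mollify n f =
      convolution ((bump N n).normed volume) f (ContinuousLinearMap.lsmul ℝ ℝ) volume := by
  rw [mollify, convolution_flip]; rfl

lemma contDiff_kernel (N n : ℕ) : ContDiff ℝ ∞ (kernel N n) := (bump N n).contDiff_normed

lemma continuous_kernel (N n : ℕ) : Continuous (kernel N n) := (contDiff_kernel N n).continuous

lemma hasCompactSupport_kernel (N n : ℕ) : HasCompactSupport (kernel N n) :=
  (bump N n).hasCompactSupport_normed

lemma kernel_nonneg (N n : ℕ) (x : Rn N) : 0 ≤ kernel N n x := (bump N n).nonneg_normed x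

lemma integral_kernel (N n : ℕ) : ∫ x, kernel N n x = 1 := (bump N n).integral_normed

lemma integrable_kernel (N n : ℕ) : Integrable (kernel N n) :=
  (continuous_kernel N n).integrable_of_hasCompactSupport (hasCompactSupport_kernel N n)

lemma tsupport_kernel (N n : ℕ) :
    tsupport (kernel N n) = Metric.closedBall (0 : Rn N) (1 / (n + 1)) :=
  (bump N n).tsupport_normed_eq

lemma kernel_eq_zero {N n : ℕ} {x : Rn N} (h : 1 / ((n : ℝ) + 1) < ‖x‖) : kernel N n x = 0 := by
  refine image_eq_zero_of_notMem_tsupport ?_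
  rw [tsupport_kernel, Metric.mem_closedBall, dist_zero_right, not_le]
  exact h

lemma tendsto_bump_rOut (N : ℕ) : Tendsto (fun n => (bump N n).rOut) atTop (𝓝 0) :=
  tendsto_one_div_add_atTop_nhds_zero_nat

lemma contDiff_mollify {f : Rn N → F} (hf : LocallyIntegrable f) (n : ℕ) :
    ContDiff ℝ ∞ (mollify n f) :=
  (hasCompactSupport_kernel N n).contDiff_convolution_right _ hf (contDiff_kernel N n)

lemma integrable_kernel_smul {f : Rn N → F} (hf : LocallyIntegrable f) (n : ℕ) (x : Rn N) :
    Integrable fun y => kernel N n (x - y) • f y :=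
  (hasCompactSupport_kernel N n).convolutionExists_right
    (ContinuousLinearMap.lsmul ℝ ℝ).flip hf (continuous_kernel N n) x

lemma integral_kernel_sub (n : ℕ) (x : Rn N) : ∫ y, kernel N n (x - y) = 1 := by
  rw [integral_sub_left_eq_self (fun y => kernel N n y) volume x, integral_kernel]

lemma mollify_sub {f g : Rn N → F} (hf : LocallyIntegrable f) (hg : LocallyIntegrable g) (n : ℕ) :
    mollify n (f - g) = mollify n f - mollify n g := by
  ext x
  simp only [mollify_apply, Pi.sub_apply, smul_sub]
  exact integral_sub (integrable_kernel_smul hf n x) (integrable_kernel_smul hg n x)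

lemma norm_mollify_le {f : Rn N → F} {C : ℝ} (hf : ∀ x, ‖f x‖ ≤ C) (n : ℕ) (x : Rn N) :
    ‖mollify n f x‖ ≤ C := by
  rw [mollify_apply]
  calc ‖∫ y, kernel N n (x - y) • f y‖ ≤ ∫ y, kernel N n (x - y) * C := by
        refine norm_integral_le_of_norm_le (((integrable_kernel N n).comp_sub_left x).mul_const C)
          (ae_of_all _ fun y => ?_)
        rw [norm_smul, Real.norm_of_nonneg (kernel_nonneg N n _)]
        exact mul_le_mul_of_nonneg_left (hf y) (kernel_nonneg N n _)
    _ = C := by rw [integral_mul_const, integral_kernel_sub, one_mul]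

lemma mollify_eq_zero {f : Rn N → F} {n : ℕ} {x : Rn N}
    (h : ∀ y, dist y x ≤ 1 / (n + 1) → f y = 0) : mollify n f x = 0 := by
  rw [mollify_apply]
  refine integral_eq_zero_of_ae (ae_of_all _ fun y => ?_)
  by_cases hy : dist y x ≤ 1 / (n + 1)
  · simp [h y hy]
  · have : kernel N n (x - y) = 0 := kernel_eq_zero (by rwa [← dist_eq_norm, dist_comm, ← not_le])
    simp [this]

lemma integrable_mollify {f : Rn N → F} (hf : Integrable f) (n : ℕ) : Integrable (mollify n f) :=
  hf.integrable_convolution _ (integrable_kernel N n)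

lemma integral_norm_mollify_le {f : Rn N → F} (hf : Integrable f) (n : ℕ) :
    ∫ x, ‖mollify n f x‖ ≤ ∫ x, ‖f x‖ := by
  calc ∫ x, ‖mollify n f x‖ ≤ ∫ x, mollify n (fun y => ‖f y‖) x := by
        refine integral_mono (integrable_mollify hf n).norm (integrable_mollify hf.norm n)
          fun x => ?_
        simp only [mollify_apply]
        refine (norm_integral_le_integral_norm _).trans (le_of_eq ?_)
        simp_rw [norm_smul, Real.norm_of_nonneg (kernel_nonneg N n _), smul_eq_mul]
    _ = ∫ x, ‖f x‖ := by
        rw [mollify, integral_convolution _ hf.norm (integrable_kernel N n), integral_kernel]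
        simp

variable [CompleteSpace F]

lemma ae_tendsto_mollify {f : Rn N → F} (hf : LocallyIntegrable f) :
    ∀ᵐ x, Tendsto (fun n => mollify n f x) atTop (𝓝 (f x)) := by
  simp_rw [mollify_eq_convolution]
  refine ContDiffBump.ae_convolution_tendsto_right_of_locallyIntegrable (K := 2)
    (tendsto_bump_rOut N) (Eventually.of_forall fun n => le_of_eq ?_) hf
  simp only [bump]
  field_simp

lemma tendsto_mollify_of_continuous {f : Rn N → F} (hf : Continuous f) (x : Rn N) :
    Tendsto (fun n => mollify n f x) atTop (𝓝 (f x)) := by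
  simp_rw [mollify_eq_convolution]
  exact ContDiffBump.convolution_tendsto_right_of_continuous (tendsto_bump_rOut N) hf x

lemma tendsto_integral_norm_mollify_sub_of_continuous {g : Rn N → F} (hg : Continuous g)
    (hc : HasCompactSupport g) :
    Tendsto (fun n => ∫ x, ‖mollify n g x - g x‖) atTop (𝓝 0) := by
  obtain ⟨C, hC⟩ := hc.exists_bound_of_continuous hg
  have hC0 : 0 ≤ C := (norm_nonneg _).trans (hC 0)
  obtain ⟨r, hr⟩ := hc.isCompact.isBounded.subset_closedBall 0
  have h0 : ∫ _ : Rn N, (0 : ℝ) = 0 := integral_zero _ _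
  rw [← h0]
  have hgl := hg.locallyIntegrable (μ := (volume : Measure (Rn N)))
  -- The scale is at most one, so all the mollified functions vanish outside the ball of radius `r +
  -- 1`, where `r` bounds the support of `g`.
  refine tendsto_integral_of_dominated_convergence
    (indicator (Metric.closedBall 0 (r + 1)) fun _ => C + C) (fun n => ?_) ?_ (fun n => ?_) ?_
  · exact ((contDiff_mollify hgl n).continuous.sub hg).norm.aestronglyMeasurable
  · exact (integrable_indicator_iff measurableSet_closedBall).2
      ((integrableOn_const_iff (by simp)).2
        (Or.inr (isCompact_closedBall _ _).measure_lt_top))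
  · refine ae_of_all _ fun x => ?_
    rw [norm_norm]
    by_cases hx : x ∈ Metric.closedBall 0 (r + 1)
    · rw [indicator_of_mem hx]
      exact (norm_sub_le _ _).trans (add_le_add (norm_mollify_le hC n x) (hC x))
    · have hz : ∀ y, dist y x ≤ 1 / ((n : ℝ) + 1) → g y = 0 := fun y hy => by
        refine image_eq_zero_of_notMem_tsupport fun hy' => hx ?_
        have h1 := hr hy'
        have h2 : 1 / ((n : ℝ) + 1) ≤ 1 := by
          rw [div_le_one (by positivity)]; linarith [(Nat.cast_nonneg n : (0 : ℝ) ≤ n)]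
        rw [Metric.mem_closedBall] at h1 ⊢
        linarith [dist_triangle x y 0, dist_comm x y]
      rw [mollify_eq_zero hz, hz x (by rw [dist_self]; positivity), indicator_of_notMem hx]
      simp
  · refine ae_of_all _ fun x => ?_
    have := ((tendsto_mollify_of_continuous hg x).sub_const (g x)).norm
    simpa using this

/-- Mollification contracts the `L¹` norm, so the claim passes from continuous compactly supported
functions to their `L¹` limits by an `ε/3` argument. -/
lemma tendsto_integral_norm_mollify_sub {f : Rn N → F} (hf : Integrable f) :
    Tendsto (fun n => ∫ x, ‖mollify n f x - f x‖) atTop (𝓝 0) := by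
  rw [Metric.tendsto_atTop]
  intro ε hε
  obtain ⟨g, hgc, hfg, hg, hgi⟩ := hf.exists_hasCompactSupport_integral_sub_le
    (show 0 < ε / 3 by positivity)
  obtain ⟨n₀, hn₀⟩ := (Metric.tendsto_atTop.1
    (tendsto_integral_norm_mollify_sub_of_continuous hg hgc)) (ε / 3) (by positivity)
  refine ⟨n₀, fun n hn => ?_⟩
  have h1 := hn₀ n hn
  rw [Real.dist_eq, sub_zero, abs_of_nonneg (integral_nonneg fun _ => norm_nonneg _)] at h1 ⊢
  have hi1 := (integrable_mollify (hf.sub hgi) n).norm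
  have hi2 := ((integrable_mollify hgi n).sub hgi).norm
  have hi3 := (hf.sub hgi).norm
  have h2 := integral_norm_mollify_le (hf.sub hgi) n
  calc ∫ x, ‖mollify n f x - f x‖
      ≤ ∫ x, (‖mollify n (f - g) x‖ + ‖mollify n g x - g x‖ + ‖f x - g x‖) := by
        refine integral_mono ((integrable_mollify hf n).sub hf).norm ((hi1.add hi2).add hi3)
          fun x => ?_
        have : mollify n f x - f x =
            mollify n (f - g) x + (mollify n g x - g x) - (f x - g x) := by
          rw [mollify_sub hf.locallyIntegrable hgi.locallyIntegrable, Pi.sub_apply]; abel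
        simp only [this]
        exact (norm_sub_le _ _).trans (add_le_add_left (norm_add_le _ _) _)
    _ = (∫ x, ‖mollify n (f - g) x‖) + (∫ x, ‖mollify n g x - g x‖) + ∫ x, ‖f x - g x‖ := by
        rw [integral_add (by exact hi1.add hi2) (by exact hi3), integral_add hi1 (by exact hi2)]
    _ < ε := by
        simp only [Pi.sub_apply] at h2
        linarith

end Mollification

/-! ### Mollification commutes with the weak gradient -/

section WeakGradient

open Filter Topology

variable {N : ℕ}

lemma mollify_pi_apply {f : Rn N → EuclideanSpace ℂ (Fin N)} (hf : LocallyIntegrable f) (n : ℕ)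
    (x : Rn N) (i : Fin N) : mollify n f x i = mollify n (fun y => f y i) x := by
  simp only [mollify_apply]
  have := ((EuclideanSpace.proj i : EuclideanSpace ℂ (Fin N) →L[ℂ] ℂ).integral_comp_comm
    (integrable_kernel_smul hf n x)).symm
  simpa using this

lemma isTestFunction_kernel {U : Set (Rn N)} {n : ℕ} {x : Rn N}
    (h : Metric.closedBall x (1 / (n + 1)) ⊆ U) :
    IsTestFunction U fun y => (kernel N n (x - y) : ℂ) := by
  have hs : tsupport (fun y => (kernel N n (x - y) : ℂ)) ⊆ Metric.closedBall x (1 / (n + 1)) := by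
    refine closure_minimal (fun y hy => ?_) Metric.isClosed_closedBall
    by_contra hy'
    refine hy ?_
    have : kernel N n (x - y) = 0 := kernel_eq_zero (by
      rwa [← dist_eq_norm, dist_comm, ← not_le])
    simp [this]
  refine ⟨?_, ?_, hs.trans h⟩
  · exact Complex.ofRealCLM.contDiff.comp ((contDiff_kernel N n).comp (contDiff_const.sub contDiff_id))
  · exact (isCompact_closedBall _ _).of_isClosed_subset (isClosed_tsupport _) hs

lemma classicalGrad_kernel {n : ℕ} (x y : Rn N) (i : Fin N) :
    classicalGrad (fun y => (kernel N n (x - y) : ℂ)) y i =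
      -(fderiv ℝ (kernel N n) (x - y) (EuclideanSpace.single i 1) : ℂ) := by
  have hd : DifferentiableAt ℝ (kernel N n) (x - y) :=
    ((contDiff_kernel N n).differentiable (by simp)).differentiableAt
  have h1 : HasFDerivAt (fun y => x - y) (-(ContinuousLinearMap.id ℝ (Rn N))) y :=
    (hasFDerivAt_id y).const_sub x
  have h2 := (Complex.ofRealCLM.hasFDerivAt).comp y (hd.hasFDerivAt.comp y h1)
  have h3 : fderiv ℝ (fun y => (kernel N n (x - y) : ℂ)) y = _ := h2.fderiv
  simp [classicalGrad, h3]

/-- Differentiation falls on the kernel, and `y ↦ κ(x - y)` is an admissible test function because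
the closed ball around `x` lies in `U`. The sign from the reflection in the kernel cancels the sign
in the weak gradient. Values of `v'` and `V'` outside `U` play no role, since the kernel vanishes
there. -/
lemma classicalGrad_mollify {U : Set (Rn N)} {v v' : Rn N → ℂ}
    {V V' : Rn N → EuclideanSpace ℂ (Fin N)} (hU : MeasurableSet U) (h : HasWeakGrad U v V)
    (hv : ∀ x ∈ U, v' x = v x) (hV : ∀ x ∈ U, V' x = V x) (hvl : LocallyIntegrable v')
    (hVl : LocallyIntegrable V') {n : ℕ} {x : Rn N}
    (hx : Metric.closedBall x (1 / (n + 1)) ⊆ U) :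
    classicalGrad (mollify n v') x = mollify n V' x := by
  ext i
  have hz : ∀ y ∉ U, kernel N n (x - y) = 0 := fun y hy => kernel_eq_zero (by
    rw [← dist_eq_norm, dist_comm, ← not_le]; exact fun hh => hy (hx hh))
  have hη := isTestFunction_kernel hx
  have hz' : ∀ y ∉ U, classicalGrad (fun y => (kernel N n (x - y) : ℂ)) y i = 0 := fun y hy => by
    have : fderiv ℝ (fun y => (kernel N n (x - y) : ℂ)) y = 0 :=
      image_eq_zero_of_notMem_tsupport fun hh => hy (hη.2.2 (tsupport_fderiv_subset ℝ hh))
    simp [classicalGrad, this]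
  have h1 := (hasCompactSupport_kernel N n).hasFDerivAt_convolution_right
    (ContinuousLinearMap.lsmul ℝ ℝ).flip hvl ((contDiff_kernel N n).of_le (by simp)) x
  have h2 : fderiv ℝ (mollify n v') x = _ := h1.fderiv
  have h3 : classicalGrad (mollify n v') x i =
      ∫ y, v' y * -classicalGrad (fun y => (kernel N n (x - y) : ℂ)) y i := by
    simp only [classicalGrad, h2]
    rw [convolution_precompR_apply _ hvl ((hasCompactSupport_kernel N n).fderiv ℝ)
      ((contDiff_kernel N n).continuous_fderiv (by simp)), convolution_def]
    refine integral_congr_ae (ae_of_all _ fun y => ?_)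
    have := classicalGrad_kernel (n := n) x y i
    simp only [classicalGrad] at this
    simp only [this]
    simp [mul_comm]
  rw [h3, mollify_pi_apply hVl, mollify_apply]
  have h4 := h.2.2 _ hη i
  rw [← integral_indicator hU, ← integral_indicator hU] at h4
  simp only [mul_neg, integral_neg]
  rw [neg_eq_iff_eq_neg]
  refine Eq.trans (integral_congr_ae (ae_of_all _ fun y => ?_)) (h4.trans ?_)
  · by_cases hy : y ∈ U
    · simp [hy, hv y hy]
    · simp [hy, hz' y hy]
  · congr 1
    refine integral_congr_ae (ae_of_all _ fun y => ?_)
    by_cases hy : y ∈ U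
    · simp [hy, hV y hy, mul_comm]
    · simp [hy, hz y hy]

end WeakGradient

/-! ### Lipschitz functions: the classical gradient is the weak gradient -/

section LipschitzFunctions

open Filter Topology

variable {N : ℕ}

lemma integral_mul_fderiv_eq_of_lipschitzWith {K : ℝ≥0} {f g : Rn N → ℝ} (hf : LipschitzWith K f)
    (hg : ContDiff ℝ ∞ g) (hgc : HasCompactSupport g) (e : Rn N) :
    ∫ x, f x * fderiv ℝ g x e = -∫ x, fderiv ℝ f x e * g x := by
  obtain ⟨D, hD⟩ := ContDiff.lipschitzWith_of_hasCompactSupport hgc hg (by simp)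
  have h := LipschitzWith.integral_lineDeriv_mul_eq (μ := (volume : Measure (Rn N))) hf hD hgc e
  have h1 : ∫ x, lineDeriv ℝ f x e * g x = ∫ x, fderiv ℝ f x e * g x := by
    refine integral_congr_ae ?_
    filter_upwards [hf.ae_differentiableAt (μ := (volume : Measure (Rn N)))] with x hx
    rw [hx.lineDeriv_eq_fderiv]
  have h2 : ∀ x, lineDeriv ℝ g x (-e) = -fderiv ℝ g x e := fun x => by
    rw [((hg.differentiable (by simp)) x).lineDeriv_eq_fderiv, map_neg]
  simp_rw [h1, h2, neg_mul, integral_neg] at h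
  rw [h, neg_neg]
  simp_rw [mul_comm]

lemma LipschitzWith.norm_classicalGrad_le {K : ℝ≥0} {f : Rn N → ℂ} (hf : LipschitzWith K f)
    (x : Rn N) (i : Fin N) : ‖classicalGrad f x i‖ ≤ K := by
  calc ‖fderiv ℝ f x (EuclideanSpace.single i 1)‖
      ≤ ‖fderiv ℝ f x‖ * ‖EuclideanSpace.single i (1 : ℝ)‖ := ContinuousLinearMap.le_opNorm _ _
    _ ≤ K := by simpa using norm_fderiv_le_of_lipschitz ℝ hf

lemma measurable_classicalGrad_apply (f : Rn N → ℂ) (i : Fin N) :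
    Measurable fun x => classicalGrad f x i :=
  measurable_fderiv_apply_const ℝ f (EuclideanSpace.single i (1 : ℝ))

lemma measurable_euclidean_of_apply {α : Type*} [MeasurableSpace α]
    {f : α → EuclideanSpace ℂ (Fin N)} (h : ∀ i, Measurable fun x => f x i) : Measurable f := by
  have := (PiLp.continuous_toLp 2 fun _ : Fin N => ℂ).measurable.comp (measurable_pi_lambda _ h)
  exact this

lemma measurable_classicalGrad (f : Rn N → ℂ) : Measurable (classicalGrad f) :=
  measurable_euclidean_of_apply (measurable_classicalGrad_apply f)

lemma euclidean_norm_le_sum (ξ : EuclideanSpace ℂ (Fin N)) : ‖ξ‖ ≤ ∑ i, ‖ξ i‖ := by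
  calc ‖ξ‖ = ‖∑ i, EuclideanSpace.single i (ξ i)‖ := by
        congr 1; ext j; simp
    _ ≤ ∑ i, ‖EuclideanSpace.single i (ξ i)‖ := norm_sum_le _ _
    _ = _ := by simp

lemma LipschitzWith.norm_classicalGrad_le' {K : ℝ≥0} {f : Rn N → ℂ} (hf : LipschitzWith K f)
    (x : Rn N) : ‖classicalGrad f x‖ ≤ N * K := by
  refine (euclidean_norm_le_sum _).trans
    ((Finset.sum_le_sum fun i _ => LipschitzWith.norm_classicalGrad_le hf x i).trans ?_)
  simp

lemma locallyIntegrable_of_bounded {F : Type*} [NormedAddCommGroup F] {f : Rn N → F}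
    (hm : AEStronglyMeasurable f volume) {C : ℝ} (h : ∀ x, ‖f x‖ ≤ C) : LocallyIntegrable f := by
  refine (locallyIntegrable_const (μ := (volume : Measure (Rn N))) C).mono hm (ae_of_all _ fun x => ?_)
  exact (h x).trans (le_abs_self C)

lemma integrable_mul_of_bounded {f g : Rn N → ℂ} (hm : AEStronglyMeasurable f volume) {C : ℝ}
    (h : ∀ x, ‖f x‖ ≤ C) (hg : Integrable g) : Integrable fun x => f x * g x :=
  hg.bdd_mul hm (ae_of_all _ h)

/-- The real-valued formula is applied to the real and imaginary parts of `f` against real test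
functions; splitting `η` into real and imaginary parts then gives the general case. -/
lemma integral_mul_classicalGrad_eq_of_lipschitzWith {K : ℝ≥0} {f η : Rn N → ℂ}
    (hf : LipschitzWith K f) (hη : ContDiff ℝ ∞ η) (hηc : HasCompactSupport η) (i : Fin N) :
    ∫ x, f x * classicalGrad η x i = -∫ x, classicalGrad f x i * η x := by
  set e : Rn N := EuclideanSpace.single i 1
  have hclm : ∀ L : ℂ →L[ℝ] ℝ, LipschitzWith (‖L‖₊ * K) (L ∘ f) := fun L => L.lipschitz.comp hf
  have hdf : ∀ L : ℂ →L[ℝ] ℝ, ∀ᵐ x, fderiv ℝ (L ∘ f) x e = L (classicalGrad f x i) := fun L => by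
    filter_upwards [hf.ae_differentiableAt (μ := (volume : Measure (Rn N)))] with x hx
    rw [(L.hasFDerivAt.comp x hx.hasFDerivAt).fderiv]; rfl
  have hfi : ∀ g : Rn N → ℝ, Continuous g → HasCompactSupport g →
      Integrable fun x => f x * (g x : ℂ) := fun g hg hgc =>
    (hf.continuous.mul (Complex.continuous_ofReal.comp hg)).integrable_of_hasCompactSupport
      ((hgc.comp_left (g := Complex.ofReal) Complex.ofReal_zero).mul_left)
  have hfi' : ∀ g : Rn N → ℝ, Continuous g → HasCompactSupport g →
      Integrable fun x => classicalGrad f x i * (g x : ℂ) := fun g hg hgc =>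
    integrable_mul_of_bounded (measurable_classicalGrad_apply f i).aestronglyMeasurable
      (fun x => LipschitzWith.norm_classicalGrad_le hf x i)
      ((Complex.continuous_ofReal.comp hg).integrable_of_hasCompactSupport
        (hgc.comp_left (g := Complex.ofReal) Complex.ofReal_zero))
  have hreal : ∀ g : Rn N → ℝ, ContDiff ℝ ∞ g → HasCompactSupport g →
      ∫ x, f x * (fderiv ℝ g x e : ℂ) = -∫ x, classicalGrad f x i * (g x : ℂ) := by
    intro g hg hgc
    have hg' : Continuous fun x => fderiv ℝ g x e :=
      (hg.continuous_fderiv (by simp)).clm_apply continuous_const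
    have hgc' : HasCompactSupport fun x => fderiv ℝ g x e := hgc.fderiv_apply ℝ e
    have hL : ∀ L : ℂ →L[ℝ] ℝ, L (∫ x, f x * (fderiv ℝ g x e : ℂ)) =
        L (-∫ x, classicalGrad f x i * (g x : ℂ)) := by
      intro L
      have hm : ∀ (z : ℂ) (r : ℝ), L (z * (r : ℂ)) = L z * r := fun z r => by
        rw [mul_comm, ← Complex.real_smul, map_smul, smul_eq_mul, mul_comm]
      rw [map_neg, ← L.integral_comp_comm (hfi _ hg' hgc'), ← L.integral_comp_comm (hfi' _ hg.continuous hgc)]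
      simp_rw [hm]
      have := integral_mul_fderiv_eq_of_lipschitzWith (hclm L) hg hgc e
      simp only [Function.comp_apply] at this
      rw [this]
      congr 1
      refine integral_congr_ae ?_
      filter_upwards [hdf L] with x hx
      rw [hx]
    exact Complex.ext (hL Complex.reCLM) (hL Complex.imCLM)
  have hd : ∀ x, DifferentiableAt ℝ η x := fun x => (hη.differentiable (by simp)) x
  have h1 : ContDiff ℝ ∞ fun x => (η x).re := Complex.reCLM.contDiff.comp hη
  have h2 : ContDiff ℝ ∞ fun x => (η x).im := Complex.imCLM.contDiff.comp hη
  have c1 : HasCompactSupport fun x => (η x).re := hηc.comp_left (g := Complex.re) rfl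
  have c2 : HasCompactSupport fun x => (η x).im := hηc.comp_left (g := Complex.im) rfl
  have e1 : ∀ x, fderiv ℝ (fun x => (η x).re) x e = (classicalGrad η x i).re := fun x => by
    have := (Complex.reCLM.hasFDerivAt.comp x (hd x).hasFDerivAt).fderiv
    exact congrArg (fun T => T e) this
  have e2 : ∀ x, fderiv ℝ (fun x => (η x).im) x e = (classicalGrad η x i).im := fun x => by
    have := (Complex.imCLM.hasFDerivAt.comp x (hd x).hasFDerivAt).fderiv
    exact congrArg (fun T => T e) this
  have k1 := hreal _ h1 c1
  have k2 := hreal _ h2 c2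
  have cg : ∀ {g : Rn N → ℝ}, ContDiff ℝ ∞ g → Continuous fun x => fderiv ℝ g x e := fun hg =>
    (hg.continuous_fderiv (by simp)).clm_apply continuous_const
  have i1 := hfi _ (cg h1) (c1.fderiv_apply ℝ e)
  have i2 := hfi _ (cg h2) (c2.fderiv_apply ℝ e)
  simp_rw [e1] at k1 i1
  simp_rw [e2] at k2 i2
  calc ∫ x, f x * classicalGrad η x i
      = ∫ x, (f x * ((classicalGrad η x i).re : ℂ) + f x * ((classicalGrad η x i).im : ℂ) * Complex.I) := by
        congr 1; ext x; conv_lhs => rw [← Complex.re_add_im (classicalGrad η x i)]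
        ring
    _ = -(∫ x, (classicalGrad f x i * ((η x).re : ℂ) +
          classicalGrad f x i * ((η x).im : ℂ) * Complex.I)) := by
        rw [integral_add i1 (i2.mul_const _), integral_mul_const, k1, k2,
          integral_add (hfi' _ h1.continuous c1) ((hfi' _ h2.continuous c2).mul_const _),
          integral_mul_const]
        ring
    _ = _ := by
        congr 2; ext x; conv_rhs => rw [← Complex.re_add_im (η x)]
        ring

lemma setIntegral_mul_eq_integral {U : Set (Rn N)} {f η : Rn N → ℂ} (hη : tsupport η ⊆ U) :
    ∫ x in U, f x * η x = ∫ x, f x * η x :=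
  setIntegral_eq_integral_of_forall_compl_eq_zero fun x hx => by
    rw [image_eq_zero_of_notMem_tsupport fun h => hx (hη h), mul_zero]

lemma classicalGrad_eq_zero {η : Rn N → ℂ} {x : Rn N} (hx : x ∉ tsupport η) :
    classicalGrad η x = 0 := by
  have : fderiv ℝ η x = 0 :=
    image_eq_zero_of_notMem_tsupport fun hh => hx (tsupport_fderiv_subset ℝ hh)
  ext i
  simp [classicalGrad, this]

lemma setIntegral_mul_classicalGrad_eq_integral {U : Set (Rn N)} {f η : Rn N → ℂ}
    (hη : tsupport η ⊆ U) (i : Fin N) :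
    ∫ x in U, f x * classicalGrad η x i = ∫ x, f x * classicalGrad η x i :=
  setIntegral_eq_integral_of_forall_compl_eq_zero fun x hx => by
    simp [classicalGrad_eq_zero fun h => hx (hη h)]

lemma LipschitzWith.hasWeakGrad {K : ℝ≥0} {f : Rn N → ℂ} (hf : LipschitzWith K f) (U : Set (Rn N)) :
    HasWeakGrad U f (classicalGrad f) := by
  refine ⟨hf.continuous.locallyIntegrable.locallyIntegrableOn U,
    (locallyIntegrable_of_bounded (measurable_classicalGrad f).aestronglyMeasurable
      (LipschitzWith.norm_classicalGrad_le' hf)).locallyIntegrableOn U, fun η hη i => ?_⟩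
  rw [setIntegral_mul_classicalGrad_eq_integral hη.2.2, setIntegral_mul_eq_integral hη.2.2]
  exact integral_mul_classicalGrad_eq_of_lipschitzWith hf hη.1 hη.2.1 i

end LipschitzFunctions

/-! ### Congruence and uniqueness of weak gradients -/

section BasicWeakGradient

open Filter Topology

variable {N : ℕ} {U : Set (Rn N)}

lemma HasWeakGrad.congr {v v' : Rn N → ℂ} {V V' : Rn N → EuclideanSpace ℂ (Fin N)}
    (h : HasWeakGrad U v V) (hv : v =ᵐ[volume.restrict U] v')
    (hV : V =ᵐ[volume.restrict U] V') : HasWeakGrad U v' V' := by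
  have aux : ∀ {F : Type} [NormedAddCommGroup F] {a b : Rn N → F}, LocallyIntegrableOn a U volume →
      a =ᵐ[volume.restrict U] b → LocallyIntegrableOn b U volume := by
    intro F _ a b ha hab x hx
    obtain ⟨s, hs, hs'⟩ := ha x hx
    refine ⟨s ∩ U, inter_mem hs self_mem_nhdsWithin, ?_⟩
    exact (hs'.mono_set inter_subset_left).congr_fun_ae
      (ae_restrict_of_ae_restrict_of_subset inter_subset_right hab)
  refine ⟨aux h.1 hv, aux h.2.1 hV, fun η hη i => ?_⟩
  calc ∫ x in U, v' x * classicalGrad η x i = ∫ x in U, v x * classicalGrad η x i :=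
        integral_congr_ae (by filter_upwards [hv] with x hx; rw [hx])
    _ = -∫ x in U, V x i * η x := h.2.2 η hη i
    _ = _ := by congr 1; exact integral_congr_ae (by filter_upwards [hV] with x hx; rw [hx])

lemma LocallyIntegrableOn.apply {V : Rn N → EuclideanSpace ℂ (Fin N)}
    (h : LocallyIntegrableOn V U volume) (i : Fin N) :
    LocallyIntegrableOn (fun x => V x i) U volume := by
  intro x hx
  obtain ⟨s, hs, hs'⟩ := h x hx
  exact ⟨s, hs, ((EuclideanSpace.proj i : EuclideanSpace ℂ (Fin N) →L[ℂ] ℂ).integrable_comp hs')⟩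

lemma isTestFunction_ofReal {g : Rn N → ℝ} (hg : ContDiff ℝ ∞ g) (hc : HasCompactSupport g)
    (hs : tsupport g ⊆ U) : IsTestFunction U fun x => (g x : ℂ) :=
  ⟨Complex.ofRealCLM.contDiff.comp hg, hc.comp_left (g := Complex.ofReal) Complex.ofReal_zero,
    (closure_mono fun x hx => by simpa using hx).trans hs⟩

lemma integrable_mul_of_locallyIntegrableOn {v η : Rn N → ℂ}
    (hv : LocallyIntegrableOn v U volume) (hη : Continuous η) (hc : HasCompactSupport η)
    (hs : tsupport η ⊆ U) : IntegrableOn (fun x => v x * η x) U volume := by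
  have h1 : IntegrableOn v (tsupport η) volume :=
    hv.integrableOn_compact_subset hs hc.isCompact
  have h2 : IntegrableOn (fun x => v x * η x) (tsupport η) volume :=
    h1.mul_continuousOn hη.continuousOn hc.isCompact
  have h3 : Integrable (fun x => v x * η x) volume :=
    (integrableOn_iff_integrable_of_support_subset fun x hx => by
      by_contra hx'
      exact hx (by simp [image_eq_zero_of_notMem_tsupport hx'])).1 h2
  exact h3.integrableOn

/-- The weak gradient is unique. -/
lemma HasWeakGrad.ae_eq (hU : IsOpen U) {v : Rn N → ℂ} {V V' : Rn N → EuclideanSpace ℂ (Fin N)}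
    (h : HasWeakGrad U v V) (h' : HasWeakGrad U v V') : V =ᵐ[volume.restrict U] V' := by
  have key : ∀ i, ∀ᵐ x, x ∈ U → V x i - V' x i = 0 := fun i => by
    refine IsOpen.ae_eq_zero_of_integral_contDiff_smul_eq_zero hU
      ((LocallyIntegrableOn.apply h.2.1 i).sub (LocallyIntegrableOn.apply h'.2.1 i))
      fun g hg hgc hgs => ?_
    have ht := isTestFunction_ofReal hg hgc hgs
    have h1 := h.2.2 _ ht i
    rw [h'.2.2 _ ht i, neg_inj] at h1
    have i1 := integrable_mul_of_locallyIntegrableOn (LocallyIntegrableOn.apply h.2.1 i)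
      ht.1.continuous ht.2.1 ht.2.2
    have i2 := integrable_mul_of_locallyIntegrableOn (LocallyIntegrableOn.apply h'.2.1 i)
      ht.1.continuous ht.2.1 ht.2.2
    rw [← sub_eq_zero, ← integral_sub i2 i1] at h1
    rw [← setIntegral_eq_integral_of_forall_compl_eq_zero (s := U) fun x hx => by
      rw [image_eq_zero_of_notMem_tsupport fun hh => hx (hgs hh), zero_smul], ← neg_eq_zero,
      ← integral_neg, ← h1]
    congr 1; ext x
    rw [Complex.real_smul]; ring
  rw [EventuallyEq, ae_restrict_iff' hU.measurableSet]
  filter_upwards [ae_all_iff.2 key] with x hx hxU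
  ext i
  exact sub_eq_zero.1 (hx i hxU)

end BasicWeakGradient

/-! ### The chain rule for bi-Lipschitz maps -/

section ChainRule

open Filter Topology

variable {N : ℕ} {U : Set (Rn N)} {Ψ : Rn N → Rn N}

/-- The gradient of `v ∘ Ψ` given by the chain rule, `V` being the gradient of `v`. -/
noncomputable def pullGrad (Ψ : Rn N → Rn N) (V : Rn N → EuclideanSpace ℂ (Fin N)) (x : Rn N) :
    EuclideanSpace ℂ (Fin N) :=
  WithLp.toLp 2 fun i => ∑ j, (jacobian Ψ x j i : ℂ) * V (Ψ x) j

lemma classicalGrad_comp {v : Rn N → ℂ} {x : Rn N} (hv : DifferentiableAt ℝ v (Ψ x))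
    (hΨ : DifferentiableAt ℝ Ψ x) :
    classicalGrad (v ∘ Ψ) x = pullGrad Ψ (classicalGrad v) x := by
  ext i
  have h := (hv.hasFDerivAt.comp x hΨ.hasFDerivAt).fderiv
  simp only [classicalGrad, pullGrad, h, ContinuousLinearMap.comp_apply]
  set ξ := fderiv ℝ Ψ x (EuclideanSpace.single i 1) with hξ
  have h1 : ξ = ∑ j, ξ j • EuclideanSpace.single j (1 : ℝ) := by
    ext k; simp [Pi.single_apply]
  conv_lhs => rw [h1]
  rw [map_sum]
  refine Finset.sum_congr rfl fun j _ => ?_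
  rw [map_smul, Complex.real_smul]
  rfl

lemma jacobian_congr {φ ψ : Rn N → Rn N} {x : Rn N} (h : φ =ᶠ[𝓝 x] ψ) :
    jacobian φ x = jacobian ψ x := by
  simp only [jacobian, h.fderiv_eq]

lemma classicalGrad_congr {f g : Rn N → ℂ} {x : Rn N} (h : f =ᶠ[𝓝 x] g) :
    classicalGrad f x = classicalGrad g x := by
  simp only [classicalGrad, h.fderiv_eq]

lemma norm_pullGrad_le {x : Rn N} {C : ℝ} (h : ∀ i j, |jacobian Ψ x i j| ≤ C)
    (V : Rn N → EuclideanSpace ℂ (Fin N)) : ‖pullGrad Ψ V x‖ ≤ N * (N * C) * ‖V (Ψ x)‖ := by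
  refine (euclidean_norm_le_sum _).trans ?_
  have hC : ∀ i j : Fin N, 0 ≤ C := fun i j => (abs_nonneg _).trans (h i j)
  have : ∀ i, ‖pullGrad Ψ V x i‖ ≤ N * C * ‖V (Ψ x)‖ := fun i => by
    refine (norm_sum_le Finset.univ fun j => (jacobian Ψ x j i : ℂ) * V (Ψ x) j).trans ?_
    calc ∑ j, ‖(jacobian Ψ x j i : ℂ) * V (Ψ x) j‖ ≤ ∑ _j : Fin N, C * ‖V (Ψ x)‖ := by
          refine Finset.sum_le_sum fun j _ => ?_
          rw [norm_mul, Complex.norm_real]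
          exact mul_le_mul (h j i) (PiLp.norm_apply_le _ j) (norm_nonneg _) (hC j i)
      _ = _ := by simp; ring
  refine (Finset.sum_le_sum fun i _ => this i).trans (le_of_eq ?_)
  simp; ring

/-- Chain rule for a smooth compactly supported function and a Lipschitz map. -/
lemma hasWeakGrad_comp_of_smooth {K : ℝ≥0} (hU : IsOpen U) (hΨ : LipschitzOnWith K Ψ U)
    {v : Rn N → ℂ} (hv : ContDiff ℝ ∞ v) (hc : HasCompactSupport v) :
    HasWeakGrad U (v ∘ Ψ) (pullGrad Ψ (classicalGrad v)) := by
  -- With a globally Lipschitz extension `Φ` the composite `v ∘ Φ` is Lipschitz on the whole space,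
  -- so its weak gradient is the classical one; by Rademacher's theorem the latter is given by the
  -- chain rule almost everywhere.
  obtain ⟨Φ, hΦ, hΦU⟩ := hΨ.extend_finite_dimension
  obtain ⟨D, hD⟩ := ContDiff.lipschitzWith_of_hasCompactSupport hc hv (by simp)
  refine (LipschitzWith.hasWeakGrad (hD.comp hΦ) U).congr ?_ ?_
  · filter_upwards [ae_restrict_mem hU.measurableSet] with x hx
    simp [hΦU hx]
  · filter_upwards [ae_restrict_mem hU.measurableSet,
      ae_restrict_of_ae (hΦ.ae_differentiableAt (μ := (volume : Measure (Rn N))))] with x hx hd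
    have he : Φ =ᶠ[𝓝 x] Ψ := by
      filter_upwards [hU.mem_nhds hx] with y hy
      exact (hΦU hy).symm
    rw [classicalGrad_comp (hv.differentiable (by simp) _) hd]
    simp only [pullGrad, jacobian_congr he, he.eq_of_nhds]

lemma IsTransformation.aestronglyMeasurable_comp (h : IsTransformation U Ψ) (hU : IsOpen U)
    {F : Type*} [TopologicalSpace F]
    [TopologicalSpace.PseudoMetrizableSpace F] {f : Rn N → F}
    (hf : AEStronglyMeasurable f (volume.restrict (Ψ '' U))) :
    AEStronglyMeasurable (f ∘ Ψ) (volume.restrict U) := by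
  obtain ⟨C, hC⟩ := h.map_le hU
  exact (hf.mono_ac ((Measure.absolutelyContinuous_of_le hC).trans
    Measure.smul_absolutelyContinuous)).comp_aemeasurable (h.aemeasurable hU)

lemma IsTransformation.exists_eLpNorm_comp_le (h : IsTransformation U Ψ) (hU : IsOpen U)
    (p : ℝ≥0∞) (hp : p ≠ ⊤) :
    ∃ C : ℝ≥0∞, C ≠ ⊤ ∧ ∀ {F : Type} [NormedAddCommGroup F] (f : Rn N → F),
      AEStronglyMeasurable f (volume.restrict (Ψ '' U)) →
      eLpNorm (f ∘ Ψ) p (volume.restrict U) ≤ C * eLpNorm f p (volume.restrict (Ψ '' U)) := by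
  obtain ⟨C, hC⟩ := h.map_le hU
  refine ⟨(C : ℝ≥0∞) ^ (1 / p).toReal, ENNReal.rpow_ne_top_of_nonneg ENNReal.toReal_nonneg ENNReal.coe_ne_top, ?_⟩
  intro F _ f hf
  rw [← eLpNorm_map_measure (hf.mono_ac ((Measure.absolutelyContinuous_of_le hC).trans
    Measure.smul_absolutelyContinuous)) (h.aemeasurable hU)]
  refine (eLpNorm_mono_measure f hC).trans (le_of_eq ?_)
  have := eLpNorm_smul_measure_of_ne_top hp (f := f) (μ := volume.restrict (Ψ '' U)) (C : ℝ≥0∞)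
  rw [smul_eq_mul] at this
  exact this

lemma IsTransformation.memLp_comp (h : IsTransformation U Ψ) (hU : IsOpen U)
    {F : Type} [NormedAddCommGroup F] {f : Rn N → F} {p : ℝ≥0∞}
    (hp : p ≠ ⊤) (hf : MemLp f p (volume.restrict (Ψ '' U))) :
    MemLp (f ∘ Ψ) p (volume.restrict U) := by
  obtain ⟨C, hC, hle⟩ := h.exists_eLpNorm_comp_le hU p hp
  exact ⟨h.aestronglyMeasurable_comp hU hf.1,
    (hle f hf.1).trans_lt (ENNReal.mul_lt_top hC.lt_top hf.2)⟩

/-- Composition with `Ψ` is bounded on `L¹` and `b` is bounded, so `L¹` convergence is preserved.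
This carries the integration by parts formula from mollified functions to their limit. -/
lemma IsTransformation.tendsto_setIntegral_mul_comp (h : IsTransformation U Ψ) (hU : IsOpen U)
    {f : ℕ → Rn N → ℂ} {g : Rn N → ℂ}
    (hf : ∀ n, Integrable (f n)) (hg : Integrable g)
    (hfg : Tendsto (fun n => ∫ x, ‖f n x - g x‖) atTop (𝓝 0)) {b : Rn N → ℂ}
    (hb : AEStronglyMeasurable b (volume.restrict U)) {B : ℝ} (hB0 : 0 ≤ B)
    (hB : ∀ᵐ x ∂volume.restrict U, ‖b x‖ ≤ B) :
    Tendsto (fun n => ∫ x in U, b x * f n (Ψ x)) atTop (𝓝 (∫ x in U, b x * g (Ψ x))) ∧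
      (∀ n, IntegrableOn (fun x => b x * f n (Ψ x)) U) ∧
      IntegrableOn (fun x => b x * g (Ψ x)) U := by
  obtain ⟨C, hC, hle⟩ := h.exists_eLpNorm_comp_le hU 1 (by simp)
  have hint : ∀ k : Rn N → ℂ, Integrable k → IntegrableOn (fun x => b x * k (Ψ x)) U := by
    intro k hk
    have := h.memLp_comp hU (p := 1) (by simp)
      (memLp_one_iff_integrable.2 (hk.integrableOn (s := Ψ '' U)))
    exact (memLp_one_iff_integrable.1 this).bdd_mul hb hB
  refine ⟨?_, fun n => hint _ (hf n), hint g hg⟩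
  rw [tendsto_iff_norm_sub_tendsto_zero]
  have hle2 : ∀ n, ‖(∫ x in U, b x * f n (Ψ x)) - ∫ x in U, b x * g (Ψ x)‖ ≤
      B * (C.toReal * ∫ x, ‖f n x - g x‖) := by
    intro n
    rw [← integral_sub (hint _ (hf n)) (hint g hg)]
    have hd : Integrable (fun x => f n x - g x) := (hf n).sub hg
    have hdi : Integrable (fun x => f n (Ψ x) - g (Ψ x)) (volume.restrict U) :=
      memLp_one_iff_integrable.1 (h.memLp_comp hU (p := 1) (by simp)
        (memLp_one_iff_integrable.2 (hd.integrableOn (s := Ψ '' U))))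
    have h1 : ∫ x in U, ‖f n (Ψ x) - g (Ψ x)‖ ≤ C.toReal * ∫ x, ‖f n x - g x‖ := by
      have h2 := hle (fun x => f n x - g x) hd.1.restrict
      have h3 : eLpNorm (fun x => f n x - g x) 1 (volume.restrict (Ψ '' U)) ≤
          eLpNorm (fun x => f n x - g x) 1 volume := eLpNorm_mono_measure _ Measure.restrict_le_self
      have h4 := h2.trans (mul_le_mul_right h3 C)
      rw [eLpNorm_one_eq_lintegral_enorm, eLpNorm_one_eq_lintegral_enorm] at h4
      rw [integral_norm_eq_lintegral_enorm hdi.1, integral_norm_eq_lintegral_enorm hd.1,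
        ← ENNReal.toReal_mul]
      exact ENNReal.toReal_mono (ENNReal.mul_ne_top hC hd.2.ne) h4
    calc _ ≤ ∫ x in U, B * ‖f n (Ψ x) - g (Ψ x)‖ := by
          refine norm_integral_le_of_norm_le (hdi.norm.const_mul B) ?_
          filter_upwards [hB] with x hx
          rw [← mul_sub, norm_mul]
          exact mul_le_mul_of_nonneg_right hx (norm_nonneg _)
      _ ≤ _ := by
          rw [integral_const_mul]
          exact mul_le_mul_of_nonneg_left h1 hB0
  refine squeeze_zero (fun _ => norm_nonneg _) hle2 ?_
  simpa using (hfg.const_mul C.toReal).const_mul B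

lemma IsTransformation.isBounded_image (h : IsTransformation U Ψ) (hb : Bornology.IsBounded U) :
    Bornology.IsBounded (Ψ '' U) := by
  obtain ⟨K, hK⟩ := h.lipschitz
  obtain ⟨C, hC⟩ := Metric.isBounded_iff.1 hb
  refine Metric.isBounded_iff.2 ⟨K * C, ?_⟩
  rintro _ ⟨x, hx, rfl⟩ _ ⟨y, hy, rfl⟩
  exact (hK.dist_le_mul x hx y hy).trans (mul_le_mul_of_nonneg_left (hC hx hy) K.2)

lemma IsTransformation.aestronglyMeasurable_pullGrad (h : IsTransformation U Ψ) (hU : IsOpen U)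
    {V : Rn N → EuclideanSpace ℂ (Fin N)}
    (hV : AEStronglyMeasurable V (volume.restrict (Ψ '' U))) :
    AEStronglyMeasurable (pullGrad Ψ V) (volume.restrict U) := by
  have hc : ∀ i, AEStronglyMeasurable (fun x => pullGrad Ψ V x i) (volume.restrict U) := by
    intro i
    change AEStronglyMeasurable (fun x => ∑ j, (jacobian Ψ x j i : ℂ) * V (Ψ x) j) _
    refine Finset.aestronglyMeasurable_fun_sum _ fun j _ => AEStronglyMeasurable.mul ?_ ?_
    · exact (Complex.measurable_ofReal.comp
        (measurable_jacobian_apply Ψ j i)).aestronglyMeasurable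
    · exact (EuclideanSpace.proj j : EuclideanSpace ℂ (Fin N) →L[ℂ]
        ℂ).continuous.comp_aestronglyMeasurable (h.aestronglyMeasurable_comp hU hV)
  have hc' : AEMeasurable (fun x i => pullGrad Ψ V x i) (volume.restrict U) :=
    aemeasurable_pi_lambda _ fun i => (hc i).aemeasurable
  exact ((PiLp.continuous_toLp 2 fun _ : Fin N => ℂ).measurable.comp_aemeasurable
    hc').aestronglyMeasurable

lemma IsTransformation.exists_eLpNorm_pullGrad_le (h : IsTransformation U Ψ) (hU : IsOpen U) :
    ∃ C : ℝ≥0∞, C ≠ ⊤ ∧ ∀ V : Rn N → EuclideanSpace ℂ (Fin N),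
      AEStronglyMeasurable V (volume.restrict (Ψ '' U)) →
      eLpNorm (pullGrad Ψ V) 2 (volume.restrict U) ≤
        C * eLpNorm V 2 (volume.restrict (Ψ '' U)) := by
  obtain ⟨C, hC, hle⟩ := h.exists_eLpNorm_comp_le hU 2 (by simp)
  obtain ⟨D, hD0, hD⟩ := h.ae_jacobian_bounds hU
  refine ⟨ENNReal.ofReal (N * (N * D)) * C, ENNReal.mul_ne_top ENNReal.ofReal_ne_top hC,
    fun V hV => ?_⟩
  have h1 := eLpNorm_le_mul_eLpNorm_of_ae_le_mul (f := pullGrad Ψ V) (g := V ∘ Ψ)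
    (c := N * (N * D)) (μ := volume.restrict U) (by
      filter_upwards [hD] with x hx
      exact norm_pullGrad_le hx.2.2.2.2.1 V) 2
  rw [mul_assoc]
  exact h1.trans (mul_le_mul_right (hle V hV) _)

lemma IsTransformation.memLp_pullGrad (h : IsTransformation U Ψ) (hU : IsOpen U)
    {V : Rn N → EuclideanSpace ℂ (Fin N)} (hV : MemLp V 2 (volume.restrict (Ψ '' U))) :
    MemLp (pullGrad Ψ V) 2 (volume.restrict U) := by
  obtain ⟨C, hC, hle⟩ := h.exists_eLpNorm_pullGrad_le hU
  exact ⟨h.aestronglyMeasurable_pullGrad hU hV.1,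
    (hle V hV.1).trans_lt (ENNReal.mul_lt_top hC.lt_top hV.2)⟩

/-- Chain rule for a function in `W^{1,2}` and a bi-Lipschitz map. -/
lemma HasWeakGrad.comp_transformation (h : IsTransformation U Ψ) (hU : IsOpen U)
    (hb : Bornology.IsBounded U) {v : Rn N → ℂ} {V : Rn N → EuclideanSpace ℂ (Fin N)}
    (hv : HasWeakGrad (Ψ '' U) v V) (hv2 : MemLp v 2 (volume.restrict (Ψ '' U)))
    (hV2 : MemLp V 2 (volume.restrict (Ψ '' U))) : HasWeakGrad U (v ∘ Ψ) (pullGrad Ψ V) := by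
  obtain ⟨K, hK⟩ := h.lipschitz
  obtain ⟨C, hC0, hC⟩ := h.ae_jacobian_bounds hU
  have hO := h.isOpen_image
  have hbO := h.isBounded_image hb
  have hfin : IsFiniteMeasure (volume.restrict (Ψ '' U)) :=
    ⟨by rw [Measure.restrict_apply_univ]; exact hbO.measure_lt_top⟩
  have hfinU : IsFiniteMeasure (volume.restrict U) :=
    ⟨by rw [Measure.restrict_apply_univ]; exact hb.measure_lt_top⟩
  -- Extension by zero makes `v` and `V` integrable on the whole space, so that they can be
  -- mollified. The extension need not have a weak gradient across the boundary.
  set v' : Rn N → ℂ := indicator (Ψ '' U) v with hv'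
  set V' : Rn N → EuclideanSpace ℂ (Fin N) := indicator (Ψ '' U) V with hV'
  have hvi : Integrable v' := (integrable_indicator_iff hO.measurableSet).2 (hv2.integrable (by norm_num))
  have hVi : Integrable V' := (integrable_indicator_iff hO.measurableSet).2 (hV2.integrable (by norm_num))
  have hvc : HasCompactSupport v' := by
    refine (hbO.isCompact_closure).of_isClosed_subset (isClosed_tsupport _) (closure_mono ?_)
    exact support_indicator_subset
  have hVij : ∀ j, Integrable fun x => V' x j := fun j =>
    (EuclideanSpace.proj j : EuclideanSpace ℂ (Fin N) →L[ℂ] ℂ).integrable_comp hVi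
  have hm2 : MemLp (pullGrad Ψ V) 2 (volume.restrict U) := h.memLp_pullGrad hU hV2
  refine ⟨?_, ?_, fun η hη i => ?_⟩
  · have h1 := (h.memLp_comp hU (by simp) hv2).integrable (by norm_num : (1 : ℝ≥0∞) ≤ 2)
    exact IntegrableOn.locallyIntegrableOn h1
  · exact IntegrableOn.locallyIntegrableOn (hm2.integrable (by norm_num : (1 : ℝ≥0∞) ≤ 2))
  obtain ⟨Bη, hBη⟩ := hη.2.1.exists_bound_of_continuous hη.1.continuous
  have hgc : Continuous fun x => classicalGrad η x i :=
    (hη.1.continuous_fderiv (by simp)).clm_apply continuous_const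
  obtain ⟨Bg, hBg⟩ := (hη.2.1.fderiv_apply ℝ
    (EuclideanSpace.single i 1)).exists_bound_of_continuous hgc
  have t1 := h.tendsto_setIntegral_mul_comp hU (fun n => integrable_mollify hvi n) hvi
    (tendsto_integral_norm_mollify_sub hvi) (b := fun x => classicalGrad η x i)
    hgc.aestronglyMeasurable ((norm_nonneg _).trans (hBg 0)) (ae_of_all _ hBg)
  have t2 := fun j => h.tendsto_setIntegral_mul_comp hU (fun n => integrable_mollify (hVij j) n)
    (hVij j) (tendsto_integral_norm_mollify_sub (hVij j))
    (b := fun x => (jacobian Ψ x j i : ℂ) * η x) (B := C * Bη)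
    ((Complex.measurable_ofReal.comp (measurable_jacobian_apply Ψ j i)).aestronglyMeasurable.mul
      hη.1.continuous.aestronglyMeasurable)
    (mul_nonneg hC0.le ((norm_nonneg _).trans (hBη 0))) (by
      filter_upwards [hC] with x hx
      rw [norm_mul, Complex.norm_real]
      exact mul_le_mul (hx.2.2.2.2.1 j i) (hBη x) (norm_nonneg _) hC0.le)
  -- the identity for the mollified functions
  have hcomp : IsCompact (Ψ '' tsupport η) :=
    hη.2.1.isCompact.image_of_continuousOn (h.continuousOn.mono hη.2.2)
  -- At scales below `δ` the balls around points of `Ψ '' tsupport η` stay inside `Ψ '' U`. There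
  -- mollification commutes with the weak gradient, and outside the support of `η` the integrand
  -- vanishes.
  obtain ⟨δ, hδ, hδ'⟩ := hcomp.exists_cthickening_subset_open hO (image_mono hη.2.2)
  obtain ⟨n₀, hn₀⟩ := exists_nat_one_div_lt hδ
  have hev : ∀ n ≥ n₀, ∫ x in U, classicalGrad η x i * mollify n v' (Ψ x) =
      -∑ j, ∫ x in U, ((jacobian Ψ x j i : ℂ) * η x) * mollify n (fun y => V' y j) (Ψ x) := by
    intro n hn
    have hmc : HasCompactSupport (mollify n v') := by
      rw [mollify_eq_convolution]
      exact (bump N n).hasCompactSupport_normed.convolution _ hvc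
    have h1 := (hasWeakGrad_comp_of_smooth hU hK
      (contDiff_mollify hvi.locallyIntegrable n) hmc).2.2 η hη i
    rw [← integral_finsetSum _ fun j _ => (t2 j).2.1 n]
    refine Eq.trans ?_ (h1.trans ?_)
    · congr 1; ext x; rw [mul_comm]; rfl
    · congr 1
      refine setIntegral_congr_fun hU.measurableSet fun x hx => ?_
      by_cases hxs : x ∈ tsupport η
      · have hball : Metric.closedBall (Ψ x) (1 / ((n : ℝ) + 1)) ⊆ Ψ '' U := by
          refine (Metric.closedBall_subset_cthickening (mem_image_of_mem Ψ hxs) _).trans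
            ((Metric.cthickening_mono ?_ _).trans hδ')
          exact (one_div_le_one_div_of_le (by positivity) (by simpa using hn)).trans hn₀.le
        have := classicalGrad_mollify hO.measurableSet hv (v' := v') (V' := V')
          (fun y hy => indicator_of_mem hy v) (fun y hy => indicator_of_mem hy V)
          hvi.locallyIntegrable hVi.locallyIntegrable hball
        simp only [pullGrad, this, Finset.sum_mul]
        refine Finset.sum_congr rfl fun j _ => ?_
        rw [mollify_pi_apply hVi.locallyIntegrable]
        ring
      · simp [image_eq_zero_of_notMem_tsupport hxs]
  have l1 := t1.1
  have l2 := (tendsto_finsetSum Finset.univ fun j _ => (t2 j).1).neg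
  have hfinal := tendsto_nhds_unique (l1.congr' (eventually_atTop.2 ⟨n₀, hev⟩)) l2
  rw [← integral_finsetSum _ fun j _ => (t2 j).2.2] at hfinal
  refine Eq.trans ?_ (hfinal.trans ?_)
  · refine setIntegral_congr_fun hU.measurableSet fun x hx => ?_
    simp only [Function.comp_apply, hv']
    rw [indicator_of_mem (mem_image_of_mem Ψ hx), mul_comm]
  · congr 1
    refine setIntegral_congr_fun hU.measurableSet fun x hx => ?_
    simp only [hV', pullGrad, Finset.sum_mul]
    refine Finset.sum_congr rfl fun j _ => ?_
    rw [indicator_of_mem (mem_image_of_mem Ψ hx)]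
    ring

end ChainRule

/-! ### Bi-Lipschitz invariance of the Sobolev spaces -/

section SobolevInvariance

open Filter Topology

variable {N : ℕ} {U : Set (Rn N)} {Ψ : Rn N → Rn N}

lemma tendsto_eLpNorm_two_of_bounded {α F : Type*} [MeasurableSpace α] {μ : Measure α}
    [IsFiniteMeasure μ] [NormedAddCommGroup F] {f : ℕ → α → F}
    (hf : ∀ n, AEStronglyMeasurable (f n) μ) {C : ℝ} (hC : ∀ n, ∀ᵐ x ∂μ, ‖f n x‖ ≤ C)
    (hlim : ∀ᵐ x ∂μ, Tendsto (fun n => f n x) atTop (𝓝 0)) :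
    Tendsto (fun n => eLpNorm (f n) 2 μ) atTop (𝓝 0) := by
  have h1 : Tendsto (fun n => ∫⁻ x, ‖f n x‖ₑ ^ (2 : ℝ) ∂μ) atTop (𝓝 (∫⁻ _, 0 ∂μ)) := by
    refine tendsto_lintegral_of_dominated_convergence' (fun _ => ENNReal.ofReal C ^ (2 : ℝ))
      (fun n => (hf n).enorm.pow_const _) (fun n => ?_) ?_ ?_
    · filter_upwards [hC n] with x hx
      refine ENNReal.rpow_le_rpow ?_ (by norm_num)
      rw [← ofReal_norm]
      exact ENNReal.ofReal_le_ofReal hx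
    · rw [lintegral_const]
      exact ENNReal.mul_ne_top (ENNReal.rpow_ne_top_of_nonneg (by norm_num) ENNReal.ofReal_ne_top)
        (measure_ne_top _ _)
    · filter_upwards [hlim] with x hx
      have h2 := (hx.enorm).ennrpow_const (2 : ℝ)
      simpa using h2
  have h2 := h1.ennrpow_const (1 / 2 : ℝ)
  simp only [lintegral_zero] at h2
  rw [ENNReal.zero_rpow_of_pos (by norm_num)] at h2
  refine h2.congr fun n => ?_
  rw [eLpNorm_eq_lintegral_rpow_enorm_toReal (by simp) (by simp)]
  simp

lemma isTestFunction_mollify {f : Rn N → ℂ} (hf : LocallyIntegrable f) {K : Set (Rn N)}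
    (hK : IsCompact K) (hfK : ∀ x ∉ K, f x = 0) {n : ℕ}
    (hn : Metric.cthickening (1 / (n + 1)) K ⊆ U) : IsTestFunction U (mollify n f) := by
  have hs : tsupport (mollify n f) ⊆ Metric.cthickening (1 / (n + 1)) K := by
    refine closure_minimal (fun x hx => ?_) Metric.isClosed_cthickening
    by_contra hx'
    refine hx (mollify_eq_zero fun y hy => hfK y fun hyK => hx' ?_)
    exact Metric.mem_cthickening_of_dist_le x y _ _ hyK (by rwa [dist_comm])
  exact ⟨contDiff_mollify hf n, hK.cthickening.of_isClosed_subset (isClosed_tsupport _) hs,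
    hs.trans hn⟩

/-- The composite `η ∘ Ψ` has compact support in `U` but is only Lipschitz. Its extension by zero is
Lipschitz on the whole space, and the mollifications are test functions in `U` that converge
boundedly almost everywhere together with their gradients. -/
lemma IsTransformation.exists_testFunction_approx (h : IsTransformation U Ψ) (hU : IsOpen U)
    (hb : Bornology.IsBounded U) {η : Rn N → ℂ} (hη : IsTestFunction (Ψ '' U) η) {ε : ℝ≥0∞}
    (hε : 0 < ε) : ∃ ζ, IsTestFunction U ζ ∧
      eLpNorm (fun x => η (Ψ x) - ζ x) 2 (volume.restrict U) +
      eLpNorm (fun x => pullGrad Ψ (classicalGrad η) x - classicalGrad ζ x) 2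
        (volume.restrict U) < ε := by
  obtain ⟨K, hK⟩ := h.lipschitz
  have hfinU : IsFiniteMeasure (volume.restrict U) :=
    ⟨by rw [Measure.restrict_apply_univ]; exact hb.measure_lt_top⟩
  obtain ⟨Φ, hΦ, -, hΦΨ⟩ := (IsTransformation.refl hU).transition h
  have hcpt : IsCompact (Φ '' tsupport η) :=
    hη.2.1.isCompact.image_of_continuousOn (hΦ.continuousOn.mono hη.2.2)
  have hcU : Φ '' tsupport η ⊆ U := by
    rintro _ ⟨y, hy, rfl⟩
    obtain ⟨x, hx, rfl⟩ := hη.2.2 hy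
    rw [hΦΨ x hx]; exact hx
  set f : Rn N → ℂ := indicator U (η ∘ Ψ) with hf
  have hfU : ∀ x ∈ U, f x = η (Ψ x) := fun x hx => indicator_of_mem hx _
  have hf0 : ∀ x ∉ Φ '' tsupport η, f x = 0 := by
    intro x hx
    by_cases hxU : x ∈ U
    · rw [hfU x hxU]
      refine image_eq_zero_of_notMem_tsupport fun hx' => hx ⟨Ψ x, hx', hΦΨ x hxU⟩
    · exact indicator_of_notMem hxU _
  obtain ⟨δ, hδ, hδU⟩ := hcpt.exists_cthickening_subset_open hU hcU
  obtain ⟨M, hM⟩ := hη.2.1.exists_bound_of_continuous hη.1.continuous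
  have hM0 : 0 ≤ M := (norm_nonneg _).trans (hM 0)
  obtain ⟨D, hD⟩ := ContDiff.lipschitzWith_of_hasCompactSupport hη.2.1 hη.1 (by simp)
  have hfM : ∀ x, ‖f x‖ ≤ M := fun x => by
    by_cases hxU : x ∈ U
    · rw [hfU x hxU]; exact hM _
    · rw [hf, indicator_of_notMem hxU, norm_zero]; exact hM0
  -- If `f x ≠ 0`, then `x` has distance more than `δ` from every point outside `U`, so the bound
  -- `M` for `f` is at most `M / δ` times that distance.
  have hcase : ∀ x ∈ U, ∀ y ∉ U, dist (f x) (f y) ≤ M / δ * dist x y := by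
    intro x hx y hy
    rw [hf, indicator_of_notMem hy, ← hf, dist_zero_right]
    by_cases hxs : x ∈ Φ '' tsupport η
    · have : δ < dist x y := by
        by_contra hlt
        exact hy (hδU (Metric.mem_cthickening_of_dist_le y x _ _ hxs
          (by rw [dist_comm]; exact not_lt.1 hlt)))
      calc ‖f x‖ ≤ M := hfM x
        _ = M / δ * δ := by field_simp
        _ ≤ _ := by gcongr
    · rw [hf0 x hxs, norm_zero]; positivity
  have hfL : LipschitzWith (D * K + (M / δ).toNNReal) f := by
    refine LipschitzWith.of_dist_le_mul fun x y => ?_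
    have hc : ((D * K + (M / δ).toNNReal : ℝ≥0) : ℝ) = D * K + M / δ := by
      push_cast; rw [Real.coe_toNNReal _ (by positivity)]
    rw [hc, add_mul]
    have n1 : 0 ≤ M / δ * dist x y := by positivity
    have n2 : 0 ≤ (D : ℝ) * K * dist x y := by positivity
    by_cases hx : x ∈ U <;> by_cases hy : y ∈ U
    · rw [hfU x hx, hfU y hy]
      have := (hD.dist_le_mul (Ψ x) (Ψ y)).trans
        (mul_le_mul_of_nonneg_left (hK.dist_le_mul x hx y hy) D.2)
      linarith [mul_assoc (D : ℝ) K (dist x y)]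
    · linarith [hcase x hx y hy]
    · rw [dist_comm (f x), dist_comm x] at *
      linarith [hcase y hy x hx]
    · rw [hf, indicator_of_notMem hx, indicator_of_notMem hy, dist_self]; linarith
  set K' := D * K + (M / δ).toNNReal
  have hgl : LocallyIntegrable (classicalGrad f) :=
    locallyIntegrable_of_bounded (measurable_classicalGrad f).aestronglyMeasurable
      (LipschitzWith.norm_classicalGrad_le' hfL)
  have hmg : ∀ n, classicalGrad (mollify n f) = mollify n (classicalGrad f) := fun n => by
    ext1 x
    exact classicalGrad_mollify MeasurableSet.univ (LipschitzWith.hasWeakGrad hfL univ)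
      (fun _ _ => rfl) (fun _ _ => rfl) hfL.continuous.locallyIntegrable hgl (subset_univ _)
  have t1 : Tendsto (fun n => eLpNorm (fun x => f x - mollify n f x) 2 (volume.restrict U))
      atTop (𝓝 0) := by
    refine tendsto_eLpNorm_two_of_bounded (C := M + M) (fun n => ?_) (fun n => ?_) ?_
    · exact (hfL.continuous.sub
        (contDiff_mollify hfL.continuous.locallyIntegrable n).continuous).aestronglyMeasurable
    · exact ae_of_all _ fun x => (norm_sub_le _ _).trans
        (add_le_add (hfM x) (norm_mollify_le hfM n x))
    · refine ae_of_all _ fun x => ?_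
      simpa using (tendsto_mollify_of_continuous hfL.continuous x).const_sub (f x)
  have t2 : Tendsto (fun n => eLpNorm (fun x => classicalGrad f x - mollify n (classicalGrad f) x) 2
      (volume.restrict U)) atTop (𝓝 0) := by
    refine tendsto_eLpNorm_two_of_bounded (C := N * K' + N * K') (fun n => ?_) (fun n => ?_) ?_
    · exact (measurable_classicalGrad f).aestronglyMeasurable.sub
        (contDiff_mollify hgl n).continuous.aestronglyMeasurable
    · exact ae_of_all _ fun x => (norm_sub_le _ _).trans
        (add_le_add (LipschitzWith.norm_classicalGrad_le' hfL x)
          (norm_mollify_le (LipschitzWith.norm_classicalGrad_le' hfL) n x))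
    · filter_upwards [ae_restrict_of_ae (ae_tendsto_mollify hgl)] with x hx
      simpa using hx.const_sub (classicalGrad f x)
  have t3 := t1.add t2
  rw [add_zero] at t3
  obtain ⟨n₀, hn₀⟩ := exists_nat_one_div_lt hδ
  obtain ⟨n, hn1, hn2⟩ := ((t3.eventually (gt_mem_nhds hε)).and (eventually_ge_atTop n₀)).exists
  refine ⟨mollify n f, isTestFunction_mollify hfL.continuous.locallyIntegrable hcpt hf0
    ((Metric.cthickening_mono ?_ _).trans hδU), ?_⟩
  · exact (one_div_le_one_div_of_le (by positivity) (by simpa using hn2)).trans hn₀.le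
  · refine lt_of_eq_of_lt ?_ hn1
    congr 1
    · refine eLpNorm_congr_ae ?_
      filter_upwards [ae_restrict_mem hU.measurableSet] with x hx
      rw [hfU x hx]
    · refine eLpNorm_congr_ae ?_
      filter_upwards [ae_restrict_mem hU.measurableSet, h.ae_differentiableAt hU] with x hx hd
      rw [hmg n, ← classicalGrad_comp (hη.1.differentiable (by simp) _) hd]
      congr 1
      refine classicalGrad_congr ?_
      filter_upwards [hU.mem_nhds hx] with y hy
      exact (hfU y hy).symm

/-- Both Sobolev spaces are invariant under bi-Lipschitz changes of variables. -/
lemma MemSobolev.comp_transformation {bc : BoundaryCondition} (h : IsTransformation U Ψ)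
    (hU : IsOpen U) (hb : Bornology.IsBounded U) {v : Rn N → ℂ}
    (hv : MemSobolev bc (Ψ '' U) v) : MemSobolev bc U (v ∘ Ψ) := by
  obtain ⟨V, hV, hv2, hV2, happ⟩ := hv
  refine ⟨pullGrad Ψ V, hV.comp_transformation h hU hb hv2 hV2, h.memLp_comp hU (by simp) hv2,
    h.memLp_pullGrad hU hV2, fun hbc ε hε => ?_⟩
  obtain ⟨C, hC, hCle⟩ := h.exists_eLpNorm_comp_le hU 2 (by simp)
  obtain ⟨D, hD, hDle⟩ := h.exists_eLpNorm_pullGrad_le hU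
  have hCD : C + D + 1 ≠ ⊤ := by simp [hC, hD]
  have hCDr : 0 < (C + D + 1).toReal := ENNReal.toReal_pos (by simp) hCD
  -- Transport by `Ψ` multiplies the errors of the function and the gradient by `C` and `D`; the
  -- summand `1` only prevents division by zero. The other `ε / 2` pays for smoothing `η ∘ Ψ`.
  obtain ⟨η, hη, hηe⟩ := happ hbc (ε / 2 / (C + D + 1).toReal) (by positivity)
  obtain ⟨ζ, hζ, hζe⟩ := h.exists_testFunction_approx hU hb hη
    (ENNReal.ofReal_pos.2 (half_pos hε))
  refine ⟨ζ, hζ, ?_⟩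
  have hηc := hη.1.continuous
  have m1 : AEStronglyMeasurable (fun x => v x - η x) (volume.restrict (Ψ '' U)) :=
    hv2.1.sub hηc.aestronglyMeasurable
  have m2 : AEStronglyMeasurable (fun x => V x - classicalGrad η x) (volume.restrict (Ψ '' U)) :=
    hV2.1.sub (measurable_classicalGrad η).aestronglyMeasurable
  have e1 : eLpNorm (fun x => (v ∘ Ψ) x - ζ x) 2 (volume.restrict U) ≤
      C * eLpNorm (fun x => v x - η x) 2 (volume.restrict (Ψ '' U)) +
      eLpNorm (fun x => η (Ψ x) - ζ x) 2 (volume.restrict U) := by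
    have := eLpNorm_add_le (h.aestronglyMeasurable_comp hU m1)
      ((h.aestronglyMeasurable_comp hU hηc.aestronglyMeasurable).sub
        (hζ.1.continuous.aestronglyMeasurable (μ := volume.restrict U))) (p := 2) (by norm_num)
    refine le_trans (le_of_eq ?_) (this.trans (add_le_add_left (hCle _ m1) _))
    congr 1; ext x; simp
  have e2 : eLpNorm (fun x => pullGrad Ψ V x - classicalGrad ζ x) 2 (volume.restrict U) ≤
      D * eLpNorm (fun x => V x - classicalGrad η x) 2 (volume.restrict (Ψ '' U)) +
      eLpNorm (fun x => pullGrad Ψ (classicalGrad η) x - classicalGrad ζ x) 2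
        (volume.restrict U) := by
    have := eLpNorm_add_le (h.aestronglyMeasurable_pullGrad hU m2)
      ((h.aestronglyMeasurable_pullGrad hU
        (measurable_classicalGrad η).aestronglyMeasurable).sub
        ((measurable_classicalGrad ζ).aestronglyMeasurable (μ := volume.restrict U)))
      (p := 2) (by norm_num)
    refine le_trans (le_of_eq ?_) (this.trans (add_le_add_left (hDle _ m2) _))
    congr 1; ext x i
    simp [pullGrad, mul_sub]
  refine lt_of_le_of_lt (add_le_add e1 e2) ?_
  set a := eLpNorm (fun x => v x - η x) 2 (volume.restrict (Ψ '' U))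
  set b := eLpNorm (fun x => V x - classicalGrad η x) 2 (volume.restrict (Ψ '' U))
  have key : C * a + D * b ≤ ENNReal.ofReal (ε / 2) := by
    calc C * a + D * b ≤ (C + D + 1) * a + (C + D + 1) * b := by
          gcongr
          · rw [add_assoc]; exact le_self_add
          · rw [add_comm C D, add_assoc]; exact le_self_add
      _ = (C + D + 1) * (a + b) := by ring
      _ ≤ (C + D + 1) * ENNReal.ofReal (ε / 2 / (C + D + 1).toReal) := by gcongr
      _ = ENNReal.ofReal (ε / 2) := by
          nth_rewrite 1 [← ENNReal.ofReal_toReal hCD]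
          rw [← ENNReal.ofReal_mul hCDr.le]
          congr 1; field_simp
  calc _ = (C * a + D * b) + (eLpNorm (fun x => η (Ψ x) - ζ x) 2 (volume.restrict U) +
      eLpNorm (fun x => pullGrad Ψ (classicalGrad η) x - classicalGrad ζ x) 2
        (volume.restrict U)) := by ring
    _ < ENNReal.ofReal (ε / 2) + ENNReal.ofReal (ε / 2) := by
      exact ENNReal.add_lt_add_of_le_of_lt (ne_top_of_le_ne_top ENNReal.ofReal_ne_top key) key hζe
    _ = ENNReal.ofReal ε := by
      rw [← ENNReal.ofReal_add (by positivity) (by positivity), add_halves]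

end SobolevInvariance

/-! ### Functions with vanishing weak gradient; the Poincaré inequality -/

section ZeroGradient

open Filter Topology

variable {N : ℕ} {U : Set (Rn N)}

lemma HasWeakGrad.mono {v : Rn N → ℂ} {V : Rn N → EuclideanSpace ℂ (Fin N)}
    (h : HasWeakGrad U v V) {U' : Set (Rn N)} (hU' : U' ⊆ U) : HasWeakGrad U' v V := by
  refine ⟨h.1.mono_set hU', h.2.1.mono_set hU', fun η hη i => ?_⟩
  have := h.2.2 η ⟨hη.1, hη.2.1, hη.2.2.trans hU'⟩ i
  rwa [setIntegral_mul_classicalGrad_eq_integral (hη.2.2.trans hU'),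
    setIntegral_mul_eq_integral (hη.2.2.trans hU'),
    ← setIntegral_mul_classicalGrad_eq_integral hη.2.2,
    ← setIntegral_mul_eq_integral hη.2.2] at this

lemma fderiv_eq_zero_of_classicalGrad_eq_zero {f : Rn N → ℂ} {x : Rn N}
    (h : classicalGrad f x = 0) : fderiv ℝ f x = 0 := by
  ext ξ
  have h1 : ξ = ∑ j, ξ j • EuclideanSpace.single j (1 : ℝ) := by
    ext k; simp [Pi.single_apply]
  rw [h1, map_sum]
  refine Finset.sum_eq_zero fun j _ => ?_
  have : fderiv ℝ f x (EuclideanSpace.single j 1) = 0 := congrArg (fun w => w j) h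
  rw [map_smul, this, smul_zero]

/-- On the half ball the mollifications at small scale have zero gradient, hence are constant. They
converge almost everywhere, so one point of convergence `z` determines the constant. -/
lemma HasWeakGrad.exists_ae_eq_const_ball (hU : IsOpen U) {v : Rn N → ℂ}
    {V : Rn N → EuclideanSpace ℂ (Fin N)}
    (h : HasWeakGrad U v V) (hV : V =ᵐ[volume.restrict U] 0) {x₀ : Rn N} (hx₀ : x₀ ∈ U) :
    ∃ r > 0, Metric.ball x₀ r ⊆ U ∧ ∃ c, ∀ᵐ x, x ∈ Metric.ball x₀ r → v x = c := by
  have h0 : HasWeakGrad U v 0 := h.congr (ae_eq_refl v) hV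
  obtain ⟨R, hR, hRU⟩ := Metric.nhds_basis_closedBall.mem_iff.1 (hU.mem_nhds hx₀)
  set v' := indicator (Metric.closedBall x₀ R) v
  have hvi : Integrable v' := (integrable_indicator_iff measurableSet_closedBall).2
    (h.1.integrableOn_compact_subset hRU (isCompact_closedBall _ _))
  have hvl := hvi.locallyIntegrable
  have hb : HasWeakGrad (Metric.closedBall x₀ R) v 0 := h0.mono hRU
  obtain ⟨n₀, hn₀⟩ := exists_nat_one_div_lt (half_pos hR)
  have hconst : ∀ n ≥ n₀, ∀ x ∈ Metric.ball x₀ (R / 2), mollify n v' x = mollify n v' x₀ := by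
    intro n hn x hx
    have hd : DifferentiableOn ℝ (mollify n v') (Metric.ball x₀ (R / 2)) :=
      ((contDiff_mollify hvl n).differentiable (by simp)).differentiableOn
    refine Metric.isOpen_ball.is_const_of_fderiv_eq_zero
      (convex_ball x₀ (R / 2)).isPreconnected hd (fun y hy => ?_) hx
      (Metric.mem_ball_self (half_pos hR))
    refine fderiv_eq_zero_of_classicalGrad_eq_zero ?_
    have hball : Metric.closedBall y (1 / ((n : ℝ) + 1)) ⊆ Metric.closedBall x₀ R := by
      refine Metric.closedBall_subset_closedBall' ?_
      have h1 : 1 / ((n : ℝ) + 1) ≤ 1 / (n₀ + 1) :=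
        one_div_le_one_div_of_le (by positivity) (by simpa using hn)
      have := Metric.mem_ball.1 hy
      linarith
    rw [classicalGrad_mollify measurableSet_closedBall hb (fun z hz => indicator_of_mem hz v)
      (V' := 0) (fun _ _ => rfl) hvl (locallyIntegrable_zero) hball]
    simp [mollify_apply]
  have hae := ae_tendsto_mollify hvl
  have hpos : volume (Metric.ball x₀ (R / 2)) ≠ 0 :=
    (Metric.measure_ball_pos volume x₀ (half_pos hR)).ne'
  obtain ⟨z, hz, hzl⟩ : ∃ z ∈ Metric.ball x₀ (R / 2),
      Tendsto (fun n => mollify n v' z) atTop (𝓝 (v' z)) := by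
    by_contra hcon
    push Not at hcon
    exact hpos (measure_mono_null (fun z hz => hcon z hz) hae)
  refine ⟨R / 2, half_pos hR, (Metric.ball_subset_closedBall.trans
    (Metric.closedBall_subset_closedBall (by linarith))).trans hRU, v' z, ?_⟩
  filter_upwards [hae] with x hx hxb
  have hxR : x ∈ Metric.closedBall x₀ R :=
    Metric.closedBall_subset_closedBall (by linarith) (Metric.ball_subset_closedBall hxb)
  have hx' : v x = v' x := (indicator_of_mem hxR v).symm
  rw [hx']
  refine tendsto_nhds_unique (hx.congr' ?_) hzl
  filter_upwards [eventually_ge_atTop n₀] with n hn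
  rw [hconst n hn x hxb, hconst n hn z hz]

/-- A function with vanishing weak gradient on a connected open set is constant. -/
lemma HasWeakGrad.exists_ae_eq_const (hU : IsOpen U) (hc : IsConnected U) {v : Rn N → ℂ}
    {V : Rn N → EuclideanSpace ℂ (Fin N)}
    (h : HasWeakGrad U v V) (hV : V =ᵐ[volume.restrict U] 0) :
    ∃ c, v =ᵐ[volume.restrict U] fun _ => c := by
  have hloc := fun x (hx : x ∈ U) => h.exists_ae_eq_const_ball hU hV hx
  obtain ⟨x₀, hx₀⟩ := hc.nonempty
  obtain ⟨r₀, hr₀, hr₀U, c₀, hc₀⟩ := hloc x₀ hx₀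
  -- `S T` consists of the points near which `v` is almost everywhere equal to some constant in `T`.
  -- The open sets `S {c₀}` and `S {c₀}ᶜ` are disjoint and cover `U`, so by connectedness the first
  -- contains `U`.
  let S : Set ℂ → Set (Rn N) := fun T =>
    {x | ∃ r > 0, ∃ c ∈ T, ∀ᵐ y, y ∈ Metric.ball x r → v y = c}
  have hS : ∀ T, IsOpen (S T) := by
    intro T
    rw [Metric.isOpen_iff]
    rintro x ⟨r, hr, c, hcT, hrc⟩
    refine ⟨r / 2, half_pos hr, fun y hy => ⟨r / 2, half_pos hr, c, hcT, ?_⟩⟩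
    filter_upwards [hrc] with z hz hzy
    refine hz ?_
    rw [Metric.mem_ball] at *
    linarith [dist_triangle z y x]
  have hdis : Disjoint (S {c₀}) (S {c₀}ᶜ) := by
    rw [Set.disjoint_left]
    rintro x ⟨r, hr, c, hcT, hrc⟩ ⟨r', hr', c', hcT', hrc'⟩
    have hpos : volume (Metric.ball x (min r r')) ≠ 0 :=
      (Metric.measure_ball_pos volume x (lt_min hr hr')).ne'
    have hne : c ≠ c' := fun hcc => hcT' (hcc ▸ hcT)
    refine hpos (measure_mono_null ?_ (ae_iff.1 (hrc.and hrc')))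
    intro y hy hcon
    exact hne ((hcon.1 (Metric.ball_subset_ball (min_le_left _ _) hy)).symm.trans
      (hcon.2 (Metric.ball_subset_ball (min_le_right _ _) hy)))
  have hcov : U ⊆ S {c₀} ∪ S {c₀}ᶜ := by
    intro x hx
    obtain ⟨r, hr, -, c, hrc⟩ := hloc x hx
    by_cases hcc : c = c₀
    · exact Or.inl ⟨r, hr, c, hcc, hrc⟩
    · exact Or.inr ⟨r, hr, c, hcc, hrc⟩
  have hsub := hc.isPreconnected.subset_left_of_subset_union (hS _) (hS _) hdis hcov
    ⟨x₀, hx₀, r₀, hr₀, c₀, rfl, hc₀⟩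
  refine ⟨c₀, ?_⟩
  rw [EventuallyEq, ae_restrict_iff' hU.measurableSet, ae_iff]
  refine measure_null_of_locally_null _ fun x hx => ?_
  have hxU : x ∈ U := by
    by_contra hh; exact hx fun hh' => absurd hh' hh
  obtain ⟨r, hr, c, hcc, hrc⟩ := hsub hxU
  rw [mem_singleton_iff] at hcc
  subst hcc
  refine ⟨Metric.ball x r ∩ {y | ¬ (y ∈ Metric.ball x r → v y = c)} ∪
    {y | ¬ (y ∈ U → v y = c)} ∩ Metric.ball x r, ?_, ?_⟩
  · exact mem_of_superset (inter_mem self_mem_nhdsWithin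
      (mem_nhdsWithin_of_mem_nhds (Metric.ball_mem_nhds x hr))) subset_union_right
  · refine measure_mono_null ?_ (ae_iff.1 hrc)
    rintro y (⟨hy1, hy2⟩ | ⟨hy1, hy2⟩)
    · exact hy2
    · exact fun hcon => hy1 fun _ => hcon hy2

lemma eLpNorm_two_sq_eq {α F : Type*} [MeasurableSpace α] {μ : Measure α} [NormedAddCommGroup F]
    {f : α → F} (hf : MemLp f 2 μ) :
    eLpNorm f 2 μ ^ 2 = ENNReal.ofReal (∫ x, ‖f x‖ ^ 2 ∂μ) := by
  rw [eLpNorm_eq_lintegral_rpow_enorm_toReal (by simp) (by simp), ← ENNReal.rpow_natCast,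
    ← ENNReal.rpow_mul, ENNReal.toReal_ofNat, Nat.cast_ofNat, one_div_mul_cancel two_ne_zero,
    ENNReal.rpow_one, ofReal_integral_eq_lintegral_ofReal ((memLp_two_iff_integrable_sq_norm hf.1).1 hf)
      (ae_of_all _ fun x => by positivity)]
  simp [ENNReal.ofReal_pow]

lemma IsTestFunction.memLp_classicalGrad {η : Rn N → ℂ} (hη : IsTestFunction U η) :
    MemLp (classicalGrad η) 2 volume := by
  have hgc : Continuous (classicalGrad η) :=
    (PiLp.continuous_toLp 2 fun _ : Fin N => ℂ).comp (continuous_pi fun j =>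
      (hη.1.continuous_fderiv (by simp)).clm_apply continuous_const)
  have hgs : HasCompactSupport (classicalGrad η) :=
    hη.2.1.mono' fun x hx => by
      by_contra hx'
      exact hx (classicalGrad_eq_zero hx')
  exact hgc.memLp_of_hasCompactSupport hgs

/-- Integrate `|η|² = |η|² ∂_i x_i` by parts and use `|x_i| ≤ R` on the support of `η`. -/
lemma IsTestFunction.integral_sq_le {η : Rn N → ℂ} (hη : IsTestFunction U η) {R : ℝ}
    (hR0 : 0 ≤ R) (hR : ∀ x ∈ U, ‖x‖ ≤ R) (i : Fin N) :
    ∫ x, ‖η x‖ ^ 2 ≤ (2 * R) ^ 2 * ∫ x, ‖classicalGrad η x‖ ^ 2 := by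
  set e : Rn N := EuclideanSpace.single i 1
  have hd : ∀ x, HasFDerivAt η (fderiv ℝ η x) x := fun x =>
    ((hη.1.differentiable (by simp)) x).hasFDerivAt
  have hη2 : ContDiff ℝ ∞ fun x => ‖η x‖ ^ 2 := hη.1.norm_sq ℝ
  have hfd : ∀ x, |fderiv ℝ (fun x => ‖η x‖ ^ 2) x e| ≤ 2 * (‖η x‖ * ‖classicalGrad η x‖) := by
    intro x
    rw [((hd x).norm_sq).fderiv]
    have h1 : |inner ℝ (η x) (fderiv ℝ η x e)| ≤ ‖η x‖ * ‖classicalGrad η x‖ :=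
      (abs_real_inner_le_norm _ _).trans (mul_le_mul_of_nonneg_left
        (PiLp.norm_apply_le (classicalGrad η x) i) (norm_nonneg _))
    have h3 : (2 • (innerSL ℝ (η x)).comp (fderiv ℝ η x)) e = 2 * inner ℝ (η x) (fderiv ℝ η x e) := by
      rw [_root_.smul_apply, two_smul, two_mul]; rfl
    rw [h3, abs_mul, abs_two]
    linarith
  have hfs : HasCompactSupport fun x => ‖η x‖ ^ 2 :=
    hη.2.1.comp_left (g := fun z : ℂ => ‖z‖ ^ 2) (by simp)
  have hfds : HasCompactSupport fun x => fderiv ℝ (fun x => ‖η x‖ ^ 2) x e := hfs.fderiv_apply ℝ e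
  have hfdc : Continuous fun x => fderiv ℝ (fun x => ‖η x‖ ^ 2) x e :=
    (hη2.continuous_fderiv (by simp)).clm_apply continuous_const
  have hpc : Continuous fun x : Rn N => x i := by fun_prop
  have hpd : ∀ x, HasFDerivAt (fun x : Rn N => x i) (EuclideanSpace.proj i : Rn N →L[ℝ] ℝ) x :=
    fun x => (EuclideanSpace.proj i : Rn N →L[ℝ] ℝ).hasFDerivAt
  have hpe : ∀ x, fderiv ℝ (fun x : Rn N => x i) x e = 1 := fun x => by
    rw [(hpd x).fderiv]; simp [e]
  have hi : Integrable fun x => ‖η x‖ ^ 2 := hη2.continuous.integrable_of_hasCompactSupport hfs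
  have hig : Integrable fun x => ‖classicalGrad η x‖ ^ 2 :=
    (memLp_two_iff_integrable_sq_norm hη.memLp_classicalGrad.1).1 hη.memLp_classicalGrad
  have hibp := integral_mul_fderiv_eq_neg_fderiv_mul_of_integrable (μ := (volume : Measure (Rn N)))
    (f := fun x : Rn N => x i) (g := fun x => ‖η x‖ ^ 2) (v := e)
    (by simpa [hpe] using hi)
    ((hpc.mul hfdc).integrable_of_hasCompactSupport hfds.mul_left)
    ((hpc.mul hη2.continuous).integrable_of_hasCompactSupport hfs.mul_left)
    (fun x _ => (hpd x).differentiableAt) (fun x _ => (hη2.differentiable (by simp)) x)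
  simp only [hpe, one_mul] at hibp
  have hmain : ∫ x, ‖η x‖ ^ 2 ≤ (2 * R) ^ 2 * ∫ x, ‖classicalGrad η x‖ ^ 2 := by
    have h1 : ∫ x, ‖η x‖ ^ 2 ≤ ∫ x, (1 / 2 * ‖η x‖ ^ 2 + 2 * R ^ 2 * ‖classicalGrad η x‖ ^ 2) := by
      rw [← neg_eq_iff_eq_neg.2 hibp, ← integral_neg]
      refine integral_mono ((hpc.mul hfdc).integrable_of_hasCompactSupport hfds.mul_left).neg
        ((hi.const_mul _).add (hig.const_mul _)) fun x => ?_
      by_cases hx : x ∈ tsupport η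
      · have hx1 : |x i| ≤ R := (PiLp.norm_apply_le x i).trans (hR x (hη.2.2 hx))
        have h2 : -(x i * fderiv ℝ (fun x => ‖η x‖ ^ 2) x e) ≤
            R * (2 * (‖η x‖ * ‖classicalGrad η x‖)) := by
          refine (neg_le_abs _).trans ?_
          rw [abs_mul]
          exact mul_le_mul hx1 (hfd x) (abs_nonneg _) hR0
        simp only
        -- Young's inequality `2R|η||∇η| ≤ |η|²/2 + 2R²|∇η|²`; the first term is absorbed after
        -- integration, which produces the constant `(2R)²`.
        nlinarith [sq_nonneg (‖η x‖ - 2 * R * ‖classicalGrad η x‖)]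
      · have h0 : fderiv ℝ (fun x => ‖η x‖ ^ 2) x e = 0 := by
          have := hfd x
          rw [image_eq_zero_of_notMem_tsupport hx, norm_zero, zero_mul, mul_zero] at this
          exact abs_nonpos_iff.1 this
        simp only [h0, mul_zero, neg_zero]
        positivity
    rw [integral_add (hi.const_mul _) (hig.const_mul _), integral_const_mul,
      integral_const_mul] at h1
    nlinarith
  exact hmain

/-- Poincaré inequality for test functions on a bounded set. -/
lemma IsTestFunction.eLpNorm_le_classicalGrad {η : Rn N → ℂ} (hη : IsTestFunction U η) {R : ℝ}
    (hR0 : 0 ≤ R) (hR : ∀ x ∈ U, ‖x‖ ≤ R) (i : Fin N) :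
    eLpNorm η 2 volume ≤ ENNReal.ofReal (2 * R) * eLpNorm (classicalGrad η) 2 volume := by
  have m1 : MemLp η 2 volume := hη.1.continuous.memLp_of_hasCompactSupport hη.2.1
  refine (ENNReal.pow_le_pow_left_iff two_ne_zero).1 ?_
  rw [mul_pow, eLpNorm_two_sq_eq m1, eLpNorm_two_sq_eq hη.memLp_classicalGrad,
    ← ENNReal.ofReal_pow (by positivity), ← ENNReal.ofReal_mul (by positivity)]
  exact ENNReal.ofReal_le_ofReal (hη.integral_sq_le hR0 hR i)

/-- An approximating test function has small gradient, as the gradient of `v` vanishes, so it is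
itself small by the Poincaré inequality. The condition `1 ≤ N` provides the coordinate direction for
that inequality. -/
lemma MemSobolev.ae_eq_zero_of_dirichlet (hN : 1 ≤ N) (hU : IsOpen U)
    (hb : Bornology.IsBounded U) {v : Rn N → ℂ}
    (hv : MemSobolev BoundaryCondition.dirichlet U v) {V : Rn N → EuclideanSpace ℂ (Fin N)}
    (hV : HasWeakGrad U v V) (hV0 : V =ᵐ[volume.restrict U] 0) : v =ᵐ[volume.restrict U] 0 := by
  obtain ⟨W, hW, hv2, hW2, happ⟩ := hv
  have hW0 : W =ᵐ[volume.restrict U] 0 := (hW.ae_eq hU hV).trans hV0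
  obtain ⟨R, hR⟩ := hb.exists_norm_le
  set R' := max R 0
  have key : ∀ ε : ℝ, 0 < ε → eLpNorm v 2 (volume.restrict U) ≤
      ENNReal.ofReal ((1 + 2 * R') * ε) := by
    intro ε hε
    obtain ⟨η, hη, hηe⟩ := happ rfl ε hε
    have hηm := hη.1.continuous.aestronglyMeasurable (μ := volume.restrict U)
    have h1 : eLpNorm (classicalGrad η) 2 volume =
        eLpNorm (fun x => W x - classicalGrad η x) 2 (volume.restrict U) := by
      have h2 : eLpNorm (fun x => W x - classicalGrad η x) 2 (volume.restrict U) =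
          eLpNorm (classicalGrad η) 2 (volume.restrict U) := by
        rw [← eLpNorm_neg]
        refine eLpNorm_congr_ae ?_
        filter_upwards [hW0] with x hx
        simp [hx]
      rw [h2, ← eLpNorm_indicator_eq_eLpNorm_restrict hU.measurableSet]
      congr 1
      refine (indicator_eq_self.2 fun x hx => ?_).symm
      by_contra hx'
      exact hx (classicalGrad_eq_zero fun hh => hx' (hη.2.2 hh))
    have h2 := hη.eLpNorm_le_classicalGrad (le_max_right R 0)
      (fun x hx => (hR x hx).trans (le_max_left R 0)) ⟨0, hN⟩
    have h3 : eLpNorm v 2 (volume.restrict U) ≤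
        eLpNorm (fun x => v x - η x) 2 (volume.restrict U) + eLpNorm η 2 (volume.restrict U) := by
      have := eLpNorm_add_le (hv2.1.sub hηm) hηm (p := 2) (by norm_num)
      rwa [sub_add_cancel] at this
    have h4 : eLpNorm η 2 (volume.restrict U) ≤ eLpNorm η 2 volume :=
      eLpNorm_mono_measure _ Measure.restrict_le_self
    rw [h1] at h2
    have hR'0 : 0 ≤ R' := le_max_right _ _
    calc eLpNorm v 2 (volume.restrict U) ≤ ENNReal.ofReal ε + ENNReal.ofReal (2 * R') * ENNReal.ofReal ε :=
          h3.trans (add_le_add (le_self_add.trans hηe.le) (h4.trans (h2.trans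
            (mul_le_mul_right (le_add_self.trans hηe.le) _))))
      _ = _ := by
          rw [← ENNReal.ofReal_mul (by positivity), ← ENNReal.ofReal_add hε.le (by positivity)]
          congr 1; ring
  have hz : eLpNorm v 2 (volume.restrict U) = 0 := by
    refine le_antisymm (ENNReal.le_of_forall_pos_le_add fun δ hδ _ => ?_) zero_le
    have hR'0 : 0 ≤ R' := le_max_right _ _
    refine (key (δ / (1 + 2 * R')) (by positivity)).trans (le_of_eq ?_)
    rw [zero_add, mul_div_cancel₀ _ (by positivity), ENNReal.ofReal_coe_nnreal]
  exact (eLpNorm_eq_zero_iff hv2.1 (by simp)).1 hz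

end ZeroGradient

/-! ### Real matrices on complex vectors, matrix square roots, measurability -/

section Matrices

open Filter Topology

variable {N : ℕ}

/-- The sesquilinear form of a real matrix on complex vectors. -/
noncomputable def sesq (M : Matrix (Fin N) (Fin N) ℝ) (ξ ζ : EuclideanSpace ℂ (Fin N)) : ℂ :=
  ∑ i, ∑ j, (M i j : ℂ) * ξ i * star (ζ j)

/-- A real matrix acting on a complex vector. -/
noncomputable def cmul (M : Matrix (Fin N) (Fin N) ℝ) (ξ : EuclideanSpace ℂ (Fin N)) :
    EuclideanSpace ℂ (Fin N) :=
  WithLp.toLp 2 fun i => ∑ j, (M i j : ℂ) * ξ j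

/-- Whenever a coefficient matrix factors as `Cᵗ D`, this gives a Cauchy–Schwarz bound for its form.
The two terms of `delta2` come from two such factorizations of `a - w⁻²ã`. -/
lemma sesq_transpose_mul (C D : Matrix (Fin N) (Fin N) ℝ) (ξ ζ : EuclideanSpace ℂ (Fin N)) :
    sesq (C.transpose * D) ξ ζ = inner ℂ (cmul D ζ) (cmul C ξ) := by
  simp only [sesq, cmul, PiLp.inner_apply, Matrix.mul_apply, Matrix.transpose_apply, RCLike.inner_apply,
    map_sum, map_mul, Complex.ofReal_sum, Complex.ofReal_mul, Finset.sum_mul, Finset.mul_sum,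
    Complex.conj_ofReal]
  calc _ = ∑ i, ∑ k, ∑ j, ((C k i : ℂ) * (D k j : ℂ)) * ξ i * star (ζ j) :=
        Finset.sum_congr rfl fun i _ => Finset.sum_comm
    _ = ∑ k, ∑ i, ∑ j, ((C k i : ℂ) * (D k j : ℂ)) * ξ i * star (ζ j) := Finset.sum_comm
    _ = _ := by
      refine Finset.sum_congr rfl fun k _ => ?_
      rw [Finset.sum_comm]
      refine Finset.sum_congr rfl fun j _ => Finset.sum_congr rfl fun i _ => ?_
      simp only [RCLike.star_def]
      ring

lemma sesq_transpose_mul_self (C : Matrix (Fin N) (Fin N) ℝ) (ξ : EuclideanSpace ℂ (Fin N)) :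
    sesq (C.transpose * C) ξ ξ = ((‖cmul C ξ‖ ^ 2 : ℝ) : ℂ) := by
  rw [sesq_transpose_mul, inner_self_eq_norm_sq_to_K]; norm_cast

lemma norm_sesq_transpose_mul_le (C D : Matrix (Fin N) (Fin N) ℝ)
    (ξ ζ : EuclideanSpace ℂ (Fin N)) :
    ‖sesq (C.transpose * D) ξ ζ‖ ≤ ‖cmul C ξ‖ * ‖cmul D ζ‖ := by
  rw [sesq_transpose_mul, mul_comm]
  exact norm_inner_le_norm _ _

lemma sesq_star_swap {M : Matrix (Fin N) (Fin N) ℝ} (hM : M.IsSymm)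
    (ξ ζ : EuclideanSpace ℂ (Fin N)) : star (sesq M ξ ζ) = sesq M ζ ξ := by
  simp only [sesq, star_sum, star_mul', star_star]
  rw [Finset.sum_comm]
  refine Finset.sum_congr rfl fun i _ => Finset.sum_congr rfl fun j _ => ?_
  rw [hM.apply i j]
  simp only [RCLike.star_def, Complex.conj_ofReal]
  ring

lemma sesq_sub (M M' : Matrix (Fin N) (Fin N) ℝ) (ξ ζ : EuclideanSpace ℂ (Fin N)) :
    sesq (M - M') ξ ζ = sesq M ξ ζ - sesq M' ξ ζ := by
  simp only [sesq, Matrix.sub_apply, Complex.ofReal_sub, sub_mul, Finset.sum_sub_distrib]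

lemma sesq_smul (c : ℝ) (M : Matrix (Fin N) (Fin N) ℝ) (ξ ζ : EuclideanSpace ℂ (Fin N)) :
    sesq (c • M) ξ ζ = c * sesq M ξ ζ := by
  simp only [sesq, Matrix.smul_apply, smul_eq_mul, Complex.ofReal_mul, Finset.mul_sum, mul_assoc]

lemma sesq_neg (M : Matrix (Fin N) (Fin N) ℝ) (ξ ζ : EuclideanSpace ℂ (Fin N)) :
    sesq (-M) ξ ζ = -sesq M ξ ζ := by
  simp only [sesq, Matrix.neg_apply, Complex.ofReal_neg, neg_mul, Finset.sum_neg_distrib]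

lemma norm_sesq_le {M : Matrix (Fin N) (Fin N) ℝ} {C : ℝ} (h : ∀ i j, |M i j| ≤ C)
    (ξ ζ : EuclideanSpace ℂ (Fin N)) : ‖sesq M ξ ζ‖ ≤ N * (N * C) * (‖ξ‖ * ‖ζ‖) := by
  refine (norm_sum_le _ _).trans ?_
  calc _ ≤ ∑ _i : Fin N, ∑ _j : Fin N, C * (‖ξ‖ * ‖ζ‖) := by
        refine Finset.sum_le_sum fun i _ => (norm_sum_le _ _).trans (Finset.sum_le_sum fun j _ => ?_)
        rw [norm_mul, norm_mul, norm_star, Complex.norm_real, mul_assoc]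
        have hC : 0 ≤ C := (abs_nonneg _).trans (h i j)
        exact mul_le_mul (h i j) (mul_le_mul (PiLp.norm_apply_le _ _) (PiLp.norm_apply_le _ _)
          (norm_nonneg _) (norm_nonneg _)) (by positivity) hC
    _ = _ := by simp; ring

lemma cmul_mul (C D : Matrix (Fin N) (Fin N) ℝ) (ξ : EuclideanSpace ℂ (Fin N)) :
    cmul (C * D) ξ = cmul C (cmul D ξ) := by
  ext i
  simp only [cmul, Matrix.mul_apply, Complex.ofReal_sum, Complex.ofReal_mul, Finset.sum_mul,
    Finset.mul_sum]
  rw [Finset.sum_comm]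
  simp only [mul_assoc]

lemma cmul_one (ξ : EuclideanSpace ℂ (Fin N)) : cmul 1 ξ = ξ := by
  ext i
  simp [cmul, Matrix.one_apply, apply_ite Complex.ofReal]

/-- The complexification of a real matrix has the same operator norm. -/
lemma norm_cmul_le (C : Matrix (Fin N) (Fin N) ℝ) (ξ : EuclideanSpace ℂ (Fin N)) :
    ‖cmul C ξ‖ ≤ matNorm C * ‖ξ‖ := by
  set p : Rn N := WithLp.toLp 2 fun i => (ξ i).re
  set q : Rn N := WithLp.toLp 2 fun i => (ξ i).im
  have h1 : ∀ r : Rn N, ‖Matrix.toEuclideanCLM (n := Fin N) (𝕜 := ℝ) C r‖ ^ 2 ≤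
      matNorm C ^ 2 * ‖r‖ ^ 2 := fun r => by
    rw [← mul_pow]
    exact pow_le_pow_left₀ (norm_nonneg _) (ContinuousLinearMap.le_opNorm _ _) 2
  have h2 : ‖ξ‖ ^ 2 = ‖p‖ ^ 2 + ‖q‖ ^ 2 := by
    rw [EuclideanSpace.norm_sq_eq, EuclideanSpace.norm_sq_eq, EuclideanSpace.norm_sq_eq,
      ← Finset.sum_add_distrib]
    refine Finset.sum_congr rfl fun i _ => ?_
    rw [← Complex.normSq_eq_norm_sq, Complex.normSq_apply]
    simp [p, q, sq]
  have h3 : ‖cmul C ξ‖ ^ 2 = ‖Matrix.toEuclideanCLM (n := Fin N) (𝕜 := ℝ) C p‖ ^ 2 +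
      ‖Matrix.toEuclideanCLM (n := Fin N) (𝕜 := ℝ) C q‖ ^ 2 := by
    rw [EuclideanSpace.norm_sq_eq, EuclideanSpace.norm_sq_eq, EuclideanSpace.norm_sq_eq,
      ← Finset.sum_add_distrib]
    refine Finset.sum_congr rfl fun i _ => ?_
    rw [← Complex.normSq_eq_norm_sq, Complex.normSq_apply]
    simp [cmul, p, q, sq, Matrix.mulVec, dotProduct]
  have h4 : ‖cmul C ξ‖ ^ 2 ≤ (matNorm C * ‖ξ‖) ^ 2 := by
    rw [h3, mul_pow, h2, mul_add]
    exact add_le_add (h1 p) (h1 q)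
  exact (pow_le_pow_iff_left₀ (norm_nonneg _)
    (mul_nonneg (norm_nonneg _) (norm_nonneg _)) two_ne_zero).1 h4

section Sqrt

variable {M : Matrix (Fin N) (Fin N) ℝ}

lemma transpose_matSqrt (M : Matrix (Fin N) (Fin N) ℝ) : (matSqrt M).transpose = matSqrt M := by
  have h : IsSelfAdjoint (cfc Real.sqrt M) := cfc_predicate _ _
  have h2 : (cfc Real.sqrt M).conjTranspose = cfc Real.sqrt M := h
  rwa [Matrix.conjTranspose_eq_transpose_of_trivial] at h2

lemma matSqrt_mul_self (hM : M.PosSemidef) : matSqrt M * matSqrt M = M := by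
  have hsa : IsSelfAdjoint M := hM.1
  rw [matSqrt, ← cfc_mul Real.sqrt Real.sqrt M]
  conv_rhs => rw [← cfc_id ℝ M hsa]
  refine cfc_congr fun x hx => ?_
  rw [hM.1.spectrum_real_eq_range_eigenvalues] at hx
  obtain ⟨i, rfl⟩ := hx
  exact Real.mul_self_sqrt (hM.eigenvalues_nonneg i)

lemma isUnit_det_matSqrt (hM : M.PosDef) : IsUnit (matSqrt M).det := by
  have h : (matSqrt M).det * (matSqrt M).det = M.det := by
    rw [← Matrix.det_mul, matSqrt_mul_self hM.posSemidef]
  refine isUnit_iff_ne_zero.2 fun h0 => ?_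
  rw [h0, zero_mul] at h
  exact hM.det_pos.ne h

lemma cfc_apply_entry (hM : M.IsHermitian) (f : ℝ → ℝ) (i j : Fin N) :
    cfc f M i j = ∑ k, (hM.eigenvectorUnitary : Matrix (Fin N) (Fin N) ℝ) i k *
      f (hM.eigenvalues k) * (hM.eigenvectorUnitary : Matrix (Fin N) (Fin N) ℝ) j k := by
  rw [hM.cfc_eq, Matrix.IsHermitian.cfc, Unitary.conjStarAlgAut_apply, Matrix.mul_apply]
  refine Finset.sum_congr rfl fun k _ => ?_
  rw [Matrix.mul_diagonal]
  simp [Matrix.star_apply]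

end Sqrt

section Measurability

variable {α : Type*} [MeasurableSpace α] {μ : Measure α}

lemma aestronglyMeasurable_matrix {M : α → Matrix (Fin N) (Fin N) ℝ}
    (h : ∀ i j, AEStronglyMeasurable (fun x => M x i j) μ) : AEStronglyMeasurable M μ := by
  have e : M = fun x => ∑ i, ∑ j, M x i j • Matrix.single i j (1 : ℝ) := by
    ext x i j
    conv_lhs => rw [Matrix.matrix_eq_sum_single (M x)]
    simp
  rw [e]
  exact Finset.aestronglyMeasurable_fun_sum _ fun i _ =>
    Finset.aestronglyMeasurable_fun_sum _ fun j _ => (h i j).smul_const _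

lemma aestronglyMeasurable_matrix_apply {M : α → Matrix (Fin N) (Fin N) ℝ}
    (h : AEStronglyMeasurable M μ) (i j : Fin N) : AEStronglyMeasurable (fun x => M x i j) μ := by
  have : Continuous fun M : Matrix (Fin N) (Fin N) ℝ => M i j := by fun_prop
  exact this.comp_aestronglyMeasurable h

lemma aestronglyMeasurable_matrix_mul {M M' : α → Matrix (Fin N) (Fin N) ℝ}
    (h : AEStronglyMeasurable M μ) (h' : AEStronglyMeasurable M' μ) :
    AEStronglyMeasurable (fun x => M x * M' x) μ := by
  have : Continuous fun p : Matrix (Fin N) (Fin N) ℝ × Matrix (Fin N) (Fin N) ℝ => p.1 * p.2 := by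
    fun_prop
  exact this.comp_aestronglyMeasurable (h.prodMk h')

lemma aestronglyMeasurable_matrix_transpose {M : α → Matrix (Fin N) (Fin N) ℝ}
    (h : AEStronglyMeasurable M μ) : AEStronglyMeasurable (fun x => (M x).transpose) μ := by
  have : Continuous fun M : Matrix (Fin N) (Fin N) ℝ => M.transpose := by fun_prop
  exact this.comp_aestronglyMeasurable h

lemma aestronglyMeasurable_matrix_inv {M : α → Matrix (Fin N) (Fin N) ℝ}
    (h : AEStronglyMeasurable M μ) : AEStronglyMeasurable (fun x => (M x)⁻¹) μ := by
  have h1 : Continuous fun M : Matrix (Fin N) (Fin N) ℝ => M.det := by fun_prop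
  have h2 : Continuous fun M : Matrix (Fin N) (Fin N) ℝ => M.adjugate := by fun_prop
  simp_rw [Matrix.inv_def, Ring.inverse_eq_inv]
  exact (h1.comp_aestronglyMeasurable h).aemeasurable.inv.aestronglyMeasurable.smul
    (h2.comp_aestronglyMeasurable h)

/-- By Weierstrass, polynomials `p n` approximate the square root on `[0, n]` to within `1 / (n +
1)`. The matrices `p n (M x)` depend measurably on `x` and converge to the square root, because each
eigenvalue of `M x` eventually lies in `[0, n]`. -/
lemma aestronglyMeasurable_matSqrt {M : α → Matrix (Fin N) (Fin N) ℝ}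
    (h : AEStronglyMeasurable M μ) (hp : ∀ᵐ x ∂μ, (M x).PosSemidef) :
    AEStronglyMeasurable (fun x => matSqrt (M x)) μ := by
  have hpoly : ∀ n : ℕ, ∃ p : Polynomial ℝ, ∀ t ∈ Icc (0 : ℝ) n,
      |p.eval t - Real.sqrt t| < 1 / ((n : ℝ) + 1) := fun n =>
    exists_polynomial_near_of_continuousOn 0 n Real.sqrt Real.continuous_sqrt.continuousOn _
      (by positivity)
  choose p hp' using hpoly
  refine aestronglyMeasurable_matrix fun i j => ?_
  refine aestronglyMeasurable_of_tendsto_ae atTop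
    (f := fun n x => (Polynomial.aeval (M x) (p n)) i j) (fun n => ?_) ?_
  · have h1 : Continuous fun M : Matrix (Fin N) (Fin N) ℝ => Polynomial.aeval M (p n) :=
      Polynomial.continuous_aeval (p n)
    exact aestronglyMeasurable_matrix_apply (h1.comp_aestronglyMeasurable h) i j
  · filter_upwards [hp] with x hx
    have hH := hx.1
    have hsa : IsSelfAdjoint (M x) := hx.1
    have e : ∀ n, Polynomial.aeval (M x) (p n) = cfc (fun t => (p n).eval t) (M x) := fun n =>
      (cfc_polynomial (p n) (M x) hsa).symm
    simp_rw [e, matSqrt, cfc_apply_entry hH]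
    refine tendsto_finsetSum _ fun k _ => Tendsto.mul_const _ (Tendsto.const_mul _ ?_)
    rw [tendsto_iff_norm_sub_tendsto_zero]
    refine squeeze_zero' (Eventually.of_forall fun _ => norm_nonneg _) ?_
      tendsto_one_div_add_atTop_nhds_zero_nat
    obtain ⟨n₀, hn₀⟩ := exists_nat_ge (hH.eigenvalues k)
    filter_upwards [eventually_ge_atTop n₀] with n hn
    exact (hp' n _ ⟨hx.eigenvalues_nonneg k, hn₀.trans (by exact_mod_cast hn)⟩).le

lemma continuous_matNorm : Continuous (matNorm (N := N)) := by
  have : Continuous fun M : Matrix (Fin N) (Fin N) ℝ =>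
      Matrix.toEuclideanCLM (n := Fin N) (𝕜 := ℝ) M :=
    LinearMap.continuous_of_finiteDimensional
      (Matrix.toEuclideanCLM (n := Fin N) (𝕜 := ℝ)).toAlgEquiv.toLinearMap
  exact this.norm

end Measurability

end Matrices

/-! ### The measure `g dx` and the weight `w` -/

section WeightedMeasure

open Filter Topology

variable {N : ℕ} {Ω : Set (Rn N)} {φ φ' : Rn N → Rn N}

lemma measurable_ofReal_density (φ : Rn N → Rn N) :
    Measurable fun x => ENNReal.ofReal (density φ x) := (measurable_density φ).ennreal_ofReal

lemma integral_weightedMeasure (Ω : Set (Rn N)) (χ : Rn N → Rn N) (f : Rn N → ℂ) :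
    ∫ x, f x ∂weightedMeasure Ω χ = ∫ x in Ω, (density χ x : ℂ) * f x := by
  rw [weightedMeasure, integral_withDensity_eq_integral_toReal_smul (measurable_ofReal_density χ)
    (ae_of_all _ fun x => ENNReal.ofReal_lt_top)]
  congr 1; ext x
  rw [ENNReal.toReal_ofReal (density_nonneg χ x), Complex.real_smul]

lemma lintegral_weightedMeasure (Ω : Set (Rn N)) (χ : Rn N → Rn N) (f : Rn N → ℝ≥0∞) :
    ∫⁻ x, f x ∂weightedMeasure Ω χ = ∫⁻ x in Ω, ENNReal.ofReal (density χ x) * f x := by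
  rw [weightedMeasure, lintegral_withDensity_eq_lintegral_mul_non_measurable _
    (measurable_ofReal_density χ) (ae_of_all _ fun x => ENNReal.ofReal_lt_top)]
  rfl

lemma integrable_weightedMeasure_iff (χ : Rn N → Rn N) {f : Rn N → ℂ} :
    Integrable f (weightedMeasure Ω χ) ↔ IntegrableOn (fun x => (density χ x : ℂ) * f x) Ω := by
  rw [weightedMeasure, integrable_withDensity_iff_integrable_smul' (measurable_ofReal_density χ)
    (ae_of_all _ fun x => ENNReal.ofReal_lt_top)]
  simp_rw [ENNReal.toReal_ofReal (density_nonneg χ _), Complex.real_smul]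
  rfl

namespace IsTransformation

/-- The density `g` is positive almost everywhere on `Ω`, so `g dx` has the null sets of Lebesgue
measure. Hence statements about `g dx` and `g̃ dx` can be exchanged freely. -/
lemma ae_weightedMeasure_iff (h : IsTransformation Ω φ) (hΩ : IsOpen Ω) {p : Rn N → Prop} :
    (∀ᵐ x ∂weightedMeasure Ω φ, p x) ↔ ∀ᵐ x ∂volume.restrict Ω, p x := by
  obtain ⟨C, -, hC⟩ := h.ae_jacobian_bounds hΩ
  refine ⟨fun hp => ?_, fun hp => (withDensity_absolutelyContinuous _ _).ae_le hp⟩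
  refine (withDensity_absolutelyContinuous' (measurable_ofReal_density φ).aemeasurable ?_).ae_le hp
  filter_upwards [hC] with x hx
  exact (ENNReal.ofReal_pos.2 hx.2.1).ne'

/-- The constants here and in `le_weightedMeasure` depend on the Lipschitz constants of `φ` and its
inverse. They serve only for integrability and finiteness and never enter the final estimate. -/
lemma weightedMeasure_le (h : IsTransformation Ω φ) (hΩ : IsOpen Ω) :
    ∃ C : ℝ≥0∞, C ≠ ⊤ ∧ weightedMeasure Ω φ ≤ C • volume.restrict Ω := by
  obtain ⟨C, -, hC⟩ := h.ae_jacobian_bounds hΩ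
  refine ⟨ENNReal.ofReal C, ENNReal.ofReal_ne_top, ?_⟩
  rw [← withDensity_const]
  refine withDensity_mono ?_
  filter_upwards [hC] with x hx
  exact ENNReal.ofReal_le_ofReal hx.2.2.1

lemma le_weightedMeasure (h : IsTransformation Ω φ) (hΩ : IsOpen Ω) :
    ∃ C : ℝ≥0∞, C ≠ ⊤ ∧ volume.restrict Ω ≤ C • weightedMeasure Ω φ := by
  obtain ⟨C, hC0, hC⟩ := h.ae_jacobian_bounds hΩ
  refine ⟨ENNReal.ofReal C, ENNReal.ofReal_ne_top, ?_⟩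
  rw [weightedMeasure, ← withDensity_smul _ (measurable_ofReal_density φ)]
  conv_lhs => rw [← withDensity_one (μ := volume.restrict Ω)]
  refine withDensity_mono ?_
  filter_upwards [hC] with x hx
  rw [Pi.one_apply, Pi.smul_apply, smul_eq_mul, ← ENNReal.ofReal_mul hC0.le, ENNReal.one_le_ofReal]
  calc (1 : ℝ) = (density φ x)⁻¹ * density φ x := (inv_mul_cancel₀ hx.2.1.ne').symm
    _ ≤ C * density φ x := mul_le_mul_of_nonneg_right hx.2.2.2.1 hx.2.1.le

lemma isFiniteMeasure (h : IsTransformation Ω φ) (hΩ : IsOpen Ω) (hb : Bornology.IsBounded Ω) :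
    IsFiniteMeasure (weightedMeasure Ω φ) := by
  obtain ⟨C, hC, hle⟩ := h.weightedMeasure_le hΩ
  refine ⟨(hle univ).trans_lt ?_⟩
  rw [Measure.smul_apply, Measure.restrict_apply_univ, smul_eq_mul]
  exact ENNReal.mul_lt_top hC.lt_top hb.measure_lt_top

lemma memLp_weightedMeasure_iff (h : IsTransformation Ω φ) (hΩ : IsOpen Ω) {F : Type*}
    [NormedAddCommGroup F] {f : Rn N → F} {p : ℝ≥0∞} :
    MemLp f p (weightedMeasure Ω φ) ↔ MemLp f p (volume.restrict Ω) := by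
  obtain ⟨C, hC, hle⟩ := h.weightedMeasure_le hΩ
  obtain ⟨D, hD, hle'⟩ := h.le_weightedMeasure hΩ
  exact ⟨fun hf => hf.of_measure_le_smul hD hle', fun hf => hf.of_measure_le_smul hC hle⟩

lemma _root_.ResolventStability.aestronglyMeasurable_weightedMeasure {F : Type*}
    [TopologicalSpace F] [TopologicalSpace.PseudoMetrizableSpace F] {f : Rn N → F}
    (hf : AEStronglyMeasurable f (volume.restrict Ω)) :
    AEStronglyMeasurable f (weightedMeasure Ω φ) :=
  hf.mono_ac (withDensity_absolutelyContinuous _ _)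

/-- Qualitative properties of the weight `w`. -/
lemma ae_weight_bounds (h : IsTransformation Ω φ) (h' : IsTransformation Ω φ') (hΩ : IsOpen Ω) :
    ∃ C : ℝ, 0 < C ∧ ∀ᵐ x ∂volume.restrict Ω, 0 < weight φ φ' x ∧ weight φ φ' x ≤ C ∧
      (weight φ φ' x)⁻¹ ≤ C ∧ weight φ φ' x ^ 2 * density φ' x = density φ x := by
  obtain ⟨C, hC0, hC⟩ := h.ae_jacobian_bounds hΩ
  obtain ⟨D, hD0, hD⟩ := h'.ae_jacobian_bounds hΩ
  refine ⟨√C * √D, by positivity, ?_⟩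
  filter_upwards [hC, hD] with x hx hx'
  have p1 := Real.sqrt_pos.2 hx.2.1
  have p2 := Real.sqrt_pos.2 hx'.2.1
  have q : ∀ {g C : ℝ}, g⁻¹ ≤ C → (√g)⁻¹ ≤ √C := fun hg => by
    rw [← Real.sqrt_inv]; exact Real.sqrt_le_sqrt hg
  refine ⟨div_pos p1 p2, ?_, ?_, ?_⟩
  · rw [weight, div_eq_mul_inv]
    exact mul_le_mul (Real.sqrt_le_sqrt hx.2.2.1) (q hx'.2.2.2.1) (by positivity) (by positivity)
  · rw [weight, inv_div, div_eq_mul_inv, mul_comm]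
    exact mul_le_mul (q hx.2.2.2.1) (Real.sqrt_le_sqrt hx'.2.2.1) (by positivity) (by positivity)
  · rw [weight, div_pow, Real.sq_sqrt hx.2.1.le, Real.sq_sqrt hx'.2.1.le]
    exact div_mul_cancel₀ _ hx'.2.1.ne'

end IsTransformation

lemma measurable_weight (φ φ' : Rn N → Rn N) : Measurable (weight φ φ') :=
  (measurable_density φ).sqrt.div (measurable_density φ').sqrt

end WeightedMeasure

/-! ### The pulled-back coefficients and the pointwise form estimates -/

section Coefficients

open Filter Topology

variable {N : ℕ} {Ω : Set (Rn N)} {φ φ' : Rn N → Rn N} {A : Rn N → Matrix (Fin N) (Fin N) ℝ}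

lemma IsEllipticCoefficient.isSymm_pulledCoefficient (hA : IsEllipticCoefficient A)
    (φ : Rn N → Rn N) (x : Rn N) : (pulledCoefficient A φ x).IsSymm := by
  have := hA.2.1 (φ x)
  rw [Matrix.IsSymm] at *
  simp only [pulledCoefficient, Matrix.transpose_mul, Matrix.transpose_transpose, this, Matrix.mul_assoc]

lemma IsEllipticCoefficient.posDef (hA : IsEllipticCoefficient A) (x : Rn N) : (A x).PosDef := by
  obtain ⟨θ, hθ, hle⟩ := hA.2.2
  refine Matrix.PosDef.of_dotProduct_mulVec_pos ?_ fun ξ hξ => ?_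
  · rw [Matrix.IsHermitian, Matrix.conjTranspose_eq_transpose_of_trivial]; exact hA.2.1 x
  · have h1 := (hle x (WithLp.toLp 2 ξ)).1
    have h2 : 0 < ‖(WithLp.toLp 2 ξ : Rn N)‖ := norm_pos_iff.2 fun h0 => hξ (by
      simpa using congrArg WithLp.ofLp h0)
    refine lt_of_lt_of_le (by positivity : 0 < θ⁻¹ * ‖(WithLp.toLp 2 ξ : Rn N)‖ ^ 2)
      (h1.trans (le_of_eq ?_))
    simp only [dotProduct, Matrix.mulVec, star_trivial, Finset.mul_sum]
    refine Finset.sum_congr rfl fun i _ => Finset.sum_congr rfl fun j _ => ?_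
    ring

lemma IsEllipticCoefficient.posDef_pulledCoefficient (hA : IsEllipticCoefficient A) {x : Rn N}
    (hx : IsUnit (jacobian φ x).det) : (pulledCoefficient A φ x).PosDef := by
  rw [pulledCoefficient, ← Matrix.conjTranspose_eq_transpose_of_trivial]
  refine (hA.posDef (φ x)).mul_mul_conjTranspose_same ?_
  refine Matrix.vecMul_injective_of_isUnit ?_
  rw [Matrix.isUnit_nonsing_inv_iff, Matrix.isUnit_iff_isUnit_det]
  exact hx

lemma IsEllipticCoefficient.aestronglyMeasurable_pulledCoefficient (hA : IsEllipticCoefficient A)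
    (h : IsTransformation Ω φ) (hΩ : IsOpen Ω) :
    AEStronglyMeasurable (pulledCoefficient A φ) (volume.restrict Ω) := by
  have hJ : AEStronglyMeasurable (jacobian φ) (volume.restrict Ω) :=
    aestronglyMeasurable_matrix fun i j => (measurable_jacobian_apply φ i j).aestronglyMeasurable
  have hJi := aestronglyMeasurable_matrix_inv hJ
  have hAφ : AEStronglyMeasurable (fun x => A (φ x)) (volume.restrict Ω) :=
    aestronglyMeasurable_matrix fun i j => h.aestronglyMeasurable_comp hΩ (hA.1 i j).1.restrict
  exact aestronglyMeasurable_matrix_mul (aestronglyMeasurable_matrix_mul hJi hAφ)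
    (aestronglyMeasurable_matrix_transpose hJi)

/-- A qualitative bound, used only for integrability of the forms. The exceptional null set of `A`
pulls back to a null set under `φ`. -/
lemma IsEllipticCoefficient.ae_bound_pulledCoefficient (hA : IsEllipticCoefficient A)
    (h : IsTransformation Ω φ) (hΩ : IsOpen Ω) :
    ∃ C : ℝ, 0 < C ∧ ∀ᵐ x ∂volume.restrict Ω, ∀ i j, |pulledCoefficient A φ x i j| ≤ C := by
  obtain ⟨D, hD0, hD⟩ := h.ae_jacobian_bounds hΩ
  have hE : ∃ E : ℝ, 0 ≤ E ∧ ∀ᵐ y : Rn N, ∀ i j, |A y i j| ≤ E := by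
    set e : Fin N → Fin N → ℝ := fun i j => (eLpNorm (fun x => A x i j) ⊤ volume).toReal with he
    have he0 : ∀ i j, 0 ≤ e i j := fun i j => ENNReal.toReal_nonneg
    refine ⟨∑ i, ∑ j, e i j, Finset.sum_nonneg fun i _ => Finset.sum_nonneg fun j _ => he0 i j, ?_⟩
    rw [ae_all_iff]; intro i
    rw [ae_all_iff]; intro j
    have h1 := ae_le_eLpNormEssSup (μ := volume) (f := fun x => A x i j)
    filter_upwards [h1] with y hy
    have h2 : |A y i j| ≤ e i j := by
      have h3 := (hA.1 i j).2
      rw [← Real.norm_eq_abs, ← toReal_enorm, he]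
      refine ENNReal.toReal_mono h3.ne ?_
      rwa [eLpNorm_exponent_top]
    refine h2.trans ((Finset.single_le_sum (fun j _ => he0 i j) (Finset.mem_univ j)).trans ?_)
    exact Finset.single_le_sum (f := fun i => ∑ j, e i j)
      (fun i _ => Finset.sum_nonneg fun j _ => he0 i j) (Finset.mem_univ i)
  obtain ⟨E, hE0, hE⟩ := hE
  refine ⟨N * (N * (D * E)) * D + 1, by positivity, ?_⟩
  filter_upwards [hD, h.quasiMeasurePreserving_ae hΩ (ae_restrict_of_ae hE)] with x hx hxE i j
  have hx := hx.2.2.2.2.2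
  refine le_trans ?_ (le_add_of_nonneg_right zero_le_one)
  have h1 : ∀ i j, |((jacobian φ x)⁻¹ * A (φ x)) i j| ≤ N * (D * E) := fun i j => by
    rw [Matrix.mul_apply]
    refine (Finset.abs_sum_le_sum_abs _ _).trans ?_
    calc _ ≤ ∑ _k : Fin N, D * E := Finset.sum_le_sum fun k _ => by
          rw [abs_mul]; exact mul_le_mul (hx i k) (hxE k j) (abs_nonneg _) hD0.le
      _ = _ := by simp
  rw [pulledCoefficient, Matrix.mul_apply]
  refine (Finset.abs_sum_le_sum_abs _ _).trans ?_
  calc _ ≤ ∑ _k : Fin N, N * (D * E) * D := Finset.sum_le_sum fun k _ => by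
        rw [abs_mul, Matrix.transpose_apply]
        exact mul_le_mul (h1 i k) (hx j k) (abs_nonneg _) (by positivity)
    _ = _ := by simp; ring

section Pointwise

variable {a a' : Matrix (Fin N) (Fin N) ℝ} {c : ℝ}

/-- `S` as a function of `a`, `ã` and `w⁻²`. -/
noncomputable def relMatrix (a a' : Matrix (Fin N) (Fin N) ℝ) (c : ℝ) : Matrix (Fin N) (Fin N) ℝ :=
  c • ((matSqrt a)⁻¹ * a' * (matSqrt a)⁻¹)

lemma transpose_matSqrt_inv (a : Matrix (Fin N) (Fin N) ℝ) :
    ((matSqrt a)⁻¹).transpose = (matSqrt a)⁻¹ := by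
  rw [Matrix.transpose_nonsing_inv, transpose_matSqrt]

lemma relMatrix_posDef (ha : a.PosDef) (ha' : a'.PosDef) (hc : 0 < c) :
    (relMatrix a a' c).PosDef := by
  refine Matrix.PosDef.smul ?_ hc
  have : Function.Injective fun v => Matrix.vecMul v (matSqrt a)⁻¹ := by
    refine Matrix.vecMul_injective_of_isUnit ?_
    rw [Matrix.isUnit_nonsing_inv_iff, Matrix.isUnit_iff_isUnit_det]
    exact isUnit_det_matSqrt ha
  have h := ha'.mul_mul_conjTranspose_same this
  rwa [Matrix.conjTranspose_eq_transpose_of_trivial, transpose_matSqrt_inv] at h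

/-- With `c = w⁻² = g̃/g` this reads `g a^(1/2) S a^(1/2) = g̃ ã`: the form of `T*ST` is the form of
`H` with `S` inserted between the square roots. -/
lemma matSqrt_mul_relMatrix_mul (ha : a.PosDef) :
    matSqrt a * relMatrix a a' c * matSqrt a = c • a' := by
  have h1 := Matrix.mul_nonsing_inv _ (isUnit_det_matSqrt ha)
  have h2 := Matrix.nonsing_inv_mul _ (isUnit_det_matSqrt ha)
  rw [relMatrix, Matrix.mul_smul, Matrix.smul_mul]
  congr 1
  calc _ = (matSqrt a * (matSqrt a)⁻¹) * a' * ((matSqrt a)⁻¹ * matSqrt a) := by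
        simp only [Matrix.mul_assoc]
    _ = a' := by rw [h1, h2, Matrix.one_mul, Matrix.mul_one]

lemma sesq_relMatrix (ha : a.PosDef) (ha' : a'.PosDef) (hc : 0 < c)
    (ζ : EuclideanSpace ℂ (Fin N)) :
    c * sesq a' ζ ζ = ((‖cmul (matSqrt (relMatrix a a' c) * matSqrt a) ζ‖ ^ 2 : ℝ) : ℂ) := by
  rw [← sesq_transpose_mul_self, ← sesq_smul, ← matSqrt_mul_relMatrix_mul ha (c := c),
    Matrix.transpose_mul, transpose_matSqrt, transpose_matSqrt]
  congr 1
  conv_lhs => rw [← matSqrt_mul_self (relMatrix_posDef ha ha' hc).posSemidef]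
  simp only [Matrix.mul_assoc]

lemma sesq_eq_norm_sq (ha : a.PosSemidef) (ζ : EuclideanSpace ℂ (Fin N)) :
    sesq a ζ ζ = ((‖cmul (matSqrt a) ζ‖ ^ 2 : ℝ) : ℂ) := by
  rw [← sesq_transpose_mul_self, transpose_matSqrt, matSqrt_mul_self ha]

/-- Since `a - c ã = a^(1/2) (1 - S) a^(1/2)`, it equals `-((S^(1/2) - S^(-1/2)) a^(1/2))ᵗ (S^(1/2)
a^(1/2))`. After Cauchy–Schwarz the second factor is the energy density of `T*ST` at `ζ`. -/
lemma norm_sesq_sub_le (ha : a.PosDef) (ha' : a'.PosDef) (hc : 0 < c)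
    (ξ ζ : EuclideanSpace ℂ (Fin N)) :
    ‖sesq a ξ ζ - c * sesq a' ξ ζ‖ ≤
      matNorm ((matSqrt (relMatrix a a' c) - (matSqrt (relMatrix a a' c))⁻¹) * matSqrt a) * ‖ξ‖ *
        √((c * sesq a' ζ ζ).re) := by
  set S := relMatrix a a' c with hS
  set B := matSqrt a with hB
  set T := matSqrt S with hT
  have hSp := relMatrix_posDef ha ha' hc
  have hTT : T * T = S := matSqrt_mul_self hSp.posSemidef
  have hTi : T⁻¹ * T = 1 := Matrix.nonsing_inv_mul _ (isUnit_det_matSqrt hSp)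
  have hBB : B * B = a := matSqrt_mul_self ha.posSemidef
  have h1 : a - c • a' = -(((T - T⁻¹) * B).transpose * (T * B)) := by
    rw [Matrix.transpose_mul, Matrix.transpose_sub, hT, transpose_matSqrt_inv, transpose_matSqrt,
      ← hT, hB, transpose_matSqrt, ← hB, ← matSqrt_mul_relMatrix_mul ha (c := c), ← hB, ← hS]
    calc a - B * S * B = B * (1 - S) * B := by
          rw [Matrix.mul_sub, Matrix.sub_mul, Matrix.mul_one, hBB]
      _ = B * (T⁻¹ * T - T * T) * B := by rw [hTi, hTT]
      _ = _ := by rw [← Matrix.sub_mul]; noncomm_ring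
  rw [← sesq_smul, ← sesq_sub, h1, sesq_neg, norm_neg]
  refine (norm_sesq_transpose_mul_le _ _ _ _).trans ?_
  rw [sesq_relMatrix ha ha' hc, Complex.ofReal_re, Real.sqrt_sq (norm_nonneg _)]
  exact mul_le_mul_of_nonneg_right (norm_cmul_le _ _) (norm_nonneg _)

/-- Here the factorization is `a - c ã = -((S - 1) a^(1/2))ᵗ a^(1/2)`, obtained by transposing, so
that `ζ` is measured in the energy of `H`. This version serves eigenfunctions `ξ` of `T*ST`. -/
lemma norm_sesq_sub_le' (ha : a.PosDef) (ha' : a'.PosDef) (ξ ζ : EuclideanSpace ℂ (Fin N)) :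
    ‖sesq a ξ ζ - c * sesq a' ξ ζ‖ ≤
      matNorm ((relMatrix a a' c - 1) * matSqrt a) * ‖ξ‖ * √((sesq a ζ ζ).re) := by
  set S := relMatrix a a' c with hS
  set B := matSqrt a with hB
  have hBB : B * B = a := matSqrt_mul_self ha.posSemidef
  have hBt : B.transpose = B := transpose_matSqrt a
  have h1 : a - c • a' = -(B.transpose * ((S - 1) * B)) := by
    rw [hBt, ← matSqrt_mul_relMatrix_mul ha (c := c), ← hB, ← hS]
    calc a - B * S * B = B * B - B * S * B := by rw [hBB]
      _ = _ := by noncomm_ring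
  have h2 : (a - c • a').transpose = a - c • a' := by
    have t : ∀ {M : Matrix (Fin N) (Fin N) ℝ}, M.PosDef → M.transpose = M := fun hM => by
      rw [← Matrix.conjTranspose_eq_transpose_of_trivial]; exact hM.1
    rw [Matrix.transpose_sub, Matrix.transpose_smul, t ha, t ha']
  rw [← sesq_smul, ← sesq_sub, ← h2, h1, Matrix.transpose_neg, Matrix.transpose_mul,
    Matrix.transpose_transpose, sesq_neg, norm_neg]
  refine (norm_sesq_transpose_mul_le _ _ _ _).trans ?_
  rw [sesq_eq_norm_sq ha.posSemidef, Complex.ofReal_re, Real.sqrt_sq (norm_nonneg _)]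
  exact mul_le_mul_of_nonneg_right (norm_cmul_le _ _) (norm_nonneg _)

end Pointwise

end Coefficients

/-! ### One form domain for all transformations -/

section FormDomain

variable {N : ℕ} {Ω : Set (Rn N)} {φ : Rn N → Rn N} {bc : BoundaryCondition}

lemma MemSobolev.congr {u v : Rn N → ℂ} (h : MemSobolev bc Ω u)
    (huv : u =ᵐ[volume.restrict Ω] v) : MemSobolev bc Ω v := by
  obtain ⟨V, hV, h2, hV2, hd⟩ := h
  refine ⟨V, hV.congr huv (ae_eq_refl _), (memLp_congr_ae huv).1 h2, hV2, fun hbc ε hε => ?_⟩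
  obtain ⟨η, hη, hlt⟩ := hd hbc ε hε
  refine ⟨η, hη, ?_⟩
  have : (fun x => v x - η x) =ᵐ[volume.restrict Ω] fun x => u x - η x :=
    huv.symm.sub (ae_eq_refl η)
  rwa [eLpNorm_congr_ae this]

/-- The form domain does not depend on the transformation. -/
lemma memFormDomain_iff (h : IsTransformation Ω φ) (hΩ : IsOpen Ω) (hb : Bornology.IsBounded Ω)
    {u : Rn N → ℂ} : MemFormDomain bc Ω φ u ↔ MemSobolev bc Ω u := by
  constructor
  · rintro ⟨v, hv, huv⟩
    exact (hv.comp_transformation h hΩ hb).congr huv.symm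
  · intro hu
    -- The transition map from `φ` to the identity is the inverse of `φ`, again a transformation.
    obtain ⟨Ψ, hΨ, him, hΨφ⟩ := (IsTransformation.refl hΩ).transition h
    rw [Set.image_id] at him
    rw [← him] at hu
    refine ⟨u ∘ Ψ, hu.comp_transformation hΨ h.isOpen_image (h.isBounded_image hb), ?_⟩
    filter_upwards [ae_restrict_mem hΩ.measurableSet] with x hx
    simp only [Function.comp_apply, hΨφ x hx, id]

lemma MemSobolev.memLp_grad (hΩ : IsOpen Ω) {u : Rn N → ℂ} {U : Rn N → EuclideanSpace ℂ (Fin N)}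
    (hu : MemSobolev bc Ω u) (hU : HasWeakGrad Ω u U) : MemLp U 2 (volume.restrict Ω) := by
  obtain ⟨V, hV, -, hV2, -⟩ := hu
  exact (memLp_congr_ae (hV.ae_eq hΩ hU)).1 hV2

lemma HasWeakGrad.const (Ω : Set (Rn N)) (c : ℂ) : HasWeakGrad Ω (fun _ => c) fun _ => 0 := by
  have h := (LipschitzWith.const (α := Rn N) c).hasWeakGrad Ω
  refine h.congr (ae_eq_refl _) (Filter.Eventually.of_forall fun x => ?_)
  ext i
  simp [classicalGrad]

lemma memSobolev_const (hb : Bornology.IsBounded Ω) (c : ℂ) :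
    MemSobolev BoundaryCondition.neumann Ω fun _ => c := by
  have : IsFiniteMeasure (volume.restrict Ω) := ⟨by
    rw [Measure.restrict_apply_univ]; exact hb.measure_lt_top⟩
  exact ⟨fun _ => 0, HasWeakGrad.const Ω c, memLp_const c, MemLp.zero', fun h => by cases h⟩

end FormDomain

/-! ### The sesquilinear forms and the operators they define -/

section Form

variable {N : ℕ} {Ω : Set (Rn N)} {φ χ : Rn N → Rn N} {bc : BoundaryCondition}
  {A : Rn N → Matrix (Fin N) (Fin N) ℝ}

/-- The sesquilinear form `∫_Ω (b U · V̄) |det ∇χ| dx`, `b = (∇χ)⁻¹ A(χ) (∇χ)⁻ᵗ`. -/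
noncomputable def gradForm (A : Rn N → Matrix (Fin N) (Fin N) ℝ) (Ω : Set (Rn N))
    (χ : Rn N → Rn N) (U V : Rn N → EuclideanSpace ℂ (Fin N)) : ℂ :=
  ∫ x, sesq (pulledCoefficient A χ x) (U x) (V x) ∂weightedMeasure Ω χ

lemma IsEllipticCoefficient.aestronglyMeasurable_sesq (hA : IsEllipticCoefficient A)
    (h : IsTransformation Ω χ) (hΩ : IsOpen Ω) {U V : Rn N → EuclideanSpace ℂ (Fin N)}
    (hU : AEStronglyMeasurable U (volume.restrict Ω))
    (hV : AEStronglyMeasurable V (volume.restrict Ω)) :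
    AEStronglyMeasurable (fun x => sesq (pulledCoefficient A χ x) (U x) (V x))
      (volume.restrict Ω) := by
  have ha := hA.aestronglyMeasurable_pulledCoefficient h hΩ
  have he : ∀ i, Continuous fun ξ : EuclideanSpace ℂ (Fin N) => ξ i := fun i => by fun_prop
  unfold sesq
  refine Finset.aestronglyMeasurable_fun_sum _ fun i _ =>
    Finset.aestronglyMeasurable_fun_sum _ fun j _ => ?_
  exact ((Complex.continuous_ofReal.comp_aestronglyMeasurable
    (aestronglyMeasurable_matrix_apply ha i j)).mul ((he i).comp_aestronglyMeasurable hU)).mul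
    (continuous_star.comp_aestronglyMeasurable ((he j).comp_aestronglyMeasurable hV))

lemma IsEllipticCoefficient.integrable_sesq (hA : IsEllipticCoefficient A)
    (h : IsTransformation Ω χ) (hΩ : IsOpen Ω) {U V : Rn N → EuclideanSpace ℂ (Fin N)}
    (hU : MemLp U 2 (volume.restrict Ω)) (hV : MemLp V 2 (volume.restrict Ω)) :
    Integrable (fun x => sesq (pulledCoefficient A χ x) (U x) (V x)) (weightedMeasure Ω χ) := by
  obtain ⟨C, hC0, hC⟩ := hA.ae_bound_pulledCoefficient h hΩ
  obtain ⟨D, hD, hle⟩ := h.weightedMeasure_le hΩ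
  refine Integrable.of_measure_le_smul hD hle ?_
  have h1 : Integrable (fun x => N * (N * C) * (‖U x‖ * ‖V x‖)) (volume.restrict Ω) :=
    (hU.norm.integrable_mul hV.norm).const_mul _
  refine h1.mono' (hA.aestronglyMeasurable_sesq h hΩ hU.1 hV.1) ?_
  filter_upwards [hC] with x hx
  exact norm_sesq_le hx _ _

lemma IsEllipticCoefficient.star_gradForm (hA : IsEllipticCoefficient A)
    (U V : Rn N → EuclideanSpace ℂ (Fin N)) :
    star (gradForm A Ω χ U V) = gradForm A Ω χ V U := by
  rw [gradForm, RCLike.star_def, ← integral_conj]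
  exact integral_congr_ae (Filter.Eventually.of_forall fun x =>
    sesq_star_swap (hA.isSymm_pulledCoefficient χ x) _ _)

lemma IsEllipticCoefficient.ae_sesq_self (hA : IsEllipticCoefficient A)
    (h : IsTransformation Ω χ) (hΩ : IsOpen Ω) (U : Rn N → EuclideanSpace ℂ (Fin N)) :
    ∀ᵐ x ∂volume.restrict Ω,
      ((sesq (pulledCoefficient A χ x) (U x) (U x)).re : ℂ) =
          sesq (pulledCoefficient A χ x) (U x) (U x) ∧
      0 ≤ (sesq (pulledCoefficient A χ x) (U x) (U x)).re ∧
      ((sesq (pulledCoefficient A χ x) (U x) (U x)).re = 0 → U x = 0) := by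
  obtain ⟨C, hC0, hC⟩ := h.ae_jacobian_bounds hΩ
  filter_upwards [hC] with x hx
  have hp := hA.posDef_pulledCoefficient hx.1
  rw [sesq_eq_norm_sq hp.posSemidef, Complex.ofReal_re]
  refine ⟨rfl, by positivity, fun h0 => ?_⟩
  have h1 : cmul (matSqrt (pulledCoefficient A χ x)) (U x) = 0 := by simpa using h0
  rw [← cmul_one (U x), ← Matrix.nonsing_inv_mul _ (isUnit_det_matSqrt hp), cmul_mul, h1]
  ext i; simp [cmul]

/-- The three conclusions serve different ends: positivity for the spectral bounds, the `lintegral`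
formula for Hölder's inequality, and definiteness for the description of the kernel. -/
lemma IsEllipticCoefficient.gradForm_self (hA : IsEllipticCoefficient A)
    (h : IsTransformation Ω χ) (hΩ : IsOpen Ω) {U : Rn N → EuclideanSpace ℂ (Fin N)}
    (hU : MemLp U 2 (volume.restrict Ω)) :
    0 ≤ (gradForm A Ω χ U U).re ∧
    ∫⁻ x, ENNReal.ofReal (sesq (pulledCoefficient A χ x) (U x) (U x)).re ∂weightedMeasure Ω χ =
      ENNReal.ofReal (gradForm A Ω χ U U).re ∧
    (gradForm A Ω χ U U = 0 → U =ᵐ[volume.restrict Ω] 0) := by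
  have hi := hA.integrable_sesq h hΩ hU hU
  have hs := (h.ae_weightedMeasure_iff hΩ).2 (hA.ae_sesq_self h hΩ U)
  have hre : (gradForm A Ω χ U U).re =
      ∫ x, (sesq (pulledCoefficient A χ x) (U x) (U x)).re ∂weightedMeasure Ω χ :=
    (integral_re hi).symm
  have hnn : 0 ≤ᵐ[weightedMeasure Ω χ]
      fun x => (sesq (pulledCoefficient A χ x) (U x) (U x)).re := by
    filter_upwards [hs] with x hx using hx.2.1
  refine ⟨hre ▸ integral_nonneg_of_ae hnn, ?_, fun h0 => ?_⟩
  · rw [hre]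
    exact (ofReal_integral_eq_lintegral_ofReal hi.re hnn).symm
  · rw [h0, Complex.zero_re, eq_comm, integral_eq_zero_iff_of_nonneg_ae hnn hi.re] at hre
    refine (h.ae_weightedMeasure_iff hΩ).1 ?_
    filter_upwards [hs, hre] with x hx hx0 using hx.2.2 hx0

/-- Once the form domain is expressed through `Ω` alone, solutions and test functions can be moved
between the equations of `H`, `T*ST` and `H̃`. -/
lemma mem_formOperator_iff (h : IsTransformation Ω φ) (hΩ : IsOpen Ω)
    (hb : Bornology.IsBounded Ω) {p : L2 Ω φ × L2 Ω φ} :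
    p ∈ formOperator bc A Ω φ χ ↔ MemSobolev bc Ω p.1 ∧ ∃ U, HasWeakGrad Ω p.1 U ∧
      ∀ (v : L2 Ω φ) (V : Rn N → EuclideanSpace ℂ (Fin N)), MemSobolev bc Ω v →
        HasWeakGrad Ω v V → gradForm A Ω χ U V = inner ℂ v p.2 := by
  simp only [formOperator, mem_ofPred_eq, memFormDomain_iff h hΩ hb]
  rfl

lemma gradForm_congr (h : IsTransformation Ω χ) (hΩ : IsOpen Ω)
    {U U' V V' : Rn N → EuclideanSpace ℂ (Fin N)} (hU : U =ᵐ[volume.restrict Ω] U')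
    (hV : V =ᵐ[volume.restrict Ω] V') : gradForm A Ω χ U V = gradForm A Ω χ U' V' := by
  refine integral_congr_ae ((h.ae_weightedMeasure_iff hΩ).2 ?_)
  filter_upwards [hU, hV] with x h1 h2
  rw [h1, h2]

lemma gradForm_eq_inner_of_mem (hφ : IsTransformation Ω φ) (hχ : IsTransformation Ω χ)
    (hΩ : IsOpen Ω) (hb : Bornology.IsBounded Ω) {p : L2 Ω φ × L2 Ω φ}
    (hp : p ∈ formOperator bc A Ω φ χ) {U : Rn N → EuclideanSpace ℂ (Fin N)}
    (hU : HasWeakGrad Ω p.1 U) {v : L2 Ω φ} {V : Rn N → EuclideanSpace ℂ (Fin N)}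
    (hv : MemSobolev bc Ω v) (hV : HasWeakGrad Ω v V) :
    gradForm A Ω χ U V = inner ℂ v p.2 := by
  obtain ⟨-, U', hU', h⟩ := (mem_formOperator_iff hφ hΩ hb).1 hp
  rw [← h v V hv hV]
  exact gradForm_congr hχ hΩ (hU.ae_eq hΩ hU') (ae_eq_refl _)

end Form

/-- Standing assumptions for the operators `formOperator bc A Ω φ χ`. -/
structure FormSetting {N : ℕ} (A : Rn N → Matrix (Fin N) (Fin N) ℝ) (Ω : Set (Rn N))
    (φ χ : Rn N → Rn N) : Prop where
  isOpen : IsOpen Ω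
  bounded : Bornology.IsBounded Ω
  coeff : IsEllipticCoefficient A
  transf : IsTransformation Ω φ
  transf' : IsTransformation Ω χ

/-! ### Resolvents, eigenvalues and zero modes of the form operators -/

namespace FormSetting

variable {N : ℕ} {Ω : Set (Rn N)} {φ χ χ' : Rn N → Rn N} {bc : BoundaryCondition}
  {A : Rn N → Matrix (Fin N) (Fin N) ℝ} {R : L2 Ω φ →L[ℂ] L2 Ω φ}

/-- Test the equation of `R f` with `R g` and that of `R g` with `R f`, and use that the form is
Hermitian. -/
lemma resolvent_inner_symm (h : FormSetting A Ω φ χ)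
    (hR : IsResolvent (formOperator bc A Ω φ χ) R) (f g : L2 Ω φ) :
    inner ℂ (R f) g = inner ℂ f (R g) := by
  have hf := (mem_formOperator_iff h.transf h.isOpen h.bounded).1 (hR.1 f)
  have hg := (mem_formOperator_iff h.transf h.isOpen h.bounded).1 (hR.1 g)
  obtain ⟨hf1, F, hF, hf2⟩ := hf
  obtain ⟨hg1, G, hG, hg2⟩ := hg
  have h1 := hf2 _ _ hg1 hG
  have h2 := hg2 _ _ hf1 hF
  rw [← h.coeff.star_gradForm, h1, inner_sub_right, star_sub, inner_sub_right] at h2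
  simp only [RCLike.star_def, inner_conj_symm] at h2
  linear_combination -h2

lemma isSelfAdjoint_resolvent (h : FormSetting A Ω φ χ)
    (hR : IsResolvent (formOperator bc A Ω φ χ) R) : IsSelfAdjoint R :=
  ContinuousLinearMap.isSelfAdjoint_iff_isSymmetric.2 fun f g => h.resolvent_inner_symm hR f g

/-- Testing the equation of `R f` with `R f` itself gives `energy + ‖R f‖² = Re ⟨R f, f⟩`, which
yields both the contraction property and the energy bound. The latter controls the test function in
`enorm_resolvent_sub_eigenvector_le`. -/
lemma resolvent_form_le (h : FormSetting A Ω φ χ)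
    (hR : IsResolvent (formOperator bc A Ω φ χ) R) (f : L2 Ω φ) :
    ‖R f‖ ≤ ‖f‖ ∧ MemSobolev bc Ω (R f) ∧ ∃ F, HasWeakGrad Ω (R f) F ∧
      (gradForm A Ω χ F F).re ≤ ‖f‖ ^ 2 := by
  obtain ⟨hf1, F, hF, hf2⟩ := (mem_formOperator_iff h.transf h.isOpen h.bounded).1 (hR.1 f)
  have h1 := congrArg Complex.re (hf2 _ _ hf1 hF)
  have h0 := (h.coeff.gradForm_self h.transf' h.isOpen (hf1.memLp_grad h.isOpen hF)).1
  rw [inner_sub_right, Complex.sub_re] at h1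
  have h2 : (inner ℂ (R f) (R f) : ℂ).re = ‖R f‖ ^ 2 := inner_self_eq_norm_sq (𝕜 := ℂ) _
  have h3 : (inner ℂ (R f) f : ℂ).re ≤ ‖R f‖ * ‖f‖ := re_inner_le_norm (𝕜 := ℂ) _ _
  rw [h2] at h1
  have h4 : ‖R f‖ ≤ ‖f‖ := by
    by_contra! hlt
    have := norm_nonneg f
    nlinarith
  refine ⟨h4, hf1, F, hF, ?_⟩
  rw [h1]
  nlinarith [norm_nonneg f, norm_nonneg (R f)]

lemma norm_resolvent_le (h : FormSetting A Ω φ χ)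
    (hR : IsResolvent (formOperator bc A Ω φ χ) R) : ‖R‖ ≤ 1 :=
  ContinuousLinearMap.opNorm_le_bound _ zero_le_one fun f => by
    rw [one_mul]; exact (h.resolvent_form_le hR f).1

lemma eigenvalue_nonneg (h : FormSetting A Ω φ χ) {ψ : L2 Ω φ} {l : ℝ} (hψ : ψ ≠ 0)
    (he : (ψ, (l : ℂ) • ψ) ∈ formOperator bc A Ω φ χ) : 0 ≤ l := by
  obtain ⟨h1, U, hU, h2⟩ := (mem_formOperator_iff h.transf h.isOpen h.bounded).1 he
  have h3 := congrArg Complex.re (h2 _ _ h1 hU)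
  have h0 := (h.coeff.gradForm_self h.transf' h.isOpen (h1.memLp_grad h.isOpen hU)).1
  rw [inner_smul_right, Complex.re_ofReal_mul] at h3
  have h4 : (inner ℂ ψ ψ : ℂ).re = ‖ψ‖ ^ 2 := inner_self_eq_norm_sq (𝕜 := ℂ) _
  rw [h4] at h3
  have : 0 < ‖ψ‖ ^ 2 := by positivity
  by_contra! hl
  nlinarith [mul_neg_of_neg_of_pos hl this]

/-- A zero mode has zero energy, hence zero gradient. It is constant because `Ω` is connected, and
zero under Dirichlet conditions by the Poincaré inequality. -/
lemma zero_mode (h : FormSetting A Ω φ χ) (hc : IsConnected Ω) (hN : 1 ≤ N) {ψ : L2 Ω φ}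
    (he : (ψ, 0) ∈ formOperator bc A Ω φ χ) :
    (∃ c : ℂ, ψ =ᵐ[volume.restrict Ω] fun _ => c) ∧
      (bc = BoundaryCondition.dirichlet → ψ = 0) := by
  obtain ⟨h1, U, hU, h2⟩ := (mem_formOperator_iff h.transf h.isOpen h.bounded).1 he
  have h3 := h2 _ _ h1 hU
  rw [inner_zero_right] at h3
  have h0 := (h.coeff.gradForm_self h.transf' h.isOpen (h1.memLp_grad h.isOpen hU)).2.2 h3
  refine ⟨hU.exists_ae_eq_const h.isOpen hc h0, fun hbc => ?_⟩
  subst hbc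
  have := h1.ae_eq_zero_of_dirichlet hN h.isOpen h.bounded hU h0
  exact Lp.eq_zero_iff_ae_eq_zero.2 ((h.transf.ae_weightedMeasure_iff h.isOpen).2 this)

end FormSetting

lemma IsResolvent.apply_eigenvector {X : Type*} [NormedAddCommGroup X] [InnerProductSpace ℂ X]
    {E : OpGraph X} {R : X →L[ℂ] X} (hR : IsResolvent E R) {ψ : X} {l : ℝ} (hl : 0 ≤ l)
    (he : (ψ, (l : ℂ) • ψ) ∈ E) : R ψ = (((1 + l)⁻¹ : ℝ) : ℂ) • ψ := by
  have h1 := hR.2 _ he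
  have h2 : (l : ℂ) • ψ + ψ = ((1 + l : ℝ) : ℂ) • ψ := by
    rw [Complex.ofReal_add, add_smul, Complex.ofReal_one, one_smul, add_comm]
  simp only [h2, map_smul] at h1
  conv_rhs => rw [← h1]
  rw [smul_smul, ← Complex.ofReal_mul, inv_mul_cancel₀ (by positivity), Complex.ofReal_one, one_smul]

/-! ### Difference of two resolvents on an eigenfunction, by comparison of forms -/

section ResolventDifference

variable {N : ℕ} {Ω : Set (Rn N)} {φ φ' χ χ' : Rn N → Rn N} {bc : BoundaryCondition}
  {A : Rn N → Matrix (Fin N) (Fin N) ℝ}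

/-- Hölder with three factors, `n` in `L^p`, `U` in `L^q` and the energy density of `Y` in `L²`. The
ratio of densities under the root turns `g dx` into the measure of the form `χ'`. The pointwise
bound `hM` is kept abstract so that both matrix factorizations can be inserted. -/
lemma gradForm_sub_le (h : FormSetting A Ω φ χ) (h' : FormSetting A Ω φ χ') {n : Rn N → ℝ}
    (hn : AEStronglyMeasurable n (volume.restrict Ω))
    (hM : ∀ᵐ x ∂volume.restrict Ω, ∀ ξ ζ,
      ‖density χ x * sesq (pulledCoefficient A χ x) ξ ζ -
        density χ' x * sesq (pulledCoefficient A χ' x) ξ ζ‖ ≤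
      density φ x * (n x * ‖ξ‖ *
        √(density χ' x / density φ x * (sesq (pulledCoefficient A χ' x) ζ ζ).re)))
    {p q : ℝ≥0∞} [ENNReal.HolderTriple p q 2] {U Y : Rn N → EuclideanSpace ℂ (Fin N)}
    (hU : MemLp U 2 (volume.restrict Ω)) (hY : MemLp Y 2 (volume.restrict Ω)) :
    ‖gradForm A Ω χ U Y - gradForm A Ω χ' U Y‖ₑ ≤
      eLpNorm n p (weightedMeasure Ω φ) * eLpNorm U q (weightedMeasure Ω φ) *
        ENNReal.ofReal (gradForm A Ω χ' Y Y).re ^ (1 / 2 : ℝ) := by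
  set z : Rn N → ℝ := fun x =>
    √(density χ' x / density φ x * (sesq (pulledCoefficient A χ' x) (Y x) (Y x)).re) with hz
  have hzm : AEStronglyMeasurable z (volume.restrict Ω) := by
    refine Real.continuous_sqrt.comp_aestronglyMeasurable ?_
    exact ((measurable_density χ').div (measurable_density φ)).aestronglyMeasurable.mul
      (Complex.continuous_re.comp_aestronglyMeasurable
        (h.coeff.aestronglyMeasurable_sesq h'.transf' h.isOpen hY.1 hY.1))
  have hz2 : eLpNorm z 2 (weightedMeasure Ω φ) =
      ENNReal.ofReal (gradForm A Ω χ' Y Y).re ^ (1 / 2 : ℝ) := by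
    rw [← (h.coeff.gradForm_self h'.transf' h.isOpen hY).2.1,
      eLpNorm_eq_lintegral_rpow_enorm_toReal two_ne_zero ENNReal.ofNat_ne_top,
      lintegral_weightedMeasure, lintegral_weightedMeasure, ENNReal.toReal_ofNat]
    congr 1
    obtain ⟨C, -, hC⟩ := h.transf.ae_jacobian_bounds h.isOpen
    refine lintegral_congr_ae ?_
    filter_upwards [hC, h.coeff.ae_sesq_self h'.transf' h.isOpen Y] with x hx hs
    have h0 : 0 ≤ density χ' x / density φ x * (sesq (pulledCoefficient A χ' x) (Y x) (Y x)).re :=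
      mul_nonneg (div_nonneg (density_nonneg _ _) (density_nonneg _ _)) hs.2.1
    have e : ‖z x‖ₑ ^ (2 : ℝ) = ENNReal.ofReal
        (density χ' x / density φ x * (sesq (pulledCoefficient A χ' x) (Y x) (Y x)).re) := by
      rw [Real.enorm_eq_ofReal (Real.sqrt_nonneg _), ENNReal.rpow_two,
        ← ENNReal.ofReal_pow (Real.sqrt_nonneg _), Real.sq_sqrt h0]
    rw [e, ← ENNReal.ofReal_mul (density_nonneg _ _), ← ENNReal.ofReal_mul (density_nonneg _ _)]
    congr 1
    field_simp [hx.2.1.ne']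
  have hI := (integrable_weightedMeasure_iff χ).1 (h.coeff.integrable_sesq h.transf' h.isOpen hU hY)
  have hI' := (integrable_weightedMeasure_iff χ').1
    (h.coeff.integrable_sesq h'.transf' h.isOpen hU hY)
  have m : ∀ {F : Type} [NormedAddCommGroup F] {f : Rn N → F},
      AEStronglyMeasurable f (volume.restrict Ω) → AEStronglyMeasurable f (weightedMeasure Ω φ) :=
    fun hf => aestronglyMeasurable_weightedMeasure hf
  rw [gradForm, gradForm, integral_weightedMeasure, integral_weightedMeasure, ← integral_sub hI hI']
  calc _ ≤ ∫⁻ x in Ω, ENNReal.ofReal (density φ x) * ‖(n x * ‖U x‖) * z x‖ₑ := by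
        refine (enorm_integral_le_lintegral_enorm _).trans (lintegral_mono_ae ?_)
        filter_upwards [hM] with x hx
        rw [← ofReal_norm, ← ofReal_norm,
          ← ENNReal.ofReal_mul (density_nonneg _ _)]
        refine ENNReal.ofReal_le_ofReal ((hx (U x) (Y x)).trans ?_)
        exact mul_le_mul_of_nonneg_left (Real.le_norm_self _) (density_nonneg _ _)
    _ = eLpNorm ((fun x => n x * ‖U x‖) • z) 1 (weightedMeasure Ω φ) := by
        rw [eLpNorm_one_eq_lintegral_enorm, lintegral_weightedMeasure]; rfl
    _ ≤ eLpNorm (n • fun x => ‖U x‖) 2 (weightedMeasure Ω φ) * eLpNorm z 2 (weightedMeasure Ω φ) :=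
        eLpNorm_smul_le_mul_eLpNorm (m hzm) (m (hn.mul hU.1.norm))
    _ ≤ _ := by
        rw [hz2]
        gcongr
        refine (eLpNorm_smul_le_mul_eLpNorm (p := p) (q := q) (m hU.1.norm) (m hn)).trans ?_
        rw [eLpNorm_norm]

/-- The key estimate for the difference of two resolvents on an eigenfunction. -/
lemma enorm_resolvent_sub_eigenvector_le (h : FormSetting A Ω φ χ) (h' : FormSetting A Ω φ χ')
    {n : Rn N → ℝ} (hn : AEStronglyMeasurable n (volume.restrict Ω))
    (hM : ∀ᵐ x ∂volume.restrict Ω, ∀ ξ ζ,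
      ‖density χ x * sesq (pulledCoefficient A χ x) ξ ζ -
        density χ' x * sesq (pulledCoefficient A χ' x) ξ ζ‖ ≤
      density φ x * (n x * ‖ξ‖ *
        √(density χ' x / density φ x * (sesq (pulledCoefficient A χ' x) ζ ζ).re)))
    {p q : ℝ≥0∞} [ENNReal.HolderTriple p q 2] {R R' : L2 Ω φ →L[ℂ] L2 Ω φ}
    (hR : IsResolvent (formOperator bc A Ω φ χ) R)
    (hR' : IsResolvent (formOperator bc A Ω φ χ') R') {ψ : L2 Ω φ} {l : ℝ} (hl : 0 ≤ l)
    (he : (ψ, (l : ℂ) • ψ) ∈ formOperator bc A Ω φ χ)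
    {U : Rn N → EuclideanSpace ℂ (Fin N)} (hU : HasWeakGrad Ω ψ U) :
    ENNReal.ofReal (1 + l) * ‖(R' - R) ψ‖ₑ ≤
      eLpNorm n p (weightedMeasure Ω φ) * eLpNorm U q (weightedMeasure Ω φ) := by
  set d := (R' - R) ψ with hd
  -- The test function is `R' d`, whose energy in the form `χ'` is at most `‖d‖²`.
  obtain ⟨-, hYm, Y, hY, hYle⟩ := h'.resolvent_form_le hR' d
  have hψm := ((mem_formOperator_iff h.transf h.isOpen h.bounded).1 he).1
  have e1 := gradForm_eq_inner_of_mem h.transf h.transf' h.isOpen h.bounded he hU hYm hY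
  have e2 := gradForm_eq_inner_of_mem h.transf h'.transf' h.isOpen h.bounded (hR'.1 d) hY hψm hU
  have e3 : gradForm A Ω χ' U Y = inner ℂ (d - R' d) ψ := by
    rw [← h.coeff.star_gradForm, e2, RCLike.star_def, inner_conj_symm]
  have e4 : R ψ = (((1 + l)⁻¹ : ℝ) : ℂ) • ψ := hR.apply_eigenvector hl he
  -- By the two equations the difference is `l⟨R'd, ψ⟩ - ⟨d - R'd, ψ⟩ = (1 + l)⟨R'd, ψ⟩ - ⟨d, ψ⟩`.
  -- Moving `R'` to `ψ` and writing `ψ = (1 + l) R ψ` in the last term leaves `(1 + l)⟨d, (R' -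
  -- R)ψ⟩`.
  have e5 : gradForm A Ω χ U Y - gradForm A Ω χ' U Y = ((1 + l : ℝ) : ℂ) * inner ℂ d d := by
    have e6 : ψ = ((1 + l : ℝ) : ℂ) • R ψ := by
      rw [e4, smul_smul, ← Complex.ofReal_mul, mul_inv_cancel₀ (by positivity),
        Complex.ofReal_one, one_smul]
    have e7 : (inner ℂ d ψ : ℂ) = ((1 + l : ℝ) : ℂ) * inner ℂ d (R ψ) := by
      conv_lhs => rw [e6]
      rw [inner_smul_right]
    have e8 : (inner ℂ d d : ℂ) = inner ℂ d (R' ψ) - inner ℂ d (R ψ) := by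
      rw [← inner_sub_right]; rfl
    rw [e1, e3, inner_smul_right, inner_sub_left, h'.resolvent_inner_symm hR', e7, e8]
    push_cast
    ring
  have key := gradForm_sub_le h h' hn hM (p := p) (q := q) (hψm.memLp_grad h.isOpen hU)
    (hYm.memLp_grad h.isOpen hY)
  have e8 : ‖gradForm A Ω χ U Y - gradForm A Ω χ' U Y‖ₑ =
      ENNReal.ofReal (1 + l) * ‖d‖ₑ * ‖d‖ₑ := by
    rw [e5, inner_self_eq_norm_sq_to_K, ← ofReal_norm, ← ofReal_norm,
      ← ENNReal.ofReal_mul (by positivity), ← ENNReal.ofReal_mul (by positivity), norm_mul,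
      norm_pow, Complex.norm_real, Real.norm_of_nonneg (by positivity)]
    congr 1
    rw [RCLike.norm_ofReal, abs_of_nonneg (norm_nonneg d)]
    ring
  have e9 : ENNReal.ofReal (gradForm A Ω χ' Y Y).re ^ (1 / 2 : ℝ) ≤ ‖d‖ₑ := by
    calc _ ≤ ENNReal.ofReal (‖d‖ ^ 2) ^ (1 / 2 : ℝ) := by gcongr
      _ = ‖d‖ₑ := by
        rw [ENNReal.ofReal_pow (norm_nonneg _), ofReal_norm, ← ENNReal.rpow_two,
          ← ENNReal.rpow_mul]
        norm_num
  rw [e8] at key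
  -- The estimate is quadratic in `‖d‖` on the left and linear on the right, so one factor is
  -- cancelled.
  by_cases hd0 : ‖d‖ₑ = 0
  · simp [hd0]
  · refine (ENNReal.mul_le_mul_iff_left hd0 enorm_ne_top).1 (key.trans ?_)
    gcongr

end ResolventDifference

/-! ### The form estimates in terms of `S` and the densities -/

section MatrixQuantities

variable {N : ℕ} {Ω : Set (Rn N)} {φ φ' : Rn N → Rn N} {A : Rn N → Matrix (Fin N) (Fin N) ℝ}

lemma ae_posDef_and_density (h : FormSetting A Ω φ φ') :
    ∀ᵐ x ∂volume.restrict Ω, (pulledCoefficient A φ x).PosDef ∧ (pulledCoefficient A φ' x).PosDef ∧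
      0 < (weight φ φ' x ^ 2)⁻¹ ∧ 0 < density φ x ∧
      (weight φ φ' x ^ 2)⁻¹ * density φ x = density φ' x := by
  obtain ⟨C, -, hC⟩ := h.transf.ae_jacobian_bounds h.isOpen
  obtain ⟨D, -, hD⟩ := h.transf'.ae_jacobian_bounds h.isOpen
  obtain ⟨E, -, hE⟩ := h.transf.ae_weight_bounds h.transf' h.isOpen
  filter_upwards [hC, hD, hE] with x h1 h2 h3
  have := h3.1
  refine ⟨h.coeff.posDef_pulledCoefficient h1.1, h.coeff.posDef_pulledCoefficient h2.1,
    by positivity, h1.2.1, ?_⟩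
  rw [← h3.2.2.2]
  field_simp

lemma FormSetting.aestronglyMeasurable_matS (h : FormSetting A Ω φ φ') :
    AEStronglyMeasurable (matS A φ φ') (volume.restrict Ω) := by
  have hs : AEStronglyMeasurable (fun x => (matSqrt (pulledCoefficient A φ x))⁻¹)
      (volume.restrict Ω) := by
    refine aestronglyMeasurable_matrix_inv (aestronglyMeasurable_matSqrt
      (h.coeff.aestronglyMeasurable_pulledCoefficient h.transf h.isOpen) ?_)
    filter_upwards [ae_posDef_and_density h] with x hx using hx.1.posSemidef
  exact ((measurable_weight φ φ').pow_const 2).inv.aestronglyMeasurable.smul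
    (aestronglyMeasurable_matrix_mul (aestronglyMeasurable_matrix_mul hs
      (h.coeff.aestronglyMeasurable_pulledCoefficient h.transf' h.isOpen)) hs)

lemma FormSetting.aestronglyMeasurable_delta2_left (h : FormSetting A Ω φ φ') :
    AEStronglyMeasurable (fun x => matNorm ((matSqrt (matS A φ φ' x) -
      (matSqrt (matS A φ φ' x))⁻¹) * matSqrt (pulledCoefficient A φ x))) (volume.restrict Ω) := by
  have hS := aestronglyMeasurable_matSqrt h.aestronglyMeasurable_matS (by
    filter_upwards [ae_posDef_and_density h] with x hx
    exact (relMatrix_posDef hx.1 hx.2.1 hx.2.2.1).posSemidef)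
  have ha := aestronglyMeasurable_matSqrt
    (h.coeff.aestronglyMeasurable_pulledCoefficient h.transf h.isOpen) (by
      filter_upwards [ae_posDef_and_density h] with x hx using hx.1.posSemidef)
  exact continuous_matNorm.comp_aestronglyMeasurable
    (aestronglyMeasurable_matrix_mul (hS.sub (aestronglyMeasurable_matrix_inv hS)) ha)

lemma FormSetting.aestronglyMeasurable_delta2_right (h : FormSetting A Ω φ φ') :
    AEStronglyMeasurable (fun x => matNorm ((matS A φ φ' x - 1) *
      matSqrt (pulledCoefficient A φ x))) (volume.restrict Ω) := by
  have ha := aestronglyMeasurable_matSqrt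
    (h.coeff.aestronglyMeasurable_pulledCoefficient h.transf h.isOpen) (by
      filter_upwards [ae_posDef_and_density h] with x hx using hx.1.posSemidef)
  exact continuous_matNorm.comp_aestronglyMeasurable
    (aestronglyMeasurable_matrix_mul
      (h.aestronglyMeasurable_matS.sub aestronglyMeasurable_const) ha)

/-- Multiply `norm_sesq_sub_le` by `g` and use `w⁻² g = g̃`. -/
lemma FormSetting.ae_form_sub_le_left (h : FormSetting A Ω φ φ') :
    ∀ᵐ x ∂volume.restrict Ω, ∀ ξ ζ,
      ‖density φ x * sesq (pulledCoefficient A φ x) ξ ζ -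
        density φ' x * sesq (pulledCoefficient A φ' x) ξ ζ‖ ≤
      density φ x * (matNorm ((matSqrt (matS A φ φ' x) -
          (matSqrt (matS A φ φ' x))⁻¹) * matSqrt (pulledCoefficient A φ x)) * ‖ξ‖ *
        √(density φ' x / density φ x * (sesq (pulledCoefficient A φ' x) ζ ζ).re)) := by
  filter_upwards [ae_posDef_and_density h] with x ⟨h1, h2, h3, h4, h5⟩ ξ ζ
  have key := norm_sesq_sub_le h1 h2 h3 ξ ζ
  rw [← h5, Complex.ofReal_mul, mul_comm ((_ : ℝ) : ℂ) (density φ x : ℂ), mul_assoc, ← mul_sub,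
    norm_mul, Complex.norm_real, Real.norm_of_nonneg h4.le, mul_div_cancel_right₀ _ h4.ne',
    ← Complex.re_ofReal_mul]
  exact mul_le_mul_of_nonneg_left key h4.le

/-- The trivial quotient `density φ x / density φ x` is kept so that this has the shape of the
hypothesis `hM` of `gradForm_sub_le` with `φ` as the second transformation. -/
lemma FormSetting.ae_form_sub_le_right (h : FormSetting A Ω φ φ') :
    ∀ᵐ x ∂volume.restrict Ω, ∀ ξ ζ,
      ‖density φ' x * sesq (pulledCoefficient A φ' x) ξ ζ -
        density φ x * sesq (pulledCoefficient A φ x) ξ ζ‖ ≤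
      density φ x * (matNorm ((matS A φ φ' x - 1) * matSqrt (pulledCoefficient A φ x)) * ‖ξ‖ *
        √(density φ x / density φ x * (sesq (pulledCoefficient A φ x) ζ ζ).re)) := by
  filter_upwards [ae_posDef_and_density h] with x ⟨h1, h2, h3, h4, h5⟩ ξ ζ
  have key := norm_sesq_sub_le' (c := (weight φ φ' x ^ 2)⁻¹) h1 h2 ξ ζ
  rw [norm_sub_rev, ← h5, Complex.ofReal_mul, mul_comm ((_ : ℝ) : ℂ) (density φ x : ℂ), mul_assoc,
    ← mul_sub, norm_mul, Complex.norm_real, Real.norm_of_nonneg h4.le, div_self h4.ne', one_mul]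
  exact mul_le_mul_of_nonneg_left key h4.le

end MatrixQuantities

/-! ### Multiplication operators in `L²` -/

section Multiplication

variable {α : Type*} [MeasurableSpace α] {μ : Measure α}

lemma MemLp.ofReal_mul_of_ae_bound {h : α → ℝ} (hm : AEStronglyMeasurable h μ) {C : ℝ}
    (hC : ∀ᵐ x ∂μ, |h x| ≤ C) {f : α → ℂ} (hf : MemLp f 2 μ) :
    MemLp (fun x => (h x : ℂ) * f x) 2 μ := by
  refine (hf.const_mul (C : ℂ)).mono
    ((Complex.continuous_ofReal.comp_aestronglyMeasurable hm).mul hf.1) ?_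
  filter_upwards [hC] with x hx
  rw [norm_mul, norm_mul, Complex.norm_real, Complex.norm_real]
  exact mul_le_mul_of_nonneg_right (hx.trans (le_abs_self C)) (norm_nonneg _)

/-- Multiplication by a bounded real function, as a bounded operator in `L²`. -/
lemma exists_multiplication_operator {h : α → ℝ} (hm : AEStronglyMeasurable h μ) {C : ℝ}
    (hC : ∀ᵐ x ∂μ, |h x| ≤ C) : ∃ T : Lp ℂ 2 μ →L[ℂ] Lp ℂ 2 μ,
      ∀ f, T f =ᵐ[μ] fun x => (h x : ℂ) * f x := by
  have hmem : ∀ f : Lp ℂ 2 μ, MemLp (fun x => (h x : ℂ) * f x) 2 μ := fun f =>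
    MemLp.ofReal_mul_of_ae_bound hm hC (Lp.memLp f)
  let T : Lp ℂ 2 μ →ₗ[ℂ] Lp ℂ 2 μ :=
    { toFun := fun f => (hmem f).toLp
      map_add' := fun f g => by
        refine Lp.ext ?_
        filter_upwards [(hmem (f + g)).coeFn_toLp, (hmem f).coeFn_toLp, (hmem g).coeFn_toLp,
          Lp.coeFn_add f g, Lp.coeFn_add (hmem f).toLp (hmem g).toLp] with x h1 h2 h3 h4 h5
        rw [h1, h4, h5, Pi.add_apply, Pi.add_apply, h2, h3, mul_add]
      map_smul' := fun c f => by
        refine Lp.ext ?_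
        filter_upwards [(hmem (c • f)).coeFn_toLp, (hmem f).coeFn_toLp,
          Lp.coeFn_smul c f, Lp.coeFn_smul c (hmem f).toLp] with x h1 h2 h4 h5
        simp only [RingHom.id_apply]
        rw [h1, h4, h5, Pi.smul_apply, Pi.smul_apply, h2, smul_eq_mul, smul_eq_mul]
        ring }
  refine ⟨T.mkContinuous C fun f => ?_, fun f => (hmem f).coeFn_toLp⟩
  refine Lp.norm_le_mul_norm_of_ae_le_mul ?_
  filter_upwards [(hmem f).coeFn_toLp, hC] with x h1 h2
  have : (T f) x = (h x : ℂ) * f x := h1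
  rw [this, norm_mul, Complex.norm_real]
  exact mul_le_mul_of_nonneg_right h2 (norm_nonneg _)

lemma isSelfAdjoint_of_ae_eq_mul {h : α → ℝ} {T : Lp ℂ 2 μ →L[ℂ] Lp ℂ 2 μ}
    (hT : ∀ f, T f =ᵐ[μ] fun x => (h x : ℂ) * f x) : IsSelfAdjoint T := by
  refine ContinuousLinearMap.isSelfAdjoint_iff_isSymmetric.2 fun f g => ?_
  change inner ℂ (T f) g = inner ℂ f (T g)
  rw [L2.inner_def, L2.inner_def]
  refine integral_congr_ae ?_
  filter_upwards [hT f, hT g] with x h1 h2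
  rw [h1, h2]
  simp only [RCLike.inner_apply, map_mul, Complex.conj_ofReal]
  ring

lemma enorm_mul_apply_le {h : α → ℝ} (hm : AEStronglyMeasurable h μ)
    {T : Lp ℂ 2 μ →L[ℂ] Lp ℂ 2 μ} (hT : ∀ f, T f =ᵐ[μ] fun x => (h x : ℂ) * f x)
    (p q : ℝ≥0∞) [ENNReal.HolderTriple p q 2] (f : Lp ℂ 2 μ) :
    ‖T f‖ₑ ≤ eLpNorm h p μ * eLpNorm f q μ := by
  rw [Lp.enorm_def, eLpNorm_congr_ae (hT f)]
  refine (eLpNorm_smul_le_mul_eLpNorm (f := f) (φ := fun x => (h x : ℂ)) (p := p) (q := q)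
    (Lp.aestronglyMeasurable f)
    (Complex.continuous_ofReal.comp_aestronglyMeasurable hm)).trans (le_of_eq ?_)
  congr 1
  exact eLpNorm_congr_norm_ae (Filter.Eventually.of_forall fun x => Complex.norm_real _)

end Multiplication

/-! ### Conjugation by `w` and the identity for `R' - Q` -/

section Conjugation

variable {N : ℕ} {Ω : Set (Rn N)} {φ φ' : Rn N → Rn N} {bc : BoundaryCondition}
  {A : Rn N → Matrix (Fin N) (Fin N) ℝ}

lemma eLpNorm_weight_mul (h : IsTransformation Ω φ) (h' : IsTransformation Ω φ') (hΩ : IsOpen Ω)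
    (f : Rn N → ℂ) : eLpNorm (fun x => (weight φ φ' x : ℂ) * f x) 2 (weightedMeasure Ω φ') =
      eLpNorm f 2 (weightedMeasure Ω φ) := by
  rw [eLpNorm_eq_lintegral_rpow_enorm_toReal two_ne_zero ENNReal.ofNat_ne_top,
    eLpNorm_eq_lintegral_rpow_enorm_toReal two_ne_zero ENNReal.ofNat_ne_top,
    lintegral_weightedMeasure, lintegral_weightedMeasure, ENNReal.toReal_ofNat]
  congr 1
  obtain ⟨C, -, hC⟩ := h.ae_weight_bounds h' hΩ
  refine lintegral_congr_ae ?_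
  filter_upwards [hC] with x hx
  rw [← hx.2.2.2, enorm_mul, ENNReal.mul_rpow_of_nonneg _ _ zero_le_two, ← mul_assoc,
    ENNReal.rpow_two, ← ofReal_norm, Complex.norm_real, Real.norm_of_nonneg hx.1.le,
    ← ENNReal.ofReal_pow hx.1.le, ← ENNReal.ofReal_mul (density_nonneg _ _), mul_comm (density φ' x)]

lemma memLp_two_iff (h : IsTransformation Ω φ) (h' : IsTransformation Ω φ') (hΩ : IsOpen Ω)
    {f : Rn N → ℂ} : MemLp f 2 (weightedMeasure Ω φ) ↔ MemLp f 2 (weightedMeasure Ω φ') := by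
  rw [h.memLp_weightedMeasure_iff hΩ, h'.memLp_weightedMeasure_iff hΩ]

/-- The unitary map `u ↦ w u`. -/
lemma exists_weight_isometry (h : IsTransformation Ω φ) (h' : IsTransformation Ω φ')
    (hΩ : IsOpen Ω) : ∃ W : L2 Ω φ ≃ₗᵢ[ℂ] L2 Ω φ',
      ∀ f, W f =ᵐ[volume.restrict Ω] fun x => (weight φ φ' x : ℂ) * f x := by
  obtain ⟨C, hC0, hC⟩ := h.ae_weight_bounds h' hΩ
  have hmem : ∀ f : L2 Ω φ, MemLp (fun x => (weight φ φ' x : ℂ) * f x) 2 (weightedMeasure Ω φ') :=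
    fun f => by
      refine MemLp.ofReal_mul_of_ae_bound (C := C) (measurable_weight φ φ').aestronglyMeasurable
        ((h'.ae_weightedMeasure_iff hΩ).2 ?_) ((memLp_two_iff h h' hΩ).1 (Lp.memLp f))
      filter_upwards [hC] with x hx
      rw [abs_of_pos hx.1]; exact hx.2.1
  have hmem' : ∀ f : L2 Ω φ', MemLp (fun x => (((weight φ φ' x)⁻¹ : ℝ) : ℂ) * f x) 2
      (weightedMeasure Ω φ) := fun f => by
    refine MemLp.ofReal_mul_of_ae_bound (C := C)
      (measurable_weight φ φ').inv.aestronglyMeasurable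
      ((h.ae_weightedMeasure_iff hΩ).2 ?_) ((memLp_two_iff h h' hΩ).2 (Lp.memLp f))
    filter_upwards [hC] with x hx
    rw [Pi.inv_apply, abs_of_pos (inv_pos.2 hx.1)]; exact hx.2.2.1
  let T : L2 Ω φ →ₗᵢ[ℂ] L2 Ω φ' :=
    { toFun := fun f => (hmem f).toLp
      map_add' := fun f g => by
        refine Lp.ext ?_
        filter_upwards [(hmem (f + g)).coeFn_toLp, (hmem f).coeFn_toLp, (hmem g).coeFn_toLp,
          (h'.ae_weightedMeasure_iff hΩ).2 ((h.ae_weightedMeasure_iff hΩ).1 (Lp.coeFn_add f g)),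
          Lp.coeFn_add (hmem f).toLp (hmem g).toLp] with x h1 h2 h3 h4 h5
        rw [h1, h4, h5, Pi.add_apply, Pi.add_apply, h2, h3, mul_add]
      map_smul' := fun c f => by
        refine Lp.ext ?_
        filter_upwards [(hmem (c • f)).coeFn_toLp, (hmem f).coeFn_toLp,
          (h'.ae_weightedMeasure_iff hΩ).2 ((h.ae_weightedMeasure_iff hΩ).1 (Lp.coeFn_smul c f)),
          Lp.coeFn_smul c (hmem f).toLp] with x h1 h2 h4 h5
        simp only [RingHom.id_apply]
        rw [h1, h4, h5, Pi.smul_apply, Pi.smul_apply, h2, smul_eq_mul, smul_eq_mul]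
        ring
      norm_map' := fun f => by
        change ‖(hmem f).toLp‖ = ‖f‖
        rw [Lp.norm_toLp, Lp.norm_def, eLpNorm_weight_mul h h' hΩ] }
  have hsurj : Function.Surjective T := fun f => by
    refine ⟨(hmem' f).toLp, Lp.ext ?_⟩
    refine (hmem (hmem' f).toLp).coeFn_toLp.trans ?_
    filter_upwards [(h'.ae_weightedMeasure_iff hΩ).2 hC, (h'.ae_weightedMeasure_iff hΩ).2
      ((h.ae_weightedMeasure_iff hΩ).1 (hmem' f).coeFn_toLp)] with x h1 h2
    rw [h2, ← mul_assoc, ← Complex.ofReal_mul, mul_inv_cancel₀ h1.1.ne', Complex.ofReal_one, one_mul]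
  exact ⟨LinearIsometryEquiv.ofSurjective T hsurj,
    fun f => (h'.ae_weightedMeasure_iff hΩ).1 (hmem f).coeFn_toLp⟩

/-- The maps entering the comparison of `w⁻¹ H̃ w` with `T*ST`: the unitary map `W : u ↦ w u` and
the operators of multiplication by `w - 1` and by `w⁻¹ - 1`. -/
structure WeightMaps (Ω : Set (Rn N)) (φ φ' : Rn N → Rn N) where
  W : L2 Ω φ ≃ₗᵢ[ℂ] L2 Ω φ'
  a : L2 Ω φ →L[ℂ] L2 Ω φ
  b : L2 Ω φ →L[ℂ] L2 Ω φ
  W_apply : ∀ f, W f =ᵐ[volume.restrict Ω] fun x => (weight φ φ' x : ℂ) * f x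
  a_apply : ∀ f, a f =ᵐ[weightedMeasure Ω φ] fun x => ((weight φ φ' x - 1 : ℝ) : ℂ) * f x
  b_apply : ∀ f, b f =ᵐ[weightedMeasure Ω φ] fun x => (((weight φ φ' x)⁻¹ - 1 : ℝ) : ℂ) * f x

lemma nonempty_weightMaps (h : IsTransformation Ω φ) (h' : IsTransformation Ω φ')
    (hΩ : IsOpen Ω) : Nonempty (WeightMaps Ω φ φ') := by
  obtain ⟨W, hW⟩ := exists_weight_isometry h h' hΩ
  obtain ⟨C, hC0, hC⟩ := h.ae_weight_bounds h' hΩ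
  have hC := (h.ae_weightedMeasure_iff hΩ).2 hC
  obtain ⟨a, ha⟩ := exists_multiplication_operator (μ := weightedMeasure Ω φ) (C := C + 1)
    (h := fun x => weight φ φ' x - 1)
    ((measurable_weight φ φ').sub_const 1).aestronglyMeasurable (by
      filter_upwards [hC] with x hx
      have := hx.1
      rw [abs_le]; constructor <;> linarith [hx.2.1])
  obtain ⟨b, hb⟩ := exists_multiplication_operator (μ := weightedMeasure Ω φ) (C := C + 1)
    (h := fun x => (weight φ φ' x)⁻¹ - 1)
    ((measurable_weight φ φ').inv.sub_const 1).aestronglyMeasurable (by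
      filter_upwards [hC] with x hx
      have := inv_pos.2 hx.1
      rw [abs_le]; constructor <;> linarith [hx.2.2.1])
  exact ⟨⟨W, a, b, hW, ha, hb⟩⟩

namespace WeightMaps

lemma mem_opConj_iff (w : WeightMaps Ω φ φ') (h' : IsTransformation Ω φ') (hΩ : IsOpen Ω)
    {p : L2 Ω φ × L2 Ω φ} :
    p ∈ opConj bc A Ω φ φ' ↔ (w.W p.1, w.W p.2) ∈ opH bc A Ω φ' := by
  constructor
  · rintro ⟨⟨q1, q2⟩, hq, h1, h2⟩
    have e1 : q1 = w.W p.1 := Lp.ext ((h'.ae_weightedMeasure_iff hΩ).2 (h1.trans (w.W_apply _).symm))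
    have e2 : q2 = w.W p.2 := Lp.ext ((h'.ae_weightedMeasure_iff hΩ).2 (h2.trans (w.W_apply _).symm))
    rwa [← e1, ← e2]
  · exact fun hp => ⟨_, hp, w.W_apply _, w.W_apply _⟩

/-- `(w⁻¹ H̃ w + 1)⁻¹ = W⁻¹ (H̃ + 1)⁻¹ W`. -/
noncomputable def conj (w : WeightMaps Ω φ φ') (R : L2 Ω φ' →L[ℂ] L2 Ω φ') :
    L2 Ω φ →L[ℂ] L2 Ω φ :=
  (w.W.symm.toContinuousLinearEquiv : L2 Ω φ' →L[ℂ] L2 Ω φ) ∘L R ∘L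
    (w.W.toContinuousLinearEquiv : L2 Ω φ →L[ℂ] L2 Ω φ')

lemma W_conj (w : WeightMaps Ω φ φ') (R : L2 Ω φ' →L[ℂ] L2 Ω φ') (f : L2 Ω φ) :
    w.W (w.conj R f) = R (w.W f) := by
  simp [conj]

lemma isResolvent_conj (w : WeightMaps Ω φ φ') (h' : IsTransformation Ω φ') (hΩ : IsOpen Ω)
    {R : L2 Ω φ' →L[ℂ] L2 Ω φ'} (hR : IsResolvent (opH bc A Ω φ') R) :
    IsResolvent (opConj bc A Ω φ φ') (w.conj R) := by
  constructor
  · intro f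
    rw [w.mem_opConj_iff h' hΩ]
    simp only [map_sub, w.W_conj]
    exact hR.1 _
  · intro p hp
    apply w.W.injective
    rw [w.W_conj, map_add]
    exact hR.2 _ ((w.mem_opConj_iff h' hΩ).1 hp)

lemma isEigenSystem_map (w : WeightMaps Ω φ φ') (h' : IsTransformation Ω φ') (hΩ : IsOpen Ω)
    {lam : ℕ → ℝ} {ψ : ℕ → L2 Ω φ} (hs : IsEigenSystem (opConj bc A Ω φ φ') lam ψ) :
    IsEigenSystem (opH bc A Ω φ') lam fun n => w.W (ψ n) where
  mono := hs.mono
  orthonormal := hs.orthonormal.comp_linearIsometryEquiv w.W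
  complete := by
    have h1 := hs.complete
    rw [← Submodule.dense_iff_topologicalClosure_eq_top] at h1 ⊢
    have h2 := w.W.surjective.denseRange.dense_image w.W.continuous h1
    refine h2.mono ?_
    rintro _ ⟨x, hx, rfl⟩
    have h3 := Submodule.mem_map_of_mem (f := w.W.toLinearEquiv.toLinearMap) hx
    rw [Submodule.map_span, ← Set.range_comp] at h3
    exact h3
  eigen n := by
    have := (w.mem_opConj_iff h' hΩ).1 (hs.eigen n)
    simpa only [map_smul] using this

lemma isSelfAdjoint_conj (w : WeightMaps Ω φ φ') {R : L2 Ω φ' →L[ℂ] L2 Ω φ'}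
    (hR : IsSelfAdjoint R) : IsSelfAdjoint (w.conj R) := by
  refine ContinuousLinearMap.isSelfAdjoint_iff_isSymmetric.2 fun f g => ?_
  change inner ℂ (w.conj R f) g = inner ℂ f (w.conj R g)
  rw [← w.W.inner_map_map, ← w.W.inner_map_map f, w.W_conj, w.W_conj]
  exact ContinuousLinearMap.isSelfAdjoint_iff_isSymmetric.1 hR _ _

lemma norm_conj_le (w : WeightMaps Ω φ φ') {R : L2 Ω φ' →L[ℂ] L2 Ω φ'} (hR : ‖R‖ ≤ 1) :
    ‖w.conj R‖ ≤ 1 :=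
  ContinuousLinearMap.opNorm_le_bound _ zero_le_one fun f => by
    rw [← w.W.norm_map (w.conj R f), w.W_conj, ← w.W.norm_map f]
    exact R.le_of_opNorm_le hR _

lemma isSelfAdjoint_a (w : WeightMaps Ω φ φ') : IsSelfAdjoint w.a :=
  isSelfAdjoint_of_ae_eq_mul w.a_apply

lemma isSelfAdjoint_b (w : WeightMaps Ω φ φ') : IsSelfAdjoint w.b :=
  isSelfAdjoint_of_ae_eq_mul w.b_apply

lemma add_a_ae_eq (w : WeightMaps Ω φ φ') (h : IsTransformation Ω φ) (hΩ : IsOpen Ω)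
    (f : L2 Ω φ) : (f + w.a f : L2 Ω φ) =ᵐ[volume.restrict Ω] w.W f := by
  filter_upwards [w.W_apply f, (h.ae_weightedMeasure_iff hΩ).1 (w.a_apply f),
    (h.ae_weightedMeasure_iff hΩ).1 (Lp.coeFn_add f (w.a f))] with x h1 h2 h3
  rw [h1, h3, Pi.add_apply, h2]
  push_cast
  ring

lemma W_add_b_ae_eq (w : WeightMaps Ω φ φ') (h : IsTransformation Ω φ)
    (h' : IsTransformation Ω φ') (hΩ : IsOpen Ω) (f : L2 Ω φ) :
    w.W (f + w.b f) =ᵐ[volume.restrict Ω] f := by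
  obtain ⟨C, -, hC⟩ := h.ae_weight_bounds h' hΩ
  filter_upwards [w.W_apply (f + w.b f), (h.ae_weightedMeasure_iff hΩ).1 (w.b_apply f),
    (h.ae_weightedMeasure_iff hΩ).1 (Lp.coeFn_add f (w.b f)), hC] with x h1 h2 h3 h4
  rw [h1, h3, Pi.add_apply, h2]
  have : (weight φ φ' x : ℂ) ≠ 0 := Complex.ofReal_ne_zero.2 h4.1.ne'
  push_cast
  field_simp
  ring

/-- `w R' f` solves the equation of `T*ST` with right-hand side `w⁻¹ (f - R' f)`. -/
lemma mem_opTST (w : WeightMaps Ω φ φ') (h : FormSetting A Ω φ φ')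
    {R : L2 Ω φ' →L[ℂ] L2 Ω φ'} (hR : IsResolvent (opH bc A Ω φ') R) (f : L2 Ω φ) :
    (w.conj R f + w.a (w.conj R f), (f - w.conj R f) + w.b (f - w.conj R f)) ∈
      opTST bc A Ω φ φ' := by
  have e := (w.add_a_ae_eq h.transf h.isOpen (w.conj R f)).symm
  rw [w.W_conj] at e
  obtain ⟨h1, U, hU, h2⟩ := (mem_formOperator_iff h.transf' h.isOpen h.bounded).1 (hR.1 (w.W f))
  refine (mem_formOperator_iff h.transf h.isOpen h.bounded).2
    ⟨h1.congr e, U, hU.congr e (ae_eq_refl _), fun v V hv hV => ?_⟩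
  -- A test function `v` for `T*ST` is written as `w · (w⁻¹ v)` with `w⁻¹ v = v + b v`, so that the
  -- equation of `H̃` can be tested with it and the unitary `W` removed from the inner product.
  have ev := (w.W_add_b_ae_eq h.transf h.transf' h.isOpen v).symm
  rw [h2 _ V (hv.congr ev) (hV.congr ev (ae_eq_refl _))]
  change inner ℂ (w.W (v + w.b v)) (w.W f - R (w.W f)) = _
  rw [← w.W_conj, ← map_sub, w.W.inner_map_map, inner_add_left, inner_add_right]
  congr 1
  exact ContinuousLinearMap.isSelfAdjoint_iff_isSymmetric.1 w.isSelfAdjoint_b _ _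

/-- `R' - Q = -a R' + Q b + Q (a - b) R'`. -/
lemma conj_sub (w : WeightMaps Ω φ φ') (h : FormSetting A Ω φ φ')
    {R : L2 Ω φ' →L[ℂ] L2 Ω φ'} (hR : IsResolvent (opH bc A Ω φ') R)
    {Q : L2 Ω φ →L[ℂ] L2 Ω φ} (hQ : IsResolvent (opTST bc A Ω φ φ') Q) :
    w.conj R - Q = -(w.a * w.conj R) + Q * w.b + Q * (w.a - w.b) * w.conj R := by
  ext1 f
  have h1 := hQ.2 _ (w.mem_opTST h hR f)
  set R' := w.conj R
  -- The right-hand side of `(T*ST + 1)(w R'f) = w⁻¹(f - R'f) + w R'f`, written with `a = w - 1` and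
  -- `b = w⁻¹ - 1`; applying `Q` to it returns `w R'f = R'f + a R'f`.
  have h2 : (f - R' f) + w.b (f - R' f) + (R' f + w.a (R' f)) =
      f + w.b f + (w.a (R' f) - w.b (R' f)) := by
    rw [map_sub]; abel
  simp only [h2, map_add] at h1
  have h3 : ∀ {x y z s t : L2 Ω φ}, y + z + s = x + t → x - y = -t + z + s := fun e => by
    rw [eq_sub_of_add_eq e.symm]; abel
  exact h3 h1

end WeightMaps

end Conjugation

/-! ### The Hölder exponents and the norm of the constant function -/

section Exponents

/-- With `p = 2q₀/(q₀-2)` this is `1/p + 1/q₀ = 1/2`. The case `q₀ = ∞` needs no separate treatment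
because `∞⁻¹ = 0`. -/
lemma holderTriple_exponentFactor {q₀ : ℝ≥0∞} (hq : 2 < q₀) :
    ENNReal.HolderTriple (ENNReal.ofReal (2 * exponentFactor q₀)) q₀ 2 := by
  have h0 : q₀⁻¹ < 2⁻¹ := ENNReal.inv_lt_inv.2 hq
  have h1 : (2 / q₀).toReal = 2 * (q₀⁻¹).toReal := by
    rw [div_eq_mul_inv, ENNReal.toReal_mul, ENNReal.toReal_ofNat]
  have h2 : (q₀⁻¹).toReal < 2⁻¹ := by
    have := (ENNReal.toReal_lt_toReal (h0.trans_le le_top).ne (by simp)).2 h0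
    simpa using this
  have h3 : 0 < 1 - (2 / q₀).toReal := by rw [h1]; linarith
  refine ⟨?_⟩
  have h4 : 0 < exponentFactor q₀ := inv_pos.2 h3
  rw [← ENNReal.ofReal_inv_of_pos (mul_pos two_pos h4),
    ← ENNReal.ofReal_toReal (h0.trans_le le_top).ne,
    ← ENNReal.ofReal_add (by positivity) ENNReal.toReal_nonneg,
    exponentFactor, mul_inv, inv_inv, h1,
    show (2 : ℝ)⁻¹ * (1 - 2 * (q₀⁻¹).toReal) + (q₀⁻¹).toReal = 2⁻¹ by ring,
    ENNReal.ofReal_inv_of_pos two_pos, ENNReal.ofReal_ofNat]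

/-- For total mass `V` this compares `V^(1/q)` with `V^(1/2)`. If `V ≥ 1`, use `1/q ≤ 1/2`; if `V ≤
1`, use `V^(1/q) ≤ 1 ≤ (V/m)^(1/2)`. -/
lemma eLpNorm_one_le_of_le_measure {α : Type*} [MeasurableSpace α] {μ : Measure α}
    {q : ℝ≥0∞} (hq : 2 ≤ q) {m : ℝ} (hm : 0 < m)
    (hμ : ENNReal.ofReal m ≤ μ univ) :
    eLpNorm (fun _ => (1 : ℂ)) q μ ≤
      ENNReal.ofReal (1 + (√m)⁻¹) * eLpNorm (fun _ => (1 : ℂ)) 2 μ := by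
  have hμ0 : μ ≠ 0 := by
    rintro rfl
    simp [hm.not_ge] at hμ
  rw [eLpNorm_const _ (by positivity) hμ0, eLpNorm_const _ two_ne_zero hμ0, enorm_one, one_mul,
    one_mul, ENNReal.toReal_ofNat]
  set V := μ univ
  have ht0 : 0 ≤ 1 / q.toReal := by positivity
  have ht : 1 / q.toReal ≤ 1 / 2 := by
    -- For `q = ⊤` the conventions `(⊤).toReal = 0` and `1 / 0 = 0` give the exponent `0`, which is
    -- the correct value.
    rcases eq_or_ne q ⊤ with rfl | hq'
    · simp
    · have : 2 ≤ q.toReal := by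
        simpa using (ENNReal.toReal_le_toReal ENNReal.ofNat_ne_top hq').2 hq
      exact one_div_le_one_div_of_le two_pos this
  have hκ : 1 ≤ ENNReal.ofReal (1 + (√m)⁻¹) := by
    rw [ENNReal.one_le_ofReal]; linarith [inv_nonneg.2 (Real.sqrt_nonneg m)]
  rcases le_total 1 V with hV | hV
  · exact (ENNReal.rpow_le_rpow_of_exponent_le hV ht).trans (le_mul_of_one_le_left' hκ)
  · calc V ^ (1 / q.toReal) ≤ 1 := ENNReal.rpow_le_one hV ht0
      _ = ENNReal.ofReal ((√m)⁻¹) * ENNReal.ofReal m ^ (1 / 2 : ℝ) := by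
        rw [ENNReal.ofReal_rpow_of_pos hm, ← Real.sqrt_eq_rpow, ← ENNReal.ofReal_mul (by positivity),
          inv_mul_cancel₀ (Real.sqrt_pos.2 hm).ne', ENNReal.ofReal_one]
      _ ≤ _ := by
        gcongr
        linarith

end Exponents

/-! ### Summation over the eigenvalues -/

section Summation

lemma tsum_ite_le_of_subsingleton {P : ℕ → Prop} [DecidablePred P]
    (hP : ∀ m n, P m → P n → m = n) {t : ℕ → ℝ≥0∞} {D : ℝ≥0∞} (ht : ∀ n, P n → t n ≤ D) :
    ∑' n, (if P n then t n else 0) ≤ D := by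
  by_cases h : ∃ n, P n
  · obtain ⟨n, hn⟩ := h
    rw [tsum_eq_single n fun m hm => if_neg fun h' => hm (hP m n h' hn), if_pos hn]
    exact ht n hn
  · push Not at h
    simp [h]

/-- `C₁^{-2α} ∑ n⁻²`, a bound for `∑ λ_n^{-2α}`. -/
noncomputable def growthConst (α C₁ : ℝ) : ℝ := C₁ ^ (-(2 * α)) * ∑' n : ℕ, 1 / ((n : ℝ) + 1) ^ 2

lemma growthConst_nonneg {α C₁ : ℝ} (hC : 0 < C₁) : 0 ≤ growthConst α C₁ :=
  mul_nonneg (Real.rpow_nonneg hC.le _) (tsum_nonneg fun n => by positivity)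

/-- Each term is governed by `(1 + λ)^(γ-L) ≤ (1 + λ)^(-α) ≤ λ^(-α) ≤ C₁^(-α) / (n + 1)`, whose
squares are summable. The condition `γ + α ≤ L` enters in the first inequality. -/
lemma tsum_weighted_sq_le {α γ C₁ c : ℝ} (hα : 0 < α) (hC₁ : 0 < C₁) (hc : 0 ≤ c) {lam : ℕ → ℝ}
    (h0 : ∀ n, 0 ≤ lam n) (hg : ∀ n, lam n ≠ 0 → C₁ * ((n : ℝ) + 1) ^ (1 / α) ≤ lam n) {L : ℕ}
    (hL : γ + α ≤ L) {t : ℕ → ℝ≥0∞} {δ : ℝ≥0∞}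
    (ht : ∀ n, lam n ≠ 0 → t n ≤ δ * ENNReal.ofReal (c * (1 + lam n) ^ γ)) :
    ∑' n, (if lam n = 0 then 0 else (ENNReal.ofReal (((1 + lam n)⁻¹) ^ L) * t n) ^ 2) ≤
      δ ^ 2 * ENNReal.ofReal (c ^ 2 * growthConst α C₁) := by
  have hsum : Summable fun n : ℕ => 1 / ((n : ℝ) + 1) ^ 2 := by
    have := (summable_nat_add_iff 1).2 (Real.summable_one_div_nat_pow.2 one_lt_two)
    simpa using this
  have key : ∀ n, (if lam n = 0 then 0 else (ENNReal.ofReal (((1 + lam n)⁻¹) ^ L) * t n) ^ 2) ≤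
      δ ^ 2 * ENNReal.ofReal (c ^ 2 * C₁ ^ (-(2 * α)) * (1 / ((n : ℝ) + 1) ^ 2)) := fun n => by
    split_ifs with hn
    · exact zero_le
    have hpos : 0 < lam n := (h0 n).lt_of_ne' hn
    have h1 : 0 < 1 + lam n := by positivity
    have hr : (((1 + lam n)⁻¹) ^ L * (1 + lam n) ^ γ) ^ 2 ≤
        C₁ ^ (-(2 * α)) * (1 / ((n : ℝ) + 1) ^ 2) := by
      have e1 : ((1 + lam n)⁻¹) ^ L * (1 + lam n) ^ γ = (1 + lam n) ^ (γ - L) := by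
        rw [Real.rpow_sub h1, Real.rpow_natCast, inv_pow]; field_simp
      calc (((1 + lam n)⁻¹) ^ L * (1 + lam n) ^ γ) ^ 2 ≤ ((1 + lam n) ^ (-α)) ^ 2 := by
            rw [e1]
            refine pow_le_pow_left₀ (by positivity) ?_ 2
            exact Real.rpow_le_rpow_of_exponent_le (by linarith) (by linarith)
        _ ≤ (lam n ^ (-α)) ^ 2 := by
            refine pow_le_pow_left₀ (by positivity) ?_ 2
            exact Real.rpow_le_rpow_of_nonpos hpos (by linarith) (by linarith)
        _ ≤ ((C₁ * ((n : ℝ) + 1) ^ (1 / α)) ^ (-α)) ^ 2 := by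
            refine pow_le_pow_left₀ (by positivity) ?_ 2
            exact Real.rpow_le_rpow_of_nonpos (by positivity) (hg n hn) (by linarith)
        _ = _ := by
            rw [Real.mul_rpow hC₁.le (by positivity), ← Real.rpow_mul (by positivity), mul_pow,
              ← Real.rpow_natCast (C₁ ^ (-α)), ← Real.rpow_mul hC₁.le,
              show 1 / α * -α = -1 by field_simp, Real.rpow_neg_one, inv_pow, one_div,
              show -α * ((2 : ℕ) : ℝ) = -(2 * α) by push_cast; ring]
    calc (ENNReal.ofReal (((1 + lam n)⁻¹) ^ L) * t n) ^ 2
        ≤ (ENNReal.ofReal (((1 + lam n)⁻¹) ^ L) *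
            (δ * ENNReal.ofReal (c * (1 + lam n) ^ γ))) ^ 2 := by gcongr; exact ht n hn
      _ = δ ^ 2 * ENNReal.ofReal (c ^ 2 * (((1 + lam n)⁻¹) ^ L * (1 + lam n) ^ γ) ^ 2) := by
          rw [mul_left_comm, ← ENNReal.ofReal_mul (by positivity), mul_pow,
            ← ENNReal.ofReal_pow (by positivity)]
          congr 2; ring
      _ ≤ _ := by
          rw [mul_assoc (c ^ 2)]
          gcongr
  refine (ENNReal.tsum_le_tsum key).trans (le_of_eq ?_)
  rw [ENNReal.tsum_mul_left, ← ENNReal.ofReal_tsum_of_nonneg (fun n => by positivity)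
    (hsum.mul_left _), tsum_mul_left, growthConst, mul_assoc]

variable {X : Type*} [NormedAddCommGroup X] [InnerProductSpace ℂ X]

lemma enorm_pow_apply_eq_of_eigenvector {B : X →L[ℂ] X} {x : X} {l : ℝ} (hl : 0 ≤ l)
    (h : B x = (((1 + l)⁻¹ : ℝ) : ℂ) • x) (T : X →L[ℂ] X) (L : ℕ) :
    ‖T ((B ^ L) x)‖ₑ = ENNReal.ofReal (((1 + l)⁻¹) ^ L) * ‖T x‖ₑ := by
  rw [pow_apply_eigenvector h, map_smul, enorm_smul, ← ofReal_norm ((((1 + l)⁻¹ : ℝ) : ℂ) ^ L),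
    norm_pow, Complex.norm_real, Real.norm_of_nonneg (by positivity)]

/-- Splitting off the (at most one-dimensional) kernel in sums over eigenfunctions. -/
lemma tsum_enorm_apply_pow_sq_le {B T : X →L[ℂ] X} {α γ C₁ c κ : ℝ} (hα : 0 < α) (hC₁ : 0 < C₁)
    (hc : 0 ≤ c) (hκ : 0 ≤ κ) {lam : ℕ → ℝ} {ψ : ℕ → X} (h0 : ∀ n, 0 ≤ lam n)
    (hg : ∀ n, lam n ≠ 0 → C₁ * ((n : ℝ) + 1) ^ (1 / α) ≤ lam n)
    (hB : ∀ n, B (ψ n) = (((1 + lam n)⁻¹ : ℝ) : ℂ) • ψ n)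
    (hz : ∀ m n, lam m = 0 → lam n = 0 → m = n) {L : ℕ} (hL : γ + α ≤ L) {δ : ℝ≥0∞}
    (ht : ∀ n, lam n ≠ 0 → ‖T (ψ n)‖ₑ ≤ δ * ENNReal.ofReal (c * (1 + lam n) ^ γ))
    (ht0 : ∀ n, lam n = 0 → ‖T (ψ n)‖ₑ ≤ δ * ENNReal.ofReal κ) :
    ∑' n, ‖T ((B ^ L) (ψ n))‖ₑ ^ 2 ≤
      δ ^ 2 * ENNReal.ofReal (c ^ 2 * growthConst α C₁ + κ ^ 2) := by
  have hs : ∀ n, ‖T ((B ^ L) (ψ n))‖ₑ ^ 2 = (if lam n = 0 then 0 else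
      (ENNReal.ofReal (((1 + lam n)⁻¹) ^ L) * ‖T (ψ n)‖ₑ) ^ 2) +
      if lam n = 0 then ‖T (ψ n)‖ₑ ^ 2 else 0 := fun n => by
    rw [enorm_pow_apply_eq_of_eigenvector (h0 n) (hB n)]
    split_ifs with hn
    · simp [hn]
    · rw [add_zero]
  simp_rw [hs]
  rw [ENNReal.tsum_add, ENNReal.ofReal_add (mul_nonneg (sq_nonneg c) (growthConst_nonneg hC₁))
    (sq_nonneg κ), mul_add]
  refine add_le_add (tsum_weighted_sq_le hα hC₁ hc h0 hg hL ht) ?_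
  refine tsum_ite_le_of_subsingleton hz fun n hn => ?_
  rw [ENNReal.ofReal_pow hκ, ← mul_pow]
  gcongr
  exact ht0 n hn

end Summation

/-! ### Zero modes of the form operators -/

section ConstantModes

variable {N : ℕ} {Ω : Set (Rn N)} {φ φ' : Rn N → Rn N} {bc : BoundaryCondition}
  {A : Rn N → Matrix (Fin N) (Fin N) ℝ}

/-- The constant function `1` in `L²(Ω, g dx)`. -/
noncomputable def constOne (Ω : Set (Rn N)) (φ : Rn N → Rn N)
    [IsFiniteMeasure (weightedMeasure Ω φ)] : L2 Ω φ :=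
  (memLp_const (1 : ℂ)).toLp

lemma constOne_ae_eq [IsFiniteMeasure (weightedMeasure Ω φ)] :
    constOne Ω φ =ᵐ[weightedMeasure Ω φ] fun _ => 1 :=
  (memLp_const (1 : ℂ)).coeFn_toLp

lemma eq_smul_constOne (h : IsTransformation Ω φ) (hΩ : IsOpen Ω)
    [IsFiniteMeasure (weightedMeasure Ω φ)] {ψ : L2 Ω φ} {c : ℂ}
    (hψ : ψ =ᵐ[volume.restrict Ω] fun _ => c) : ψ = c • constOne Ω φ := by
  refine Lp.ext ?_
  filter_upwards [(h.ae_weightedMeasure_iff hΩ).2 hψ, Lp.coeFn_smul c (constOne Ω φ),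
    constOne_ae_eq (Ω := Ω) (φ := φ)] with x h1 h2 h3
  rw [h1, h2, Pi.smul_apply, h3, smul_eq_mul, mul_one]

/-- Two zero modes would both be nonzero multiples of the constant function and could not be
orthogonal. -/
lemma FormSetting.eigenvalue_zero_unique (h : FormSetting A Ω φ φ') (hc : IsConnected Ω)
    (hN : 1 ≤ N) {lam : ℕ → ℝ} {ψ : ℕ → L2 Ω φ}
    (hs : IsEigenSystem (formOperator bc A Ω φ φ') lam ψ) (m n : ℕ) (hm : lam m = 0)
    (hn : lam n = 0) : m = n := by
  have := h.transf.isFiniteMeasure h.isOpen h.bounded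
  have key : ∀ k, lam k = 0 → ∃ c : ℂ, ψ k = c • constOne Ω φ := fun k hk => by
    have he := hs.eigen k
    rw [hk, Complex.ofReal_zero, zero_smul] at he
    obtain ⟨⟨c, hψ⟩, -⟩ := h.zero_mode hc hN he
    exact ⟨c, eq_smul_constOne h.transf h.isOpen hψ⟩
  obtain ⟨c, hc⟩ := key m hm
  obtain ⟨d, hd⟩ := key n hn
  by_contra hne
  have h1 : (inner ℂ (ψ m) (ψ n) : ℂ) = 0 := hs.orthonormal.2 hne
  have h2 := hs.orthonormal.1 m
  have h3 := hs.orthonormal.1 n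
  rw [hc, norm_smul] at h2
  rw [hd, norm_smul] at h3
  have h4 : constOne Ω φ ≠ 0 := fun h0 => by simp [h0] at h2
  have h5 : c ≠ 0 := fun h0 => by simp [h0] at h2
  have h6 : d ≠ 0 := fun h0 => by simp [h0] at h3
  rw [hc, hd, inner_smul_left, inner_smul_right] at h1
  simp [h4, h5, h6] at h1

lemma constOne_mem (h : FormSetting A Ω φ φ') [IsFiniteMeasure (weightedMeasure Ω φ)] :
    (constOne Ω φ, 0) ∈ formOperator BoundaryCondition.neumann A Ω φ φ' := by
  have e := (h.transf.ae_weightedMeasure_iff h.isOpen).1 (constOne_ae_eq (Ω := Ω) (φ := φ)).symm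
  refine (mem_formOperator_iff h.transf h.isOpen h.bounded).2
    ⟨(memSobolev_const h.bounded 1).congr e, _, (HasWeakGrad.const Ω 1).congr e (ae_eq_refl _),
      fun v V _ _ => ?_⟩
  simp [gradForm, sesq]

end ConstantModes

/-- The choice `β = c‖x‖/‖y‖` gives `β y` the length of `c x`, and `‖y‖x - ‖x‖y = (‖y‖-‖x‖)x +
‖x‖(x-y)`. The obvious choice `β = c` would put `‖x‖` in the denominator. In the application `x` is
the function `w⁻¹` and `y = 1`; the bound is to involve the norm of the latter only. -/
lemma exists_norm_sub_smul_le {X : Type*} [NormedAddCommGroup X] [InnerProductSpace ℂ X]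
    {x y : X} (hy : y ≠ 0) {c : ℂ} (hc : ‖c • x‖ = 1) :
    ∃ β : ℂ, ‖y‖ * ‖c • x - β • y‖ ≤ 2 * ‖x - y‖ := by
  have hy' : ‖y‖ ≠ 0 := norm_ne_zero_iff.2 hy
  refine ⟨c * ((‖x‖ / ‖y‖ : ℝ) : ℂ), ?_⟩
  have e : (‖y‖ : ℂ) • (c • x - (c * ((‖x‖ / ‖y‖ : ℝ) : ℂ)) • y) =
      c • (((‖y‖ - ‖x‖ : ℝ) : ℂ) • x + (‖x‖ : ℂ) • (x - y)) := by
    have h1 : (‖y‖ : ℂ) * ((‖x‖ / ‖y‖ : ℝ) : ℂ) = (‖x‖ : ℂ) := by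
      rw [← Complex.ofReal_mul, mul_div_cancel₀ _ hy']
    rw [smul_sub, smul_smul, smul_smul, mul_left_comm, h1]
    push_cast
    module
  have h2 := congrArg norm e
  rw [norm_smul, norm_smul, Complex.norm_real, norm_norm] at h2
  rw [h2]
  rw [norm_smul] at hc
  have h3 : ‖((‖y‖ - ‖x‖ : ℝ) : ℂ) • x + (‖x‖ : ℂ) • (x - y)‖ ≤ ‖x‖ * (2 * ‖x - y‖) := by
    refine (norm_add_le _ _).trans ?_
    rw [norm_smul, norm_smul, Complex.norm_real, Complex.norm_real, norm_norm, Real.norm_eq_abs]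
    have := abs_norm_sub_norm_le y x
    rw [norm_sub_rev] at this
    nlinarith [norm_nonneg x]
  calc _ ≤ ‖c‖ * (‖x‖ * (2 * ‖x - y‖)) := by gcongr
    _ = _ := by rw [← mul_assoc, hc, one_mul]

/-! ### The difference `R' - Q` on eigenfunctions -/

namespace WeightMaps

variable {N : ℕ} {Ω : Set (Rn N)} {φ φ' : Rn N → Rn N} {bc : BoundaryCondition}
  {A : Rn N → Matrix (Fin N) (Fin N) ℝ} {R : L2 Ω φ' →L[ℂ] L2 Ω φ'} {Q : L2 Ω φ →L[ℂ] L2 Ω φ}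

/-- The adjoint of `conj_sub`: all operators involved are self-adjoint, and now `Q` stands on the
right, ready to act on eigenfunctions of `T*ST`. -/
lemma conj_sub' (w : WeightMaps Ω φ φ') (h : FormSetting A Ω φ φ')
    (hR : IsResolvent (opH bc A Ω φ') R) (hRs : IsSelfAdjoint R)
    (hQ : IsResolvent (opTST bc A Ω φ φ') Q) (hQs : IsSelfAdjoint Q) :
    w.conj R - Q = -(w.conj R * w.a) + w.b * Q + w.conj R * (w.a - w.b) * Q := by
  have e := congrArg star (w.conj_sub h hR hQ)
  simpa only [star_sub, star_add, star_neg, star_mul, (w.isSelfAdjoint_conj hRs).star_eq,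
    hQs.star_eq, w.isSelfAdjoint_a.star_eq, w.isSelfAdjoint_b.star_eq, ← mul_assoc] using e

/-- On an eigenfunction both `conj_sub` and `conj_sub'` take this shape, with the images of the
eigenfunction under `w - 1` and `w⁻¹ - 1` in the roles of `z` and `ψ`. -/
lemma norm_perturbation_le {X : Type*} [NormedAddCommGroup X] [InnerProductSpace ℂ X] {ψ u v z : X}
    {l : ℝ} (hl : 0 ≤ l) {B : X →L[ℂ] X} (hB : ‖B‖ ≤ 1) (hu : ‖u‖ ≤ ‖z‖) (hv : ‖v‖ ≤ ‖ψ‖) :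
    ‖-u + v + B ((((1 + l)⁻¹ : ℝ) : ℂ) • (z - ψ))‖ ≤ 2 * (‖z‖ + ‖ψ‖) := by
  have h1 : ‖B ((((1 + l)⁻¹ : ℝ) : ℂ) • (z - ψ))‖ ≤ ‖z‖ + ‖ψ‖ := by
    refine (B.le_of_opNorm_le hB _).trans ?_
    rw [one_mul, norm_smul, Complex.norm_real, Real.norm_of_nonneg (by positivity)]
    exact (mul_le_of_le_one_left (norm_nonneg _) (inv_le_one_of_one_le₀ (by linarith))).trans
      (norm_sub_le _ _)
  have h2 := norm_add_le (-u + v) (B ((((1 + l)⁻¹ : ℝ) : ℂ) • (z - ψ)))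
  have h3 := norm_add_le (-u) v
  rw [norm_neg] at h3
  linarith

lemma norm_inv_smul_le {X : Type*} [NormedAddCommGroup X] [InnerProductSpace ℂ X] {l : ℝ}
    (hl : 0 ≤ l) (x : X) : ‖(((1 + l)⁻¹ : ℝ) : ℂ) • x‖ ≤ ‖x‖ := by
  rw [norm_smul, Complex.norm_real, Real.norm_of_nonneg (by positivity)]
  exact mul_le_of_le_one_left (norm_nonneg _) (inv_le_one_of_one_le₀ (by linarith))

lemma norm_conj_sub_apply_le (w : WeightMaps Ω φ φ') (h : FormSetting A Ω φ φ')
    (hR : IsResolvent (opH bc A Ω φ') R) (hQ : IsResolvent (opTST bc A Ω φ φ') Q)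
    (hQ1 : ‖Q‖ ≤ 1) {ψ : L2 Ω φ} {l : ℝ} (hl : 0 ≤ l)
    (hψ : w.conj R ψ = (((1 + l)⁻¹ : ℝ) : ℂ) • ψ) :
    ‖(w.conj R - Q) ψ‖ ≤ 2 * (‖w.a ψ‖ + ‖w.b ψ‖) := by
  rw [w.conj_sub h hR hQ]
  have e : (-(w.a * w.conj R) + Q * w.b + Q * (w.a - w.b) * w.conj R) ψ =
      -(w.a (w.conj R ψ)) + Q (w.b ψ) + Q ((w.a - w.b) (w.conj R ψ)) := rfl
  rw [e, hψ, map_smul, map_smul]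
  refine norm_perturbation_le hl hQ1 (norm_inv_smul_le hl _) ?_
  simpa using Q.le_of_opNorm_le hQ1 (w.b ψ)

lemma norm_conj_sub_apply_le' (w : WeightMaps Ω φ φ') (h : FormSetting A Ω φ φ')
    (hR : IsResolvent (opH bc A Ω φ') R) (hRs : IsSelfAdjoint R) (hR1 : ‖R‖ ≤ 1)
    (hQ : IsResolvent (opTST bc A Ω φ φ') Q) (hQs : IsSelfAdjoint Q) {ψ : L2 Ω φ} {l : ℝ}
    (hl : 0 ≤ l) (hψ : Q ψ = (((1 + l)⁻¹ : ℝ) : ℂ) • ψ) :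
    ‖(w.conj R - Q) ψ‖ ≤ 2 * (‖w.a ψ‖ + ‖w.b ψ‖) := by
  rw [w.conj_sub' h hR hRs hQ hQs]
  have e : (-(w.conj R * w.a) + w.b * Q + w.conj R * (w.a - w.b) * Q) ψ =
      -(w.conj R (w.a ψ)) + w.b (Q ψ) + w.conj R ((w.a - w.b) (Q ψ)) := rfl
  rw [e, hψ, map_smul, map_smul]
  refine norm_perturbation_le hl (w.norm_conj_le hR1) ?_ (norm_inv_smul_le hl _)
  simpa using (w.conj R).le_of_opNorm_le (w.norm_conj_le hR1) (w.a ψ)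

lemma enorm_le_delta1_mul (w : WeightMaps Ω φ φ') {p q : ℝ≥0∞} [ENNReal.HolderTriple p q 2]
    {T : L2 Ω φ →L[ℂ] L2 Ω φ} {ψ : L2 Ω φ} (hT : ‖T ψ‖ ≤ 2 * (‖w.a ψ‖ + ‖w.b ψ‖)) :
    ‖T ψ‖ₑ ≤ 2 * (delta1 Ω φ φ' p * eLpNorm ψ q (weightedMeasure Ω φ)) := by
  have h1 := ENNReal.ofReal_le_ofReal hT
  rw [ENNReal.ofReal_mul zero_le_two, ENNReal.ofReal_add (norm_nonneg _) (norm_nonneg _),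
    ofReal_norm, ofReal_norm, ofReal_norm, ENNReal.ofReal_ofNat] at h1
  refine h1.trans ?_
  rw [delta1, add_mul]
  gcongr
  · exact enorm_mul_apply_le ((measurable_weight φ φ').sub_const 1).aestronglyMeasurable w.a_apply
      p q ψ
  · exact enorm_mul_apply_le ((measurable_weight φ φ').inv.sub_const 1).aestronglyMeasurable
      w.b_apply p q ψ

/-- The zero mode of `w⁻¹ H̃ w` for Neumann conditions. -/
lemma enorm_pow_sub_pow_zero_mode_le (w : WeightMaps Ω φ φ') (h : FormSetting A Ω φ φ')
    (hc : IsConnected Ω) (hN : 1 ≤ N) (hR : IsResolvent (opH bc A Ω φ') R)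
    (hQ : IsResolvent (opTST bc A Ω φ φ') Q) (hQ1 : ‖Q‖ ≤ 1) {p q : ℝ≥0∞}
    [ENNReal.HolderTriple p q 2] {κ : ℝ}
    (hκ : bc = BoundaryCondition.neumann → eLpNorm (fun _ => (1 : ℂ)) q (weightedMeasure Ω φ) ≤
      ENNReal.ofReal κ * eLpNorm (fun _ => (1 : ℂ)) 2 (weightedMeasure Ω φ))
    {ψ : L2 Ω φ} (hψ1 : ‖ψ‖ = 1) (hψ : (ψ, 0) ∈ opConj bc A Ω φ φ') (k : ℕ) :
    ‖(w.conj R ^ k - Q ^ k) ψ‖ₑ ≤ delta1 Ω φ φ' p * ENNReal.ofReal (4 * κ) := by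
  have := h.transf.isFiniteMeasure h.isOpen h.bounded
  have h' : FormSetting A Ω φ' φ' := ⟨h.isOpen, h.bounded, h.coeff, h.transf', h.transf'⟩
  have hW := (w.mem_opConj_iff h.transf' h.isOpen).1 hψ
  simp only [map_zero] at hW
  obtain ⟨⟨c, hcψ⟩, hd⟩ := h'.zero_mode hc hN hW
  have hψ0 : ψ ≠ 0 := fun h0 => by simp [h0] at hψ1
  cases bc with
  | dirichlet => exact absurd ((map_eq_zero_iff _ w.W.injective).1 (hd rfl)) hψ0
  | neumann =>
    set e := constOne Ω φ with he
    -- The zero mode of `H̃` is the constant `wψ = c`, so `ψ = c w⁻¹`, and `e + b e` is `w⁻¹`.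
    have hψe : ψ = c • (e + w.b e) := by
      apply w.W.injective
      refine Lp.ext ((h.transf'.ae_weightedMeasure_iff h.isOpen).2 ?_)
      rw [map_smul]
      filter_upwards [hcψ, w.W_add_b_ae_eq h.transf h.transf' h.isOpen e,
        (h.transf.ae_weightedMeasure_iff h.isOpen).1 (constOne_ae_eq (Ω := Ω) (φ := φ)),
        (h.transf'.ae_weightedMeasure_iff h.isOpen).1 (Lp.coeFn_smul c (w.W (e + w.b e)))]
        with x h1 h2 h3 h4
      rw [h1, h4, Pi.smul_apply, h2, h3, smul_eq_mul, mul_one]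
    have he0 : e ≠ 0 := fun h0 => hψ0 (by rw [hψe, h0]; simp)
    obtain ⟨β, hβ⟩ := exists_norm_sub_smul_le he0 (hψe ▸ hψ1)
    rw [← hψe, add_sub_cancel_left] at hβ
    have hRψ : w.conj R ψ = (1 : ℂ) • ψ := by
      have := (w.isResolvent_conj h.transf' h.isOpen hR).2 _ hψ
      rw [one_smul]; simpa using this
    have hQe : Q e = (1 : ℂ) • e := by
      have := hQ.2 _ (constOne_mem h)
      rw [one_smul]; simpa using this
    -- Both powers fix their zero modes, `R'ψ = ψ` and `Qe = e`, so only the deviation of `ψ` from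
    -- the constants matters. Thus only `(w⁻¹ - 1) · 1` has to be estimated, not `w⁻¹` in `L^{q₀}`.
    have e1 : (w.conj R ^ k - Q ^ k) ψ = (ψ - β • e) - (Q ^ k) (ψ - β • e) := by
      rw [map_sub, map_smul, pow_apply_eigenvector hQe, one_pow, one_smul]
      change (w.conj R ^ k) ψ - (Q ^ k) ψ = _
      rw [pow_apply_eigenvector hRψ, one_pow, one_smul]
      abel
    have e2 : ‖(w.conj R ^ k - Q ^ k) ψ‖ₑ ≤ 2 * ‖ψ - β • e‖ₑ := by
      rw [e1, two_mul]
      exact enorm_sub_le.trans (add_le_add_right (enorm_pow_apply_le hQ1 k _) _)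
    have e3 : ‖e‖ₑ = eLpNorm (fun _ => (1 : ℂ)) 2 (weightedMeasure Ω φ) := by
      rw [Lp.enorm_def, eLpNorm_congr_ae constOne_ae_eq]
    have e4 : ‖w.b e‖ₑ ≤ delta1 Ω φ φ' p * (ENNReal.ofReal κ * ‖e‖ₑ) := by
      refine (enorm_mul_apply_le ((measurable_weight φ φ').inv.sub_const 1).aestronglyMeasurable
        w.b_apply p q e).trans ?_
      rw [eLpNorm_congr_ae (f := e) constOne_ae_eq, e3]
      exact mul_le_mul' le_add_self (hκ rfl)
    have e5 : ‖e‖ₑ * ‖ψ - β • e‖ₑ ≤ ‖e‖ₑ * (2 * (delta1 Ω φ φ' p * ENNReal.ofReal κ)) := by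
      have := ENNReal.ofReal_le_ofReal hβ
      rw [ENNReal.ofReal_mul (norm_nonneg _), ENNReal.ofReal_mul zero_le_two, ofReal_norm,
        ofReal_norm, ofReal_norm, ENNReal.ofReal_ofNat] at this
      refine this.trans ((mul_le_mul_right e4 2).trans (le_of_eq (by ring)))
    -- The norm of `e` produced by Hölder cancels against that from `exists_norm_sub_smul_le`,
    -- leaving only `κ`.
    have e6 := (ENNReal.mul_le_mul_iff_right (enorm_ne_zero.2 he0) enorm_ne_top).1 e5
    refine e2.trans ((mul_le_mul_right e6 2).trans (le_of_eq ?_))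
    rw [ENNReal.ofReal_mul (by norm_num), ENNReal.ofReal_ofNat]
    ring

end WeightMaps

/-! ### Hilbert–Schmidt estimates for the powers of the resolvents -/

section Powers

variable {N : ℕ} {Ω : Set (Rn N)} {φ φ' χ : Rn N → Rn N} {bc : BoundaryCondition}
  {A : Rn N → Matrix (Fin N) (Fin N) ℝ}

/-- Replaces (P1) at the eigenvalue zero: the mode is a constant of unit `L²` norm, and `hκ`
compares the two norms of the constant function. -/
lemma FormSetting.eLpNorm_zero_mode_le (h : FormSetting A Ω φ χ) (hc : IsConnected Ω) (hN : 1 ≤ N)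
    {q : ℝ≥0∞} {κ : ℝ}
    (hκ : bc = BoundaryCondition.neumann → eLpNorm (fun _ => (1 : ℂ)) q (weightedMeasure Ω φ) ≤
      ENNReal.ofReal κ * eLpNorm (fun _ => (1 : ℂ)) 2 (weightedMeasure Ω φ))
    {ψ : L2 Ω φ} (hψ1 : ‖ψ‖ = 1) (hψ : (ψ, 0) ∈ formOperator bc A Ω φ χ) :
    eLpNorm ψ q (weightedMeasure Ω φ) ≤ ENNReal.ofReal κ := by
  obtain ⟨⟨c, hcψ⟩, hd⟩ := h.zero_mode hc hN hψ
  cases bc with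
  | dirichlet => rw [hd rfl, norm_zero] at hψ1; exact absurd hψ1 zero_ne_one
  | neumann =>
    have e : ∀ r : ℝ≥0∞, eLpNorm ψ r (weightedMeasure Ω φ) =
        ‖c‖ₑ * eLpNorm (fun _ => (1 : ℂ)) r (weightedMeasure Ω φ) := fun r => by
      rw [eLpNorm_congr_ae ((h.transf.ae_weightedMeasure_iff h.isOpen).2 hcψ),
        ← eLpNorm_const_smul]
      simp [Pi.smul_def]
    have h1 : ‖ψ‖ₑ = 1 := by rw [← ofReal_norm, hψ1, ENNReal.ofReal_one]
    rw [Lp.enorm_def, e] at h1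
    calc eLpNorm ψ q (weightedMeasure Ω φ) ≤ ‖c‖ₑ * (ENNReal.ofReal κ *
          eLpNorm (fun _ => (1 : ℂ)) 2 (weightedMeasure Ω φ)) := by
          rw [e]; gcongr; exact hκ rfl
      _ = ENNReal.ofReal κ := by rw [mul_left_comm, h1, mul_one]

/-- The factor `1 + l` gained from the resolvents outweighs the half power lost to the gradient in
(P2): `l^(1/2+γ) ≤ (1+l)(1+l)^γ`. -/
lemma enorm_le_of_ofReal_mul_le {x n δ : ℝ≥0∞} {C l γ : ℝ} (hC : 0 < C)
    (hl : 0 ≤ l) (hn : n ≤ δ)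
    (h : ENNReal.ofReal (1 + l) * x ≤ n * ENNReal.ofReal (C * l ^ (1 / 2 + γ))) (hγ : 0 < γ) :
    x ≤ δ * ENNReal.ofReal (C * (1 + l) ^ γ) := by
  have h1 : C * l ^ (1 / 2 + γ) ≤ (1 + l) * (C * (1 + l) ^ γ) := by
    have : l ^ (1 / 2 + γ) ≤ (1 + l) ^ (1 + γ) :=
      (Real.rpow_le_rpow hl (by linarith) (by linarith)).trans
        (Real.rpow_le_rpow_of_exponent_le (by linarith) (by linarith))
    rw [Real.rpow_add (x := 1 + l) (by linarith), Real.rpow_one] at this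
    rw [mul_left_comm]
    exact mul_le_mul_of_nonneg_left this hC.le
  have h2 : 0 < 1 + l := by linarith
  refine (ENNReal.mul_le_mul_iff_right (ENNReal.ofReal_pos.2 h2).ne' ENNReal.ofReal_ne_top).1
    (h.trans ?_)
  calc _ ≤ δ * ENNReal.ofReal ((1 + l) * (C * (1 + l) ^ γ)) := by gcongr
    _ = _ := by rw [ENNReal.ofReal_mul h2.le, mul_left_comm]

lemma IsEigenSystem.isCompleteOrthonormal {X : Type*} [NormedAddCommGroup X]
    [InnerProductSpace ℂ X] {E : OpGraph X} {lam : ℕ → ℝ} {ψ : ℕ → X}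
    (h : IsEigenSystem E lam ψ) : IsCompleteOrthonormal ψ :=
  ⟨h.orthonormal, h.complete⟩

lemma FormSetting.eigenSystem_nonneg (h : FormSetting A Ω φ χ) {lam : ℕ → ℝ} {ψ : ℕ → L2 Ω φ}
    (hs : IsEigenSystem (formOperator bc A Ω φ χ) lam ψ) (n : ℕ) : 0 ≤ lam n :=
  h.eigenvalue_nonneg (hs.orthonormal.ne_zero n) (hs.eigen n)

variable {α γ C₁ C₂ : ℝ} {q₀ p : ℝ≥0∞}

/-- Comparison of the powers of the resolvents of `T*ST` and `H`. -/
lemma tsum_resolvent_pow_sub_pow_sq_le [ENNReal.HolderTriple p q₀ 2] (h : FormSetting A Ω φ φ')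
    (hc : IsConnected Ω) (hN : 1 ≤ N) (hα : 0 < α) (hγ : 0 < γ) (hC₁ : 0 < C₁) (hC₂ : 0 < C₂)
    {R Q : L2 Ω φ →L[ℂ] L2 Ω φ} (hR : IsResolvent (opH bc A Ω φ) R)
    (hQ : IsResolvent (opTST bc A Ω φ φ') Q) (hgH : EigenvalueGrowth (opH bc A Ω φ) α C₁)
    (hgT : EigenvalueGrowth (opTST bc A Ω φ φ') α C₁) (h2H : PropP2 (opH bc A Ω φ) q₀ γ C₂)
    (h2T : PropP2 (opTST bc A Ω φ φ') q₀ γ C₂) {L k : ℕ} (hL : γ + α ≤ L) (hk : 2 * L + 1 ≤ k)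
    {ψ : ℕ → L2 Ω φ} (hψ : IsCompleteOrthonormal ψ) :
    ∑' n, ‖(Q ^ k - R ^ k) (ψ n)‖ₑ ^ 2 ≤ (k * k + 1) * (delta A Ω φ φ' p ^ 2 *
      ENNReal.ofReal (C₂ ^ 2 * growthConst α C₁)) := by
  have hH : FormSetting A Ω φ φ := ⟨h.isOpen, h.bounded, h.coeff, h.transf, h.transf⟩
  have hRs := hH.isSelfAdjoint_resolvent hR
  have hQs := h.isSelfAdjoint_resolvent hQ
  obtain ⟨lH, ψH, hsH, hbH⟩ := h2H
  obtain ⟨lT, ψT, hsT, hbT⟩ := h2T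
  have hlH := hH.eigenSystem_nonneg hsH
  have hlT := h.eigenSystem_nonneg hsT
  have tH : ∀ n, ‖(Q - R) (ψH n)‖ₑ ≤ delta A Ω φ φ' p *
      ENNReal.ofReal (C₂ * (1 + lH n) ^ γ) ∧ (lH n = 0 → ‖(Q - R) (ψH n)‖ₑ = 0) := fun n => by
    obtain ⟨Ψ, hΨ, hle⟩ := hbH n
    have key := (enorm_resolvent_sub_eigenvector_le hH h h.aestronglyMeasurable_delta2_left
      h.ae_form_sub_le_left (p := p) (q := q₀) hR hQ (hlH n) (hsH.eigen n) hΨ).trans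
      (mul_le_mul_right hle _)
    refine ⟨enorm_le_of_ofReal_mul_le hC₂ (hlH n) ?_ key hγ, fun h0 => ?_⟩
    · exact le_self_add.trans le_add_self
    -- At eigenvalue zero (P2) forces the gradient to vanish, so `Q - R` annihilates the mode and no
    -- extra contribution arises.
    · rw [h0, Real.zero_rpow (by positivity)] at key
      simpa using key
  have tT : ∀ n, ‖(Q - R) (ψT n)‖ₑ ≤ delta A Ω φ φ' p *
      ENNReal.ofReal (C₂ * (1 + lT n) ^ γ) ∧ (lT n = 0 → ‖(Q - R) (ψT n)‖ₑ = 0) := fun n => by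
    obtain ⟨Ψ, hΨ, hle⟩ := hbT n
    have key := (enorm_resolvent_sub_eigenvector_le h hH h.aestronglyMeasurable_delta2_right
      h.ae_form_sub_le_right (p := p) (q := q₀) hQ hR (hlT n) (hsT.eigen n) hΨ).trans
      (mul_le_mul_right hle _)
    have e : ‖(Q - R) (ψT n)‖ₑ = ‖(R - Q) (ψT n)‖ₑ := by
      rw [← neg_sub R Q, neg_apply, enorm_neg]
    rw [e]
    refine ⟨enorm_le_of_ofReal_mul_le hC₂ (hlT n) ?_ key hγ, fun h0 => ?_⟩
    · exact le_add_self.trans le_add_self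
    · rw [h0, Real.zero_rpow (by positivity)] at key
      simpa using key
  have sH := tsum_enorm_apply_pow_sq_le (T := Q - R) hα hC₁ hC₂.le le_rfl hlH (hgH _ _ hsH)
    (fun n => hR.apply_eigenvector (hlH n) (hsH.eigen n))
    (hH.eigenvalue_zero_unique hc hN hsH) hL (fun n _ => (tH n).1)
    (fun n h0 => by rw [(tH n).2 h0]; exact zero_le)
  have sT := tsum_enorm_apply_pow_sq_le (T := Q - R) hα hC₁ hC₂.le le_rfl hlT (hgT _ _ hsT)
    (fun n => hQ.apply_eigenvector (hlT n) (hsT.eigen n))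
    (h.eigenvalue_zero_unique hc hN hsT) hL (fun n _ => (tT n).1)
    (fun n h0 => by rw [(tT n).2 h0]; exact zero_le)
  rw [zero_pow two_ne_zero, add_zero] at sH sT
  -- `Q^k - R^k` is self-adjoint and its Hilbert–Schmidt sum is the same in every orthonormal basis,
  -- so the given basis may be replaced by the eigenbasis of `T*ST` supplied by (P2).
  rw [tsum_enorm_apply_sq_eq_adjoint hψ hsT.isCompleteOrthonormal,
    ((hQs.pow k).sub (hRs.pow k)).adjoint_eq]
  classical
  refine tsum_enorm_pow_sub_pow_sq_le hQs hRs (h.norm_resolvent_le hQ) (hH.norm_resolvent_le hR)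
    hsT.isCompleteOrthonormal hsH.isCompleteOrthonormal
    (fun n => hQ.apply_eigenvector (hlT n) (hsT.eigen n))
    (fun n => hR.apply_eigenvector (hlH n) (hsH.eigen n)) ∅ hk sH ?_ ?_
  · simpa using sT
  · simp

/-- Comparison of the powers of the resolvents of `w⁻¹ H̃ w` and `T*ST`. -/
lemma WeightMaps.tsum_conj_pow_sub_pow_sq_le (w : WeightMaps Ω φ φ') [ENNReal.HolderTriple p q₀ 2]
    (h : FormSetting A Ω φ φ')
    (hc : IsConnected Ω) (hN : 1 ≤ N) (hα : 0 < α) (hγ : 0 < γ) (hC₁ : 0 < C₁) (hC₂ : 0 < C₂)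
    {κ : ℝ} (hκ0 : 0 ≤ κ)
    (hκ : bc = BoundaryCondition.neumann → eLpNorm (fun _ => (1 : ℂ)) q₀ (weightedMeasure Ω φ) ≤
      ENNReal.ofReal κ * eLpNorm (fun _ => (1 : ℂ)) 2 (weightedMeasure Ω φ))
    {R : L2 Ω φ' →L[ℂ] L2 Ω φ'} {Q : L2 Ω φ →L[ℂ] L2 Ω φ} (hR : IsResolvent (opH bc A Ω φ') R)
    (hQ : IsResolvent (opTST bc A Ω φ φ') Q) (hgH : EigenvalueGrowth (opH bc A Ω φ') α C₁)
    (hgT : EigenvalueGrowth (opTST bc A Ω φ φ') α C₁)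
    (hT : PropP1 (opTST bc A Ω φ φ') q₀ γ C₂) {lC : ℕ → ℝ} {ψC : ℕ → L2 Ω φ}
    (hsC : IsEigenSystem (opConj bc A Ω φ φ') lC ψC) (hbC : ∀ n, lC n ≠ 0 →
      eLpNorm (ψC n) q₀ (weightedMeasure Ω φ) ≤ ENNReal.ofReal (C₂ * lC n ^ γ))
    {L k : ℕ} (hL : γ + α ≤ L) (hk : 2 * L + 1 ≤ k) :
    ∑' n, ‖(w.conj R ^ k - Q ^ k) (ψC n)‖ₑ ^ 2 ≤ (k * k + 1) * (delta A Ω φ φ' p ^ 2 *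
      ENNReal.ofReal ((2 * C₂) ^ 2 * growthConst α C₁ + (4 * κ) ^ 2)) := by
  have hH : FormSetting A Ω φ' φ' := ⟨h.isOpen, h.bounded, h.coeff, h.transf', h.transf'⟩
  have hRs := hH.isSelfAdjoint_resolvent hR
  have hR1 := hH.norm_resolvent_le hR
  have hQs := h.isSelfAdjoint_resolvent hQ
  have hQ1 := h.norm_resolvent_le hQ
  have hR' := w.isResolvent_conj h.transf' h.isOpen hR
  -- Unitary equivalence transfers the eigensystem to `H̃` with the same eigenvalues; this is how
  -- their growth, non-negativity and the simplicity of zero become available for `w⁻¹H̃w`.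
  have hsW := w.isEigenSystem_map h.transf' h.isOpen hsC
  obtain ⟨lT, ψT, hsT, hbT⟩ := hT
  have hlC : ∀ n, 0 ≤ lC n := hH.eigenSystem_nonneg hsW
  have hlT := h.eigenSystem_nonneg hsT
  have hδ : delta1 Ω φ φ' p ≤ delta A Ω φ φ' p := le_self_add
  have hrp : ∀ {l : ℝ} {x : ℝ≥0∞}, 0 ≤ l → x ≤ ENNReal.ofReal (C₂ * l ^ γ) →
      2 * (delta1 Ω φ φ' p * x) ≤
        delta A Ω φ φ' p * ENNReal.ofReal (2 * C₂ * (1 + l) ^ γ) := fun {l x} hl hx => by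
    calc 2 * (delta1 Ω φ φ' p * x) ≤ 2 * (delta A Ω φ φ' p * ENNReal.ofReal (C₂ * (1 + l) ^ γ)) := by
          gcongr
          refine hx.trans (ENNReal.ofReal_le_ofReal ?_)
          gcongr
          linarith
      _ = _ := by
          rw [mul_assoc 2 C₂, ENNReal.ofReal_mul zero_le_two, ENNReal.ofReal_ofNat]; ring
  have tC : ∀ n, lC n ≠ 0 → ‖(w.conj R - Q) (ψC n)‖ₑ ≤ delta A Ω φ φ' p *
      ENNReal.ofReal (2 * C₂ * (1 + lC n) ^ γ) := fun n hn =>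
    (w.enorm_le_delta1_mul (p := p) (q := q₀) (w.norm_conj_sub_apply_le h hR hQ hQ1 (hlC n)
      (hR'.apply_eigenvector (hlC n) (hsC.eigen n)))).trans (hrp (hlC n) (hbC n hn))
  have tT' : ∀ n, ‖(w.conj R - Q) (ψT n)‖ₑ ≤
      2 * (delta1 Ω φ φ' p * eLpNorm (ψT n) q₀ (weightedMeasure Ω φ)) := fun n =>
    w.enorm_le_delta1_mul (w.norm_conj_sub_apply_le' h hR hRs hR1 hQ hQs (hlT n)
      (hQ.apply_eigenvector (hlT n) (hsT.eigen n)))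
  have zT : ∀ n, lT n = 0 → ‖(w.conj R - Q) (ψT n)‖ₑ ≤ delta A Ω φ φ' p *
      ENNReal.ofReal (4 * κ) := fun n hn => by
    have he := hsT.eigen n
    rw [hn, Complex.ofReal_zero, zero_smul] at he
    calc _ ≤ 2 * (delta1 Ω φ φ' p * eLpNorm (ψT n) q₀ (weightedMeasure Ω φ)) := tT' n
      _ ≤ 2 * (delta A Ω φ φ' p * ENNReal.ofReal κ) := by
          gcongr
          exact h.eLpNorm_zero_mode_le hc hN hκ (hsT.orthonormal.1 n) he
      _ = delta A Ω φ φ' p * ENNReal.ofReal (2 * κ) := by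
          rw [ENNReal.ofReal_mul zero_le_two, ENNReal.ofReal_ofNat]; ring
      _ ≤ _ := by gcongr; norm_num
  have sT := tsum_enorm_apply_pow_sq_le (T := w.conj R - Q) hα hC₁ (by positivity)
    (mul_nonneg zero_le_four hκ0) hlT (hgT _ _ hsT)
    (fun n => hQ.apply_eigenvector (hlT n) (hsT.eigen n))
    (h.eigenvalue_zero_unique hc hN hsT) hL (fun n hn => (tT' n).trans (hrp (hlT n) (hbT n hn))) zT
  have sC := tsum_weighted_sq_le (L := L) (c := 2 * C₂) hα hC₁ (by positivity) hlC (hgH _ _ hsW) hL tC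
  classical
  -- The exceptional set holds the zero mode of `w⁻¹H̃w`, where (P1) gives no bound; it contains at
  -- most one index, and the difference of powers is estimated there directly.
  refine tsum_enorm_pow_sub_pow_sq_le (w.isSelfAdjoint_conj hRs) hQs (w.norm_conj_le hR1) hQ1
    hsC.isCompleteOrthonormal hsT.isCompleteOrthonormal
    (fun n => hR'.apply_eigenvector (hlC n) (hsC.eigen n))
    (fun n => hQ.apply_eigenvector (hlT n) (hsT.eigen n)) {n | lC n = 0} hk sT ?_ ?_
  · refine le_trans (ENNReal.tsum_le_tsum fun n => ?_) (sC.trans ?_)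
    · simp only [mem_ofPred_eq]
      rw [enorm_pow_apply_eq_of_eigenvector (hlC n)
        (hR'.apply_eigenvector (hlC n) (hsC.eigen n))]
    · gcongr
      exact le_add_of_nonneg_right (sq_nonneg _)
  · refine tsum_ite_le_of_subsingleton (hH.eigenvalue_zero_unique hc hN hsW) fun n hn => ?_
    have he := hsC.eigen n
    rw [show lC n = 0 from hn, Complex.ofReal_zero, zero_smul] at he
    calc _ ≤ (delta A Ω φ φ' p * ENNReal.ofReal (4 * κ)) ^ 2 := by
          gcongr
          exact (w.enorm_pow_sub_pow_zero_mode_le h hc hN hR hQ hQ1 hκ (hsC.orthonormal.1 n) he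
            k).trans (mul_le_mul_left hδ _)
      _ ≤ _ := by
          rw [mul_pow, ← ENNReal.ofReal_pow (mul_nonneg zero_le_four hκ0)]
          gcongr
          exact le_add_of_nonneg_left (mul_nonneg (sq_nonneg _) (growthConst_nonneg hC₁))

lemma hsNorm_sub_le_of_tsum_le {X : Type*} [NormedAddCommGroup X] [InnerProductSpace ℂ X]
    [CompleteSpace X] {ψ : ℕ → X} (hψ : IsCompleteOrthonormal ψ) {B C D : X →L[ℂ] X} {δ : ℝ≥0∞}
    {a b K : ℝ} (ha : 0 ≤ a) (hb : 0 ≤ b) (hK : 0 ≤ K)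
    (h1 : ∑' n, ‖(B - C) (ψ n)‖ₑ ^ 2 ≤ ENNReal.ofReal K * (δ ^ 2 * ENNReal.ofReal a))
    (h2 : ∑' n, ‖(C - D) (ψ n)‖ₑ ^ 2 ≤ ENNReal.ofReal K * (δ ^ 2 * ENNReal.ofReal b)) :
    hsNorm (B - D) ≤ ENNReal.ofReal √(2 * K * (a + b)) * δ := by
  refine (hsNorm_le_of_isCompleteOrthonormal hψ _).trans ?_
  have h3 : ∑' n, ‖(B - D) (ψ n)‖ₑ ^ 2 ≤ δ ^ 2 * ENNReal.ofReal (2 * K * (a + b)) := by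
    calc ∑' n, ‖(B - D) (ψ n)‖ₑ ^ 2
        ≤ ∑' n, 2 * (‖(B - C) (ψ n)‖ₑ ^ 2 + ‖(C - D) (ψ n)‖ₑ ^ 2) := by
          refine ENNReal.tsum_le_tsum fun n => ?_
          have e : (B - D) (ψ n) = ∑ i : Fin 2, ![(B - C) (ψ n), (C - D) (ψ n)] i := by
            rw [Fin.sum_univ_two]
            simp
          have := enorm_sum_sq_le Finset.univ ![(B - C) (ψ n), (C - D) (ψ n)]
          rw [← e, Fin.sum_univ_two] at this
          simpa using this
      _ = 2 * (∑' n, ‖(B - C) (ψ n)‖ₑ ^ 2 + ∑' n, ‖(C - D) (ψ n)‖ₑ ^ 2) := by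
          rw [ENNReal.tsum_mul_left, ENNReal.tsum_add]
      _ ≤ 2 * (ENNReal.ofReal K * (δ ^ 2 * ENNReal.ofReal a) +
            ENNReal.ofReal K * (δ ^ 2 * ENNReal.ofReal b)) := by gcongr
      _ = _ := by
          rw [ENNReal.ofReal_mul (by positivity), ENNReal.ofReal_mul zero_le_two,
            ENNReal.ofReal_add ha hb, ENNReal.ofReal_ofNat]
          ring
  calc _ ≤ (δ ^ 2 * ENNReal.ofReal (2 * K * (a + b))) ^ (1 / 2 : ℝ) := by gcongr
    _ = _ := by
      rw [ENNReal.mul_rpow_of_nonneg _ _ (by norm_num), ENNReal.ofReal_rpow_of_nonneg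
        (by positivity) (by norm_num), ← Real.sqrt_eq_rpow, ← ENNReal.rpow_two, ← ENNReal.rpow_mul,
        mul_comm]
      norm_num

end Powers

end ResolventStability

theorem theorem3p1 (α γ : ℝ) (hα : 0 < α) (hγ : 0 < γ) :
    ∃ K : ℕ, ∀ k : ℕ, K ≤ k →
      ∀ (s C₁ C₂ : ℝ), 0 < C₁ → 0 < C₂ → ∀ (bc : BoundaryCondition) (M m : ℝ), 0 < m →
      ∃ c : ℝ, 0 < c ∧
        ∀ (q₀ : ℝ≥0∞), 2 < q₀ → exponentFactor q₀ * (α + 2 * γ) < s →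
        ∀ (N : ℕ), 1 ≤ N →
        ∀ (Ω : Set (Rn N)), IsOpen Ω → IsConnected Ω → Bornology.IsBounded Ω →
        ∀ (A : Rn N → Matrix (Fin N) (Fin N) ℝ), IsEllipticCoefficient A →
        ∀ (φ φ' : Rn N → Rn N), IsTransformation Ω φ → IsTransformation Ω φ' →
        -- in the Neumann case `c` may depend on `‖g‖_{L^{q₀}(Ω)}` and on `|φ(Ω)|`
        (bc = BoundaryCondition.neumann →
          eLpNorm (density φ) q₀ (volume.restrict Ω) ≤ ENNReal.ofReal M ∧
          ENNReal.ofReal m ≤ volume (φ '' Ω)) →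
        HasCompactResolvent (opH bc A Ω φ) → EigenvalueGrowth (opH bc A Ω φ) α C₁ →
        HasCompactResolvent (opH bc A Ω φ') → EigenvalueGrowth (opH bc A Ω φ') α C₁ →
        HasCompactResolvent (opTST bc A Ω φ φ') → EigenvalueGrowth (opTST bc A Ω φ φ') α C₁ →
        PropP1 (opH bc A Ω φ) q₀ γ C₂ → PropP2 (opH bc A Ω φ) q₀ γ C₂ →
        PropP1 (opTST bc A Ω φ φ') q₀ γ C₂ → PropP2 (opTST bc A Ω φ φ') q₀ γ C₂ →
        PropP1 (opConj bc A Ω φ φ') q₀ γ C₂ →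
        ∃ R R' : L2 Ω φ →L[ℂ] L2 Ω φ,
          IsResolvent (opH bc A Ω φ) R ∧ IsResolvent (opConj bc A Ω φ φ') R' ∧
          hsNorm (R' ^ k - R ^ k) ≤
            ENNReal.ofReal c * (1 + delta A Ω φ φ' (ENNReal.ofReal s)) *
              delta A Ω φ φ' (ENNReal.ofReal (2 * exponentFactor q₀)) := by
  -- This is `2L + 1` with `L = ⌈γ + α⌉`: of `k - 1` resolvent factors, at least `L` fall on one
  -- side of the difference.
  refine ⟨2 * ⌈γ + α⌉₊ + 1, fun k hk s C₁ C₂ hC₁ hC₂ bc M m hm => ?_⟩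
  set κ : ℝ := 1 + (√m)⁻¹ with hκ
  have hκ0 : 0 ≤ κ := by positivity
  have hG := growthConst_nonneg (α := α) hC₁
  set a : ℝ := (2 * C₂) ^ 2 * growthConst α C₁ + (4 * κ) ^ 2 with ha
  set b : ℝ := C₂ ^ 2 * growthConst α C₁ with hb
  -- `k * k + 1` comes from telescoping and the exceptional modes, the `2` from joining the two
  -- comparisons. `a` belongs to `R'^k - Q^k` and contains the Neumann zero modes through `κ`; `b`
  -- belongs to `Q^k - R^k`.
  refine ⟨√(2 * (k * k + 1) * (a + b)) + 1, by positivity, ?_⟩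
  intro q₀ hq₀ _ N hN Ω hΩ hc hbd A hA φ φ' hφ hφ' hNeu hcH hgH hcH' hgH' hcT hgT _ h2H h1T h2T h1C
  have h : FormSetting A Ω φ φ' := ⟨hΩ, hbd, hA, hφ, hφ'⟩
  have := holderTriple_exponentFactor hq₀
  obtain ⟨R, hR, -⟩ := hcH
  obtain ⟨R₁, hR₁, -⟩ := hcH'
  obtain ⟨Q, hQ, -⟩ := hcT
  obtain ⟨w⟩ := nonempty_weightMaps hφ hφ' hΩ
  obtain ⟨lC, ψC, hsC, hbC⟩ := h1C
  have hL : γ + α ≤ (⌈γ + α⌉₊ : ℝ) := Nat.le_ceil _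
  have hmeas : bc = BoundaryCondition.neumann →
      eLpNorm (fun _ => (1 : ℂ)) q₀ (weightedMeasure Ω φ) ≤
        ENNReal.ofReal κ * eLpNorm (fun _ => (1 : ℂ)) 2 (weightedMeasure Ω φ) := fun hbc =>
    eLpNorm_one_le_of_le_measure hq₀.le hm
      ((hNeu hbc).2.trans (hφ.volume_image_le_weightedMeasure hΩ))
  have e : ((k : ℝ≥0∞) * k + 1) = ENNReal.ofReal (k * k + 1) := by
    rw [ENNReal.ofReal_add (by positivity) zero_le_one, ENNReal.ofReal_mul (by positivity)]
    simp
  have s1 := w.tsum_conj_pow_sub_pow_sq_le (p := ENNReal.ofReal (2 * exponentFactor q₀)) h hc hN hα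
    hγ hC₁ hC₂ hκ0 hmeas hR₁ hQ hgH' hgT h1T hsC hbC hL hk
  have s2 := tsum_resolvent_pow_sub_pow_sq_le (p := ENNReal.ofReal (2 * exponentFactor q₀)) h hc hN hα
    hγ hC₁ hC₂ hR hQ hgH hgT h2H h2T hL hk hsC.isCompleteOrthonormal
  rw [e] at s1 s2
  refine ⟨R, w.conj R₁, hR, w.isResolvent_conj hφ' hΩ hR₁, ?_⟩
  refine (hsNorm_sub_le_of_tsum_le hsC.isCompleteOrthonormal (by positivity) (by positivity)
    (by positivity) s1 s2).trans ?_
  gcongr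
  -- The bound already holds without the factor `1 + δ_s`, which is at least one.
  calc _ ≤ ENNReal.ofReal (√(2 * (k * k + 1) * (a + b)) + 1) * 1 := by
        rw [mul_one]; exact ENNReal.ofReal_le_ofReal (by linarith)
    _ ≤ _ := by gcongr; exact le_self_add
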